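/- **Setting.** Fix integers $k,m\ge 1$. Let $s$ be a real or a complex variable and let $F$ be the algebra of smooth complex-valued functions of $s$ (entire functions, if $s$ is complex). The variables are $\boldsymbol t=(t_1,t_2,\dots)$, $\bar{\boldsymbol t}=(\bar t_1,\bar t_2,\dots)$, $\boldsymbol x=(x_1,x_2,\dots)$, with the identifications $\bar t_{nm}=t_{nk}$ for $n\ge 1$ (one and the same variable) and $x_0=s$. "Function" means a formal power series in the independent variables among $t_i,\bar t_j,x_l$ with coefficients in $F$. Let $(\Lambda f)(s)=f(s+1)$. For a difference operator $A=\sum_{i\in\mathbb Z}a_i\Lambda^i$ put $A_+=\sum_{i\ge0}a_i\Lambda^i$ and $A_-=\sum_{i<0}a_i\Lambda^i$; products are determined by $(a\Lambda^i)(b\Lambda^j)=a\,(\Lambda^i b)\,\Lambda^{i+j}$, and derivatives of operators are taken coefficient by coefficient. **The hierarchy.** A solution of the extended bigraded Toda hierarchy (EBTH) consists of operators $$L=\Lambda^k+u_{k-1}\Lambda^{k-1}+\dots+u_{-m}\Lambda^{-m},\qquad W=1+\sum_{i\ge1}w_i\Lambda^{-i},\qquad \bar W=\sum_{i\ge0}\bar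 w_i\Lambda^i,$$ with $u_{-m}$ and $\bar w_0$ invertible, such that $L=W\Lambda^kW^{-1}=\bar W\Lambda^{-m}\bar W^{-1}$ and, with $$L^{n/k}=W\Lambda^nW^{-1},\qquad L^{n/m}=\bar W\Lambda^{-n}\bar W^{-1},\qquad \log L=-\tfrac12(\partial_sW)W^{-1}+\tfrac12(\partial_s\bar W)\bar W^{-1},$$ for each of the pairs $$(\partial,B)=(\partial_{t_n},L^{n/k})\ (n\ge1),\qquad (\partial_{\bar t_n},L^{n/m})\ (n\ge1),\qquad (\partial_{x_n},2L^n\log L)\ (n\ge0)$$ one has $$\partial L=[B_+,L],\qquad \partial W=-B_-W,\qquad \partial\bar W=B_+\bar W .$$ **Notation.** Let $[\zeta]=(\zeta,\zeta^2/2,\zeta^3/3,\dots)$. In $\tau(s,\boldsymbol t\pm[z^{-1}],\bar{\boldsymbol t},\boldsymbol x)$ all variables $t_i$, including $t_{nk}=\bar t_{nm}$, are shifted, and the $\bar t_j$ with $m\nmid j$ are not; in $\tau(s,\boldsymbol t,\bar{\boldsymbol t}\pm[z],\boldsymbol x)$ all variables $\bar t_j$, including $\bar t_{nm}=t_{nk}$,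 are shifted, and the $t_i$ with $k\nmid i$ are not. Let $$\xi(\boldsymbol t,z)=\sum_{i\ge1}t_iz^i,\qquad \xi_k(\boldsymbol t,z)=\sum_{n\ge1}t_{nk}z^{nk},\qquad \xi_m(\bar{\boldsymbol t},z^{-1})=\sum_{n\ge1}\bar t_{nm}z^{-nm},$$ $$\chi=z^{s+\xi(\boldsymbol x,z^k)}e^{\xi(\boldsymbol t,z)-\frac12\xi_k(\boldsymbol t,z)},\qquad \bar\chi=z^{s+\xi(\boldsymbol x,z^{-m})}e^{-\xi(\bar{\boldsymbol t},z^{-1})+\frac12\xi_m(\bar{\boldsymbol t},z^{-1})}.$$ Let $\tau=\tau(s,\boldsymbol t,\bar{\boldsymbol t},\boldsymbol x)$ be a function, invertible in the sense that $\tau(s,\boldsymbol 0,\boldsymbol 0,\boldsymbol 0)\ne0$ for every $s$. It is a *tau-function of the EBTH* if there is a solution of the EBTH whose wave functions $\psi=W\chi=\bigl(1+\sum_{i\ge1}w_iz^{-i}\bigr)\chi$ and $\bar\psi=\bar W\bar\chi=\bigl(\sum_{i\ge0}\bar w_iz^i\bigr)\bar\chi$ are $$\psi=\frac{\tau(s,\boldsymbol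 t-[z^{-1}],\bar{\boldsymbol t},\boldsymbol x)}{\tau(s,\boldsymbol t,\bar{\boldsymbol t},\boldsymbol x)}\,\chi,\qquad \bar\psi=\frac{\tau(s+1,\boldsymbol t,\bar{\boldsymbol t}+[z],\boldsymbol x)}{\tau(s,\boldsymbol t,\bar{\boldsymbol t},\boldsymbol x)}\,\bar\chi .$$ **Theorem.** An invertible function $\tau$ is a tau-function of the EBTH if and only if $$\begin{aligned} \oint\frac{dz}{2\pi\mathrm i}\,&z^{nk+s'-s}\,e^{\xi(\boldsymbol t'-\boldsymbol t,z)-\frac12\xi_k(\boldsymbol t'-\boldsymbol t,z)}\, \tau(s'-\xi(\boldsymbol a,z^k),\boldsymbol t'-[z^{-1}],\bar{\boldsymbol t}',\boldsymbol x+\boldsymbol a)\, \tau(s-\xi(\boldsymbol b,z^k),\boldsymbol t+[z^{-1}],\bar{\boldsymbol t},\boldsymbol x+\boldsymbol b)\\ =\oint\frac{dz}{2\pi\mathrm i}\,&z^{-nm+s'-s}\,e^{\xi(\bar{\boldsymbol t}-\bar{\boldsymbol t}',z^{-1})-\frac12\xi_m(\bar{\boldsymbol t}-\bar{\boldsymbol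 t}',z^{-1})}\, \tau(s'+1-\xi(\boldsymbol a,z^{-m}),\boldsymbol t',\bar{\boldsymbol t}'+[z],\boldsymbol x+\boldsymbol a)\, \tau(s-1-\xi(\boldsymbol b,z^{-m}),\boldsymbol t,\bar{\boldsymbol t}-[z],\boldsymbol x+\boldsymbol b) \end{aligned}$$ for all $\boldsymbol a=(a_1,a_2,\dots)$, $\boldsymbol b=(b_1,b_2,\dots)$, all integers $n\ge0$, and all $s,s'$ with $s-s'\in\mathbb Z$. The identity is one of formal power series in the independent variables among $t'_i,\bar t'_j,t_i,\bar t_j,x_l,a_l,b_l$ (where also $\bar t'_{nm}=t'_{nk}$) with coefficients functions of $s$. Shifts of $s$ by $-\xi(\boldsymbol a,\cdot)$ and $-\xi(\boldsymbol b,\cdot)$ are expanded by Taylor's formula. The coefficient of each monomial is a Laurent series in $z^{-1}$ on the left and in $z$ on the right, and $\oint\frac{dz}{2\pi\mathrm i}$ takes the coefficient of $z^{-1}$. -/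

import Mathlib

open scoped ContDiff

namespace EBTH

noncomputable section

/-! ### Functions of the variable `s`

`𝕜` is `ℝ` or `ℂ`; the coefficient functions are the smooth complex-valued functions of `s : 𝕜`
(for `𝕜 = ℂ` these are the entire functions). -/

section FunctionsOfS

variable (𝕜 : Type*) [RCLike 𝕜] [NormedAlgebra 𝕜 ℂ]

/-- The algebra of smooth complex-valued functions of `s : 𝕜`. -/
def SFun : Subalgebra ℂ (𝕜 → ℂ) where
  carrier := {f | ContDiff 𝕜 ∞ f}
  mul_mem' := fun {f g} hf hg => by
    rw [Set.mem_ofPred_eq] at hf hg ⊢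
    exact hf.mul hg
  add_mem' := fun {f g} hf hg => by
    rw [Set.mem_ofPred_eq] at hf hg ⊢
    exact hf.add hg
  algebraMap_mem' := fun c => by
    rw [Set.mem_ofPred_eq]
    exact contDiff_const (c := c)

variable {𝕜}

theorem mem_SFun {f : 𝕜 → ℂ} : f ∈ SFun 𝕜 ↔ ContDiff 𝕜 ∞ f := Iff.rfl

theorem contDiff_SFun (f : SFun 𝕜) : ContDiff 𝕜 ∞ (f : 𝕜 → ℂ) := mem_SFun.1 f.2

/-- The derivative `∂_s f`. -/
def sDeriv (f : SFun 𝕜) : SFun 𝕜 :=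
  ⟨deriv (f : 𝕜 → ℂ), mem_SFun.2 (contDiff_infty_iff_deriv.1 (contDiff_SFun f)).2⟩

/-- The translation `(Λ ^ j f)(s) = f (s + j)`, for an integer `j`. -/
def sShift (j : ℤ) : SFun 𝕜 →+* SFun 𝕜 where
  toFun f := ⟨fun s => (f : 𝕜 → ℂ) (s + j),
    mem_SFun.2 ((contDiff_SFun f).comp (contDiff_id.add contDiff_const))⟩
  map_one' := rfl
  map_mul' _ _ := rfl
  map_zero' := rfl
  map_add' _ _ := rfl

end FunctionsOfS

/-! ### The variables -/

/-- The time variables: `t i` for `i ≥ 1`, and `tbar j` for `j ≥ 1` not divisible by `m`.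
The variables `tbar (n * m)` are identified with `t (n * k)`, see `Time.tb`. -/
inductive Time (m : ℕ+) : Type
  | t (i : ℕ+) : Time m
  | tbar (j : ℕ+) (hj : ¬ m ∣ j) : Time m

open Classical in
/-- The variable `tbar j` for arbitrary `j ≥ 1`: if `j = m * n`, it is the variable `t (k * n)`. -/
def Time.tb (k m : ℕ+) (j : ℕ+) : Time m :=
  if h : m ∣ j then Time.t (k * PNat.divExact j m) else Time.tbar j h

/-- All the variables of a tau-function besides `s`: the time variables, and the logarithmic
variables `x l`, `l ≥ 1`; the variable `x 0` is identified with `s`. -/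
inductive Var (m : ℕ+) : Type
  | time (v : Time m) : Var m
  | x (l : ℕ+) : Var m

/-- The variables of the bilinear equation: two copies of the time variables (primed and unprimed),
and the variables `x`, `a`, `b`. -/
inductive BVar (m : ℕ+) : Type
  | primed (v : Time m) : BVar m
  | unprimed (v : Time m) : BVar m
  | x (l : ℕ+) : BVar m
  | a (l : ℕ+) : BVar m
  | b (l : ℕ+) : BVar m

/-- Functions of `s` and the variables in `σ`: formal power series in the variables in `σ`
whose coefficients are functions of `s`. -/
abbrev Fn (𝕜 : Type*) [RCLike 𝕜] [NormedAlgebra 𝕜 ℂ] (σ : Type) : Type _ :=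
  MvPowerSeries σ (SFun 𝕜)

variable {𝕜 : Type*} [RCLike 𝕜] [NormedAlgebra 𝕜 ℂ] {k m : ℕ+} {σ : Type}

/-- The derivative `∂_s`, coefficient by coefficient. -/
def Fn.dS (f : Fn 𝕜 σ) : Fn 𝕜 σ := fun d => sDeriv (MvPowerSeries.coeff d f)

/-- The translation `s ↦ s + j`, coefficient by coefficient. -/
def Fn.shiftS (j : ℤ) (f : Fn 𝕜 σ) : Fn 𝕜 σ := MvPowerSeries.map (sShift j) f

/-- The derivative with respect to the variable `v`. -/
def Fn.dVar (v : σ) (f : Fn 𝕜 σ) : Fn 𝕜 σ := MvPowerSeries.pderiv (SFun 𝕜) v f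

/-- The derivative `∂_{x_n}` for `n ≥ 0`, where `x_0 = s`. -/
def Fn.dX (n : ℕ) (f : Fn 𝕜 (Var m)) : Fn 𝕜 (Var m) :=
  if h : 0 < n then f.dVar (Var.x ⟨n, h⟩) else f.dS

/-! ### Difference operators -/

/-- Formal difference operators `∑ i ∈ ℤ, A i * Λ ^ i`. -/
abbrev DiffOp (𝕜 : Type*) [RCLike 𝕜] [NormedAlgebra 𝕜 ℂ] (m : ℕ+) : Type _ :=
  ℤ → Fn 𝕜 (Var m)

namespace DiffOp

/-- Powers of `Λ` bounded from below. -/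
def BddBelow (A : DiffOp 𝕜 m) : Prop := ∃ N : ℤ, ∀ i < N, A i = 0

/-- Powers of `Λ` bounded from above. -/
def BddAbove (A : DiffOp 𝕜 m) : Prop := ∃ N : ℤ, ∀ i > N, A i = 0

/-- The product, determined by `(a Λ ^ i) (b Λ ^ j) = a (Λ ^ i b) Λ ^ (i + j)`. For two operators
bounded on the same side, or if one of the two is bounded on both sides, the sum is finite. -/
def mul (A B : DiffOp 𝕜 m) : DiffOp 𝕜 m :=
  fun p => ∑ᶠ i : ℤ, A i * (B (p - i)).shiftS i

/-- The operator `Λ ^ n`. -/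
def Lam (n : ℤ) : DiffOp 𝕜 m := Pi.single n 1

/-- The powers of an operator. -/
def npow (A : DiffOp 𝕜 m) : ℕ → DiffOp 𝕜 m
  | 0 => Lam 0
  | n + 1 => mul A (npow A n)

/-- The projection `A_+` to nonnegative powers of `Λ`. -/
def pos (A : DiffOp 𝕜 m) : DiffOp 𝕜 m := fun i => if 0 ≤ i then A i else 0

/-- The projection `A_-` to negative powers of `Λ`. -/
def neg (A : DiffOp 𝕜 m) : DiffOp 𝕜 m := fun i => if i < 0 then A i else 0

/-- The commutator. -/
def comm (A B : DiffOp 𝕜 m) : DiffOp 𝕜 m := mul A B - mul B A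

/-- Apply an operation on functions to the coefficients of a difference operator. -/
def onCoeffs (D : Fn 𝕜 (Var m) → Fn 𝕜 (Var m)) (A : DiffOp 𝕜 m) : DiffOp 𝕜 m := fun i => D (A i)

/-- `∂ A` for the time variable `v`. -/
def dTime (v : Time m) (A : DiffOp 𝕜 m) : DiffOp 𝕜 m := A.onCoeffs (Fn.dVar (Var.time v))

/-- `∂_{x_n} A` for `n ≥ 0`, where `x_0 = s`. -/
def dX (n : ℕ) (A : DiffOp 𝕜 m) : DiffOp 𝕜 m := A.onCoeffs (Fn.dX n)

end DiffOp

open DiffOp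

/-! ### The hierarchy -/

/-- `L` is a Lax operator `Λ ^ k + u_{k-1} Λ ^ (k-1) + ⋯ + u_{-m} Λ ^ (-m)` with
`u_{-m}` nowhere zero. -/
structure IsLaxOperator (k : ℕ+) (L : DiffOp 𝕜 m) : Prop where
  top : ∀ i : ℤ, (k : ℤ) < i → L i = 0
  leading : L (k : ℤ) = 1
  bot : ∀ i : ℤ, i < -(m : ℤ) → L i = 0
  trailing : IsUnit (L (-(m : ℤ)))

/-- `W = 1 + ∑ i ≥ 1, w_i Λ ^ (-i)`, with inverse `Winv` among the operators whose powers of `Λ`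
are bounded from above. -/
structure IsWaveOperator (W Winv : DiffOp 𝕜 m) : Prop where
  leading : W 0 = 1
  top : ∀ i : ℤ, 0 < i → W i = 0
  inv_bdd : Winv.BddAbove
  mul_inv : mul W Winv = Lam 0
  inv_mul : mul Winv W = Lam 0

/-- `Wb = ∑ i ≥ 0, wbar_i Λ ^ i` with `wbar_0` nowhere zero, and with inverse `Wbinv` among the
operators whose powers of `Λ` are bounded from below. -/
structure IsBarWaveOperator (Wb Wbinv : DiffOp 𝕜 m) : Prop where
  leading : IsUnit (Wb 0)
  bot : ∀ i : ℤ, i < 0 → Wb i = 0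
  inv_bdd : Wbinv.BddBelow
  mul_inv : mul Wb Wbinv = Lam 0
  inv_mul : mul Wbinv Wb = Lam 0

/-- The fractional power `L ^ (n / k) = W Λ ^ n W⁻¹`. -/
def powK (W Winv : DiffOp 𝕜 m) (n : ℕ+) : DiffOp 𝕜 m := mul (mul W (Lam (n : ℤ))) Winv

/-- The fractional power `L ^ (n / m) = Wb Λ ^ (-n) Wb⁻¹`. -/
def powM (Wb Wbinv : DiffOp 𝕜 m) (n : ℕ+) : DiffOp 𝕜 m := mul (mul Wb (Lam (-(n : ℤ)))) Wbinv

/-- `log L = - (1/2) (∂_s W) W⁻¹ + (1/2) (∂_s Wb) Wb⁻¹`. -/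
def logL (W Winv Wb Wbinv : DiffOp 𝕜 m) : DiffOp 𝕜 m :=
  -((1 / 2 : ℂ) • mul (W.onCoeffs Fn.dS) Winv) + (1 / 2 : ℂ) • mul (Wb.onCoeffs Fn.dS) Wbinv

/-- `2 L ^ n log L`. -/
def twoPowLog (L W Winv Wb Wbinv : DiffOp 𝕜 m) (n : ℕ) : DiffOp 𝕜 m :=
  (2 : ℂ) • mul (L.npow n) (logL W Winv Wb Wbinv)

/-- The Lax operator `L` with wave operators `W`, `Wb` is a solution of the extended bigraded Toda
hierarchy: `L = W Λ ^ k W⁻¹ = Wb Λ ^ (-m) Wb⁻¹`, `L` satisfies the Lax equations, and `W`, `Wb`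
evolve by the corresponding flows. -/
structure IsSolution (k : ℕ+) (L W Winv Wb Wbinv : DiffOp 𝕜 m) : Prop where
  lax : IsLaxOperator k L
  wave : IsWaveOperator W Winv
  barWave : IsBarWaveOperator Wb Wbinv
  dress : L = mul (mul W (Lam (k : ℤ))) Winv
  barDress : L = mul (mul Wb (Lam (-(m : ℤ)))) Wbinv
  -- the Lax equations
  lax_t : ∀ n : ℕ+, L.dTime (Time.t n) = comm (powK W Winv n).pos L
  lax_tbar : ∀ n : ℕ+, L.dTime (Time.tb k m n) = comm (powM Wb Wbinv n).pos L
  lax_x : ∀ n : ℕ, L.dX n = comm (twoPowLog L W Winv Wb Wbinv n).pos L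
  -- the flows of the wave operators
  wave_t : ∀ n : ℕ+, W.dTime (Time.t n) = -mul (powK W Winv n).neg W
  wave_tbar : ∀ n : ℕ+, W.dTime (Time.tb k m n) = -mul (powM Wb Wbinv n).neg W
  wave_x : ∀ n : ℕ, W.dX n = -mul (twoPowLog L W Winv Wb Wbinv n).neg W
  barWave_t : ∀ n : ℕ+, Wb.dTime (Time.t n) = mul (powK W Winv n).pos Wb
  barWave_tbar : ∀ n : ℕ+, Wb.dTime (Time.tb k m n) = mul (powM Wb Wbinv n).pos Wb
  barWave_x : ∀ n : ℕ, Wb.dX n = mul (twoPowLog L W Winv Wb Wbinv n).pos Wb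

/-! ### Shifts of the arguments

The variable `none : Option σ` plays the role of a formal parameter `ζ`, which is `z⁻¹` for the
expansions at `z = ∞` and `z` for the expansions at `z = 0`. -/

/-- The increment that adding `ε [ζ] = ε (ζ, ζ ^ 2 / 2, ζ ^ 3 / 3, …)` to the sequence of time
variables `p 1, p 2, …` causes in the time variable `v`. The sequences used are `Time.t` and
`Time.tb k m`, which have no repetitions. -/
def bracket (p : ℕ+ → Time m) (ε : ℂ) (v : Time m) : Fn 𝕜 (Option σ) :=
  ∑ᶠ (j : ℕ+) (_ : p j = v), (ε / (j : ℂ)) • MvPowerSeries.X none ^ (j : ℕ)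

/-- The values to be substituted for the variables of a function: `T v + h v` for a time variable
`v`, and `X l` for `x l`. -/
def point (T : Time m → σ) (h : Time m → Fn 𝕜 (Option σ)) (X : ℕ+ → Fn 𝕜 (Option σ)) :
    Var m → Fn 𝕜 (Option σ)
  | Var.time v => MvPowerSeries.X (some (T v)) + h v
  | Var.x l => X l

/-- The coefficient of `ζ ^ N`. -/
def zetaCoeff (N : ℕ) (f : Fn 𝕜 (Option σ)) : Fn 𝕜 σ :=
  fun d => MvPowerSeries.coeff
    (d.embDomain Function.Embedding.some + Finsupp.single none N) f

/-- The function of `s, t, tbar, x, ζ` obtained from `τ` by adding `ε [ζ]` to the sequence `p` of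
time variables. -/
def tauShift (p : ℕ+ → Time m) (ε : ℂ) (τ : Fn 𝕜 (Var m)) : Fn 𝕜 (Option (Var m)) :=
  MvPowerSeries.subst
    (point Var.time (bracket p ε) fun l => MvPowerSeries.X (some (Var.x l))) τ

/-- `τ` is a tau-function of the hierarchy: there is a solution whose wave functions
`ψ = W χ = w χ` and `ψbar = Wb χbar = wbar χbar` are
`ψ = τ(s, t - [z⁻¹], tbar, x) / τ(s, t, tbar, x) * χ` and
`ψbar = τ(s + 1, t, tbar + [z], x) / τ(s, t, tbar, x) * χbar`.
Here `w = ∑ i ≥ 0, W (-i) z ^ (-i)` and `wbar = ∑ i ≥ 0, Wb i z ^ i` are the symbols of the wave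
operators; after division by the common formal factors `χ` and `χbar`, and multiplication by `τ`
(invertible wherever this is used), the two equations are equalities of formal power series in
`z⁻¹` and `z`, respectively. -/
def IsTauFunction (k : ℕ+) (τ : Fn 𝕜 (Var m)) : Prop :=
  ∃ L W Winv Wb Wbinv : DiffOp 𝕜 m, IsSolution k L W Winv Wb Wbinv ∧
    (∀ i : ℕ, τ * W (-(i : ℤ)) = zetaCoeff i (tauShift Time.t (-1) τ)) ∧
    (∀ i : ℕ, τ * Wb (i : ℤ) = zetaCoeff i (tauShift (Time.tb k m) 1 (τ.shiftS 1)))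

/-! ### The bilinear equation -/

/-- Formal power series in the variables in `σ` whose coefficients are Laurent series in `ζ` (with
finitely many negative powers of `ζ`) over the functions of `s`. -/
abbrev LFn (𝕜 : Type*) [RCLike 𝕜] [NormedAlgebra 𝕜 ℂ] (σ : Type) : Type _ :=
  MvPowerSeries σ (LaurentSeries (SFun 𝕜))

/-- The monomial `ζ ^ e`, for an integer `e`. -/
def zeta (𝕜 : Type*) [RCLike 𝕜] [NormedAlgebra 𝕜 ℂ] (e : ℤ) : LaurentSeries (SFun 𝕜) :=
  HahnSeries.single e 1

/-- View a power series in `ζ` and the variables in `σ` as a power series in the variables in `σ`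
with coefficients in the Laurent series in `ζ`. -/
def toLFn (f : Fn 𝕜 (Option σ)) : LFn 𝕜 σ :=
  fun d => HahnSeries.ofPowerSeries ℤ (SFun 𝕜)
    (PowerSeries.mk fun N => MvPowerSeries.coeff d (zetaCoeff N f))

open Classical in
/-- The formal linear combination `∑ i ≥ 1, c i * v i` of variables. -/
def linSum (v : ℕ+ → σ) (c : ℕ+ → LaurentSeries (SFun 𝕜)) : LFn 𝕜 σ :=
  fun d => ∑ᶠ i : ℕ+, if d = Finsupp.single (v i) 1 then c i else 0

/-- `exp E`, for `E` with zero constant term. -/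
def lexp (E : LFn 𝕜 σ) : LFn 𝕜 σ := PowerSeries.subst E (PowerSeries.exp ℂ)

/-- The value of `τ` at `s + j + η` and at the point `P`, where `j` is an integer and `η` has zero
constant term, by Taylor's formula `∑ r ≥ 0, η ^ r / r! * (∂_s ^ r τ)(s + j, P)`. In the
coefficient of a monomial of degree `N`, only the terms with `r ≤ N` contribute. -/
def tauAt (τ : Fn 𝕜 (Var m)) (j : ℤ) (η : LFn 𝕜 σ) (P : Var m → Fn 𝕜 (Option σ)) : LFn 𝕜 σ :=
  fun d => ∑ r ∈ Finset.range (d.degree + 1), MvPowerSeries.coeff d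
    ((1 / (r.factorial : ℂ)) • (η ^ r *
      toLFn (MvPowerSeries.subst P ((Fn.dS^[r] τ).shiftS j))))

/-- `x + a`, as values to be substituted for the variables `x`. -/
def xPlusA (l : ℕ+) : Fn 𝕜 (Option (BVar m)) :=
  MvPowerSeries.X (some (BVar.x l)) + MvPowerSeries.X (some (BVar.a l))

/-- `x + b`, as values to be substituted for the variables `x`. -/
def xPlusB (l : ℕ+) : Fn 𝕜 (Option (BVar m)) :=
  MvPowerSeries.X (some (BVar.x l)) + MvPowerSeries.X (some (BVar.b l))

/-- `ξ(t', z) - ξ_k(t', z) / 2`, or the same for `t` instead of `t'`, depending on the copy `T` of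
the time variables; here `ζ = z⁻¹`. -/
def xiT (𝕜 : Type*) [RCLike 𝕜] [NormedAlgebra 𝕜 ℂ] (k : ℕ+) (T : Time m → BVar m) :
    LFn 𝕜 (BVar m) :=
  linSum (fun i => T (Time.t i)) (fun i => zeta 𝕜 (-(i : ℤ)))
    - (1 / 2 : ℂ) • linSum (fun n => T (Time.t (n * k))) (fun n => zeta 𝕜 (-((n * k : ℕ+) : ℤ)))

/-- `ξ(tbar', z⁻¹) - ξ_m(tbar', z⁻¹) / 2`, or the same for `tbar` instead of `tbar'`, depending on
the copy `T` of the time variables; here `ζ = z`. -/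
def xiTbar (𝕜 : Type*) [RCLike 𝕜] [NormedAlgebra 𝕜 ℂ] (k : ℕ+) (T : Time m → BVar m) :
    LFn 𝕜 (BVar m) :=
  linSum (fun i => T (Time.tb k m i)) (fun i => zeta 𝕜 (-(i : ℤ)))
    - (1 / 2 : ℂ) •
      linSum (fun n => T (Time.tb k m (n * m))) (fun n => zeta 𝕜 (-((n * m : ℕ+) : ℤ)))

/-- The integrand of the left-hand side of the bilinear equation, expanded at `z = ∞`, with
`ζ = z⁻¹` and `s' = s + j`:
`z ^ (n k + s' - s) exp (ξ(t' - t, z) - ξ_k(t' - t, z) / 2)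
  * τ(s' - ξ(a, z ^ k), t' - [z⁻¹], tbar', x + a) * τ(s - ξ(b, z ^ k), t + [z⁻¹], tbar, x + b)`. -/
def bilinearLeft (k : ℕ+) (τ : Fn 𝕜 (Var m)) (n : ℕ) (j : ℤ) : LFn 𝕜 (BVar m) :=
  MvPowerSeries.C (zeta 𝕜 (-(n * k + j)))
    * lexp (xiT 𝕜 k BVar.primed - xiT 𝕜 k BVar.unprimed)
    * tauAt τ j (-linSum BVar.a fun l => zeta 𝕜 (-(k * l : ℤ)))
        (point BVar.primed (bracket Time.t (-1)) xPlusA)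
    * tauAt τ 0 (-linSum BVar.b fun l => zeta 𝕜 (-(k * l : ℤ)))
        (point BVar.unprimed (bracket Time.t 1) xPlusB)

/-- The integrand of the right-hand side of the bilinear equation, expanded at `z = 0`, with
`ζ = z` and `s' = s + j`:
`z ^ (- n m + s' - s) exp (ξ(tbar - tbar', z⁻¹) - ξ_m(tbar - tbar', z⁻¹) / 2)
  * τ(s' + 1 - ξ(a, z ^ (-m)), t', tbar' + [z], x + a)
  * τ(s - 1 - ξ(b, z ^ (-m)), t, tbar - [z], x + b)`. -/
def bilinearRight (k : ℕ+) (τ : Fn 𝕜 (Var m)) (n : ℕ) (j : ℤ) : LFn 𝕜 (BVar m) :=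
  MvPowerSeries.C (zeta 𝕜 (-(n * m) + j))
    * lexp (xiTbar 𝕜 k BVar.unprimed - xiTbar 𝕜 k BVar.primed)
    * tauAt τ (j + 1) (-linSum BVar.a fun l => zeta 𝕜 (-(m * l : ℤ)))
        (point BVar.primed (bracket (Time.tb k m) 1) xPlusA)
    * tauAt τ (-1) (-linSum BVar.b fun l => zeta 𝕜 (-(m * l : ℤ)))
        (point BVar.unprimed (bracket (Time.tb k m) (-1)) xPlusB)

/-- The formal contour integral `∮ dz / (2 π i)` of an expansion at `z = ∞`, with `ζ = z⁻¹`: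
the coefficient of `z⁻¹ = ζ`. -/
def residueInfty (f : LFn 𝕜 σ) : Fn 𝕜 σ := fun d => (MvPowerSeries.coeff d f).coeff 1

/-- The formal contour integral `∮ dz / (2 π i)` of an expansion at `z = 0`, with `ζ = z`:
the coefficient of `z⁻¹ = ζ⁻¹`. -/
def residueZero (f : LFn 𝕜 σ) : Fn 𝕜 σ := fun d => (MvPowerSeries.coeff d f).coeff (-1)

/-- The bilinear equation for `τ`, for all `n ≥ 0` and all integers `j = s' - s`, as an identity of
functions of `s` and formal power series in `t', tbar', t, tbar, x, a, b`. -/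
def SatisfiesBilinear (k : ℕ+) (τ : Fn 𝕜 (Var m)) : Prop :=
  ∀ (n : ℕ) (j : ℤ), residueInfty (bilinearLeft k τ n j) = residueZero (bilinearRight k τ n j)

end

end EBTH

/-!
# Tau-functions of the extended bigraded Toda hierarchy

The bilinear equation is an equation for power series in `t', tbar', t, tbar, x, a, b`, while a
solution of the hierarchy consists of difference operators whose coefficients are power series in
`t, tbar, x`. The two are related by restriction to the diagonal `t' = t`, `tbar' = tbar`,
`a = b = 0`: a power series vanishes if and only if all its iterated derivatives with respect to
`t'`, `tbar'`, `a` and `b` vanish on the diagonal (`eq_zero_of_forall_diag_eq_zero`).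

On the diagonal the exponentials are equal to `1`, and the coefficient of `z⁻¹` in a product of two
symbols becomes a coefficient of a product of two difference operators. Let `X` and `Xb` be the
operators with the symbols `τ(s, t - [z⁻¹])` and `τ(s + 1, tbar + [z])`, and let `Y` and `Yb` be the
operators with `τ(s, t + [z⁻¹])` and `τ(s - 1, tbar - [z])` as symbols with the coefficients to the
right of the powers of `Λ`. Restricted to the diagonal, for all `s'` at once, the bilinear equation
is `X Λ ^ (n k) Y = Xb Λ ^ (-n m) Yb`. A derivative with respect to `t'`, `tbar'` or `a` of the left
side replaces `X` by `∂_v X + r X Λ ^ i` (`timeD`) or by `∂_{x_l} X - (∂_s X) Λ ^ (k l)` (`logD`),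
with analogous expressions for `Xb`; a derivative with respect to `b` acts on `Y` in a similar way
(`dualLogD`). This is the content of `satisfiesBilinear_of_pairs` and
`SatisfiesBilinear.operators`.

If `W` and `Wb` are dressing operators with `W Λ ^ k W⁻¹ = Wb Λ ^ (-m) Wb⁻¹`, then the flow
`∂ W = -B_- W`, `∂ Wb = B_+ Wb` says that `(∂ W) W⁻¹ + B = (∂ Wb) Wb⁻¹` (`IsFlow`), since the first
term on the left has only negative powers of `Λ` and the right-hand side only nonnegative ones. For
`B = L ^ (n / k)` and `B = L ^ (n / m)` this equation is what the first derivative of the bilinear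
equation with respect to a time variable says about `X = τ W` and `Xb = τ Wb`
(`timeRel_iff_isFlow`): for the common variables `t_{nk} = tbar_{nm}` both exponents contribute one
half of `L ^ n`. For `B = 2 L ^ l log L` it is what the first derivative with respect to `a_l` says
(`logRel_iff_isFlow`).

*A tau-function satisfies the bilinear equation* (`IsTauFunction.satisfiesBilinear`). The pairs
`(A W, A Wb)` and `(W⁻¹ A, Wb⁻¹ A)` with a common finite operator `A` are preserved by the
operations on `X` and `Y`, by the flows, and all products of the former, `Λ ^ (n k)` or
`Λ ^ (-n m)`, and the latter agree. One has `(X, Xb) = (τ W, τ Wb)`. It remains to show that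
`(Y, Yb)` is of the second form with `A = τ(s + 1) Λ`, that is, to find the symbols of `W⁻¹` and
`Wb⁻¹` (`inv_symbol`). To this end the operation `∂ + Λ ^ i`, which preserves the first family of
pairs, is applied repeatedly to construct a member with the first component
`∑ S_{N - p}(W) Λ ^ p`, where `S_N f` is the coefficient of `z ^ (-N)` in `f(t + [z⁻¹])`. Its
product with `W⁻¹` has no negative powers of `Λ`; the vanishing of the coefficient of `Λ⁻¹` for all
`N` determines `W⁻¹`, because the shifts by `[z⁻¹]` and `-[z⁻¹]` are inverse to each other.

*A solution of the bilinear equation is a tau-function* (`SatisfiesBilinear.isTauFunction`). For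
`n = 0` the equation `X Y = Xb Yb` holds between an operator with powers of `Λ` at most one and an
operator with powers at least one, so both are equal to `τ τ(s + 1) Λ`. Therefore `W = τ⁻¹ X` and
`Wb = τ⁻¹ Xb` are invertible with inverses given by `Y` and `Yb`. The case `n = 1` gives
`W Λ ^ k W⁻¹ = Wb Λ ^ (-m) Wb⁻¹`, and the first derivatives for `n = 0` give the flows.
-/

namespace EBTH

noncomputable section

open DiffOp

/-! ### Continuity of maps between rings of power series -/

section FinDep

open MvPowerSeries

variable {σ' τ' υ' R S T : Type*} [CommRing R] [CommRing S] [CommRing T]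

/-- Every coefficient of `δ f` is determined by finitely many coefficients of `f`. This is
continuity for the product topologies of the discrete topologies on `R` and `S`. -/
def FinDep (δ : MvPowerSeries σ' R → MvPowerSeries τ' S) : Prop :=
  ∀ d, ∃ E : Finset (σ' →₀ ℕ), ∀ f g : MvPowerSeries σ' R,
    (∀ e ∈ E, coeff e f = coeff e g) → coeff d (δ f) = coeff d (δ g)

theorem finDep_id : FinDep (fun f : MvPowerSeries σ' R => f) := fun d =>
  ⟨{d}, fun _ _ h => h d (by simp)⟩

theorem FinDep.comp {δ : MvPowerSeries τ' S → MvPowerSeries υ' T}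
    {η : MvPowerSeries σ' R → MvPowerSeries τ' S} (hδ : FinDep δ) (hη : FinDep η) :
    FinDep (fun f => δ (η f)) := by
  classical
  intro d
  obtain ⟨E, hE⟩ := hδ d
  choose F hF using hη
  refine ⟨E.biUnion F, fun f g h => hE _ _ fun e he => hF e f g fun e' he' => h e' ?_⟩
  exact Finset.mem_biUnion.2 ⟨e, he, he'⟩

theorem FinDep.sub {δ η : MvPowerSeries σ' R → MvPowerSeries τ' S} (hδ : FinDep δ)
    (hη : FinDep η) : FinDep (fun f => δ f - η f) := by
  classical
  intro d
  obtain ⟨E, hE⟩ := hδ d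
  obtain ⟨F, hF⟩ := hη d
  refine ⟨E ∪ F, fun f g h => ?_⟩
  rw [map_sub, map_sub, hE f g fun e he => h e (Finset.mem_union_left _ he),
    hF f g fun e he => h e (Finset.mem_union_right _ he)]

theorem FinDep.const_mul (c : MvPowerSeries τ' S) {δ : MvPowerSeries σ' R → MvPowerSeries τ' S}
    (hδ : FinDep δ) : FinDep (fun f => c * δ f) := by
  classical
  intro d
  choose E hE using hδ
  refine ⟨(Finset.HasAntidiagonal.antidiagonal d).biUnion fun p => E p.2, fun f g h => ?_⟩
  rw [coeff_mul, coeff_mul]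
  refine Finset.sum_congr rfl fun p hp => ?_
  rw [hE p.2 f g fun e he => h e (Finset.mem_biUnion.2 ⟨p, hp, he⟩)]

theorem FinDep.sum {ι : Type*} (s : Finset ι) {δ : ι → MvPowerSeries σ' R → MvPowerSeries τ' S}
    (hδ : ∀ i, FinDep (δ i)) : FinDep (fun f => ∑ i ∈ s, δ i f) := by
  classical
  intro d
  choose E hE using fun i => hδ i d
  refine ⟨s.biUnion E, fun f g h => ?_⟩
  rw [map_sum, map_sum]
  exact Finset.sum_congr rfl fun i hi => hE i f g fun e he =>
    h e (Finset.mem_biUnion.2 ⟨i, hi, he⟩)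

/-- A map acting on a finite number of coefficients is continuous. -/
theorem FinDep.of_coeff {δ : MvPowerSeries σ' R → MvPowerSeries τ' S} (c : (τ' →₀ ℕ) → σ' →₀ ℕ)
    (F : (τ' →₀ ℕ) → R → S) (h : ∀ d f, coeff d (δ f) = F d (coeff (c d) f)) : FinDep δ :=
  fun d => ⟨{c d}, fun f g hfg => by rw [h, h, hfg _ (by simp)]⟩

theorem FinDep.pderiv (v : σ') : FinDep (fun f : MvPowerSeries σ' R => pderiv R v f) :=
  .of_coeff (fun d => d + Finsupp.single v 1) (fun d x => x * (d v + 1))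
    fun d f => coeff_pderiv f d

theorem FinDep.subst [Algebra R S] {P : σ' → MvPowerSeries τ' S} (hP : HasSubst P) :
    FinDep (fun f : MvPowerSeries σ' R => subst P f) := by
  intro d
  have hfin := coeff_subst_finite (R := S) hP (fun _ => 1) d
  refine ⟨hfin.toFinset, fun f g h => ?_⟩
  rw [coeff_subst hP, coeff_subst hP]
  refine finsum_congr fun e => ?_
  by_cases he : e ∈ hfin.toFinset
  · rw [h e he]
  · have : coeff d (e.prod fun s n => P s ^ n) = 0 := by
      have h1 : ¬ (coeff e (fun _ => (1 : S) : MvPowerSeries σ' S) •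
          coeff d (e.prod fun s n => P s ^ n) ≠ 0) := by
        intro h2
        exact he (hfin.mem_toFinset.2 h2)
      have h3 : coeff e (fun _ => (1 : S) : MvPowerSeries σ' S) = 1 := rfl
      rwa [h3, one_smul, not_not] at h1
    rw [this, smul_zero, smul_zero]

/-- Polynomials are dense. -/
theorem exists_mvPolynomial_coeff_eq (E : Finset (σ' →₀ ℕ)) (f : MvPowerSeries σ' R) :
    ∃ p : MvPolynomial σ' R, ∀ e ∈ E, coeff e (p : MvPowerSeries σ' R) = coeff e f := by
  classical
  refine ⟨∑ e ∈ E, MvPolynomial.monomial e (coeff e f), fun e he => ?_⟩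
  rw [MvPolynomial.coeff_coe, MvPolynomial.coeff_sum]
  simp only [MvPolynomial.coeff_monomial]
  rw [Finset.sum_ite_eq' E e, if_pos he]

/-- Continuous ring homomorphisms which agree on constants and variables are equal. -/
theorem FinDep.ringHom_ext {φ ψ : MvPowerSeries σ' R →+* MvPowerSeries τ' S}
    (hφ : FinDep φ) (hψ : FinDep ψ) (hC : ∀ c, φ (C c) = ψ (C c)) (hX : ∀ v, φ (X v) = ψ (X v)) :
    φ = ψ := by
  classical
  have hpoly : φ.comp (MvPolynomial.coeToMvPowerSeries.ringHom (σ := σ') (R := R)) =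
      ψ.comp (MvPolynomial.coeToMvPowerSeries.ringHom (σ := σ') (R := R)) := by
    refine MvPolynomial.ringHom_ext (fun c => ?_) fun v => ?_
    · simpa using hC c
    · simpa using hX v
  ext f d
  obtain ⟨E, hE⟩ := hφ d
  obtain ⟨F, hF⟩ := hψ d
  obtain ⟨p, hp⟩ := exists_mvPolynomial_coeff_eq (E ∪ F) f
  rw [← hE p f fun e he => hp e (Finset.mem_union_left _ he),
    ← hF p f fun e he => hp e (Finset.mem_union_right _ he)]
  exact congrArg (coeff d) (RingHom.congr_fun hpoly p)

/-- Let `δ` be a continuous derivation along a ring homomorphism `φ` which vanishes on constants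
and maps the variables into an ideal `J`. Then the coefficients that vanish on `J` vanish
on all values of `δ`. -/
theorem FinDep.coeff_derivation_eq_zero {φ : MvPowerSeries σ' R →+* MvPowerSeries τ' S}
    {δ : MvPowerSeries σ' R → MvPowerSeries τ' S} (hadd : ∀ f g, δ (f + g) = δ f + δ g)
    (hmul : ∀ f g, δ (f * g) = φ f * δ g + φ g * δ f) (hfin : FinDep δ) (hC : ∀ c, δ (C c) = 0)
    (J : Ideal (MvPowerSeries τ' S)) (hX : ∀ v, δ (X v) ∈ J) (d : τ' →₀ ℕ)
    (hd : ∀ f ∈ J, coeff d f = 0) (f : MvPowerSeries σ' R) : coeff d (δ f) = 0 := by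
  have key : ∀ p : MvPolynomial σ' R, δ p ∈ J := by
    intro p
    induction p using MvPolynomial.induction_on with
    | C c => rw [MvPolynomial.coe_C, hC]; exact J.zero_mem
    | add p q hp hq => rw [MvPolynomial.coe_add, hadd]; exact J.add_mem hp hq
    | mul_X p v hp =>
      rw [MvPolynomial.coe_mul, hmul, MvPolynomial.coe_X]
      exact J.add_mem (J.mul_mem_left _ (hX v)) (J.mul_mem_left _ hp)
  obtain ⟨E, hE⟩ := hfin d
  obtain ⟨p, hp⟩ := exists_mvPolynomial_coeff_eq E f
  rw [← hE p f hp, hd _ (key p)]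

theorem FinDep.derivation_eq_zero {φ : MvPowerSeries σ' R →+* MvPowerSeries τ' S}
    {δ : MvPowerSeries σ' R → MvPowerSeries τ' S} (hadd : ∀ f g, δ (f + g) = δ f + δ g)
    (hmul : ∀ f g, δ (f * g) = φ f * δ g + φ g * δ f) (hfin : FinDep δ) (hC : ∀ c, δ (C c) = 0)
    (hX : ∀ v, δ (X v) = 0) (f : MvPowerSeries σ' R) : δ f = 0 := by
  ext d
  exact hfin.coeff_derivation_eq_zero hadd hmul hC ⊥ (fun v => by simp [hX v]) d
    (fun g hg => by rw [Ideal.mem_bot.1 hg, map_zero]) f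

end FinDep

/-! ### Operations on functions -/

section Operations

variable {𝕜 : Type*} [RCLike 𝕜] [NormedAlgebra 𝕜 ℂ] {k m : ℕ+} {σ : Type}

theorem contDiff_differentiableAt (f : SFun 𝕜) (s : 𝕜) : DifferentiableAt 𝕜 (f : 𝕜 → ℂ) s :=
  ((contDiff_SFun f).differentiable (by simp)).differentiableAt

theorem sDeriv_add (f g : SFun 𝕜) : sDeriv (f + g) = sDeriv f + sDeriv g := by
  ext s
  exact deriv_add (contDiff_differentiableAt f s) (contDiff_differentiableAt g s)

theorem sDeriv_mul (f g : SFun 𝕜) : sDeriv (f * g) = f * sDeriv g + g * sDeriv f := by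
  ext s
  refine (deriv_mul (contDiff_differentiableAt f s) (contDiff_differentiableAt g s)).trans ?_
  change deriv (f : 𝕜 → ℂ) s * (g : 𝕜 → ℂ) s + (f : 𝕜 → ℂ) s * deriv (g : 𝕜 → ℂ) s
    = (f : 𝕜 → ℂ) s * deriv (g : 𝕜 → ℂ) s + (g : 𝕜 → ℂ) s * deriv (f : 𝕜 → ℂ) s
  ring

theorem sDeriv_algebraMap (c : ℂ) : sDeriv (algebraMap ℂ (SFun 𝕜) c) = 0 := by
  ext s
  exact deriv_const s c

theorem sShift_sDeriv (j : ℤ) (f : SFun 𝕜) : sShift j (sDeriv f) = sDeriv (sShift j f) := by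
  ext s
  exact (deriv_comp_add_const (f := (f : 𝕜 → ℂ)) (j : 𝕜) s).symm

theorem sShift_sShift (i j : ℤ) (f : SFun 𝕜) : sShift i (sShift j f) = sShift (i + j) f := by
  ext s
  change (f : 𝕜 → ℂ) (s + i + j) = (f : 𝕜 → ℂ) (s + ((i + j : ℤ) : 𝕜))
  push_cast
  rw [add_assoc]

theorem sShift_zero (f : SFun 𝕜) : sShift 0 f = f := by
  ext s
  change (f : 𝕜 → ℂ) (s + ((0 : ℤ) : 𝕜)) = _
  simp

/-- `∂_s` as a derivation of the algebra of functions of `s`. -/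
def sDer (𝕜 : Type*) [RCLike 𝕜] [NormedAlgebra 𝕜 ℂ] : Derivation ℂ (SFun 𝕜) (SFun 𝕜) :=
  .mk' { toFun := sDeriv
         map_add' := sDeriv_add
         map_smul' := fun c f => by
          rw [Algebra.smul_def, sDeriv_mul, sDeriv_algebraMap, mul_zero, add_zero,
            RingHom.id_apply, Algebra.smul_def] }
    fun f g => sDeriv_mul f g

/-- `∂_s` as a derivation of power series. -/
def dSDer (𝕜 : Type*) [RCLike 𝕜] [NormedAlgebra 𝕜 ℂ] (σ : Type) :
    Derivation ℂ (Fn 𝕜 σ) (Fn 𝕜 σ) :=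
  .mk' { toFun := Fn.dS
         map_add' := fun f g => by
          ext1 d
          exact sDeriv_add _ _
         map_smul' := fun c f => by
          ext1 d
          exact (sDer 𝕜).map_smul c (MvPowerSeries.coeff d f) }
    fun f g => by
      classical
      ext1 d
      change sDer 𝕜 (MvPowerSeries.coeff d (f * g)) = _
      rw [MvPowerSeries.coeff_mul, map_sum, smul_eq_mul, smul_eq_mul, mul_comm g, map_add,
        MvPowerSeries.coeff_mul, MvPowerSeries.coeff_mul, ← Finset.sum_add_distrib]
      refine Finset.sum_congr rfl fun p _ => ?_
      rw [Derivation.leibniz, smul_eq_mul, smul_eq_mul, mul_comm (MvPowerSeries.coeff p.2 g)]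
      rfl

@[simp] theorem dSDer_apply (f : Fn 𝕜 σ) : dSDer 𝕜 σ f = f.dS := rfl

/-- `∂_v` as a derivation over `ℂ`. -/
def dVarDer (𝕜 : Type*) [RCLike 𝕜] [NormedAlgebra 𝕜 ℂ] (v : σ) :
    Derivation ℂ (Fn 𝕜 σ) (Fn 𝕜 σ) :=
  (MvPowerSeries.pderiv (SFun 𝕜) v).restrictScalars ℂ

@[simp] theorem dVarDer_apply (v : σ) (f : Fn 𝕜 σ) : dVarDer 𝕜 v f = f.dVar v := rfl

theorem coeff_dS (f : Fn 𝕜 σ) (d : σ →₀ ℕ) :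
    MvPowerSeries.coeff d f.dS = sDeriv (MvPowerSeries.coeff d f) := rfl

theorem coeff_shiftS (j : ℤ) (f : Fn 𝕜 σ) (d : σ →₀ ℕ) :
    MvPowerSeries.coeff d (f.shiftS j) = sShift j (MvPowerSeries.coeff d f) := rfl

theorem coeff_dVar (v : σ) (f : Fn 𝕜 σ) (d : σ →₀ ℕ) : MvPowerSeries.coeff d (f.dVar v) =
    MvPowerSeries.coeff (d + Finsupp.single v 1) f * (d v + 1) := MvPowerSeries.coeff_pderiv f d

theorem dVar_dS (v : σ) (f : Fn 𝕜 σ) : (f.dS).dVar v = (f.dVar v).dS := by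
  ext1 d
  rw [coeff_dVar, coeff_dS, coeff_dS, coeff_dVar, sDeriv_mul]
  have : sDeriv ((d v : SFun 𝕜) + 1) = 0 := by
    have := sDeriv_algebraMap (𝕜 := 𝕜) ((d v : ℂ) + 1)
    rwa [map_add, map_natCast, map_one] at this
  rw [this, mul_zero, zero_add, mul_comm]

theorem shiftS_dS (j : ℤ) (f : Fn 𝕜 σ) : (f.dS).shiftS j = (f.shiftS j).dS := by
  ext1 d
  exact sShift_sDeriv j _

theorem shiftS_dVar (j : ℤ) (v : σ) (f : Fn 𝕜 σ) : (f.dVar v).shiftS j = (f.shiftS j).dVar v := by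
  ext1 d
  simp only [coeff_dVar, coeff_shiftS, map_mul, map_add, map_natCast, map_one]

theorem shiftS_shiftS (i j : ℤ) (f : Fn 𝕜 σ) : (f.shiftS j).shiftS i = f.shiftS (i + j) := by
  ext1 d
  exact sShift_sShift i j _

@[simp] theorem shiftS_zero_index (f : Fn 𝕜 σ) : f.shiftS 0 = f := by
  ext1 d
  exact sShift_zero _

@[simp] theorem shiftS_one (j : ℤ) : (1 : Fn 𝕜 σ).shiftS j = 1 := map_one (MvPowerSeries.map _)

@[simp] theorem shiftS_zero (j : ℤ) : (0 : Fn 𝕜 σ).shiftS j = 0 := map_zero (MvPowerSeries.map _)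

theorem shiftS_add (j : ℤ) (f g : Fn 𝕜 σ) : (f + g).shiftS j = f.shiftS j + g.shiftS j :=
  map_add (MvPowerSeries.map _) f g

theorem shiftS_mul (j : ℤ) (f g : Fn 𝕜 σ) : (f * g).shiftS j = f.shiftS j * g.shiftS j :=
  map_mul (MvPowerSeries.map _) f g

theorem shiftS_smul (j : ℤ) (c : ℂ) (f : Fn 𝕜 σ) : (c • f).shiftS j = c • f.shiftS j := rfl

theorem FinDep.shiftS (j : ℤ) : FinDep (fun f : Fn 𝕜 σ => f.shiftS j) :=
  .of_coeff id (fun _ => sShift j) fun _ _ => rfl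

theorem FinDep.dS : FinDep (fun f : Fn 𝕜 σ => f.dS) :=
  .of_coeff id (fun _ => sDeriv) fun _ _ => rfl

/-- The coefficients with respect to `ζ`, as a power series in `ζ`. -/
def zetaSeries (𝕜 : Type*) [RCLike 𝕜] [NormedAlgebra 𝕜 ℂ] (σ : Type) :
    Fn 𝕜 (Option σ) →ₐ[SFun 𝕜] PowerSeries (Fn 𝕜 σ) :=
  (MvPowerSeries.optionEquivLeft σ (SFun 𝕜)).toAlgHom

theorem coeff_zetaCoeff (N : ℕ) (f : Fn 𝕜 (Option σ)) (d : σ →₀ ℕ) :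
    MvPowerSeries.coeff d (zetaCoeff N f) = MvPowerSeries.coeff
      (d.embDomain Function.Embedding.some + Finsupp.single none N) f := rfl

theorem embDomain_add_single_none (N : ℕ) (d : σ →₀ ℕ) :
    d.embDomain Function.Embedding.some + Finsupp.single none N = d.optionElim N := by
  ext (_ | a)
  · rw [Finsupp.add_apply, Finsupp.optionElim_apply_none, Finsupp.single_eq_same,
      Finsupp.embDomain_of_notMem_range _ _ _ (by simp), zero_add]
  · rw [Finsupp.add_apply, Finsupp.optionElim_apply_some, Finsupp.single_eq_of_ne (by simp),
      add_zero]
    exact Finsupp.embDomain_apply_self Function.Embedding.some d a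

theorem coeff_zetaSeries (N : ℕ) (f : Fn 𝕜 (Option σ)) :
    PowerSeries.coeff N (zetaSeries 𝕜 σ f) = zetaCoeff N f := by
  ext1 d
  rw [coeff_zetaCoeff, embDomain_add_single_none]
  exact MvPowerSeries.coeff_coeff_optionEquivLeft f N d

theorem zetaCoeff_mul (N : ℕ) (f g : Fn 𝕜 (Option σ)) :
    zetaCoeff N (f * g) = ∑ p ∈ Finset.HasAntidiagonal.antidiagonal N, zetaCoeff p.1 f * zetaCoeff p.2 g := by
  simp_rw [← coeff_zetaSeries, map_mul, PowerSeries.coeff_mul]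

theorem zetaCoeff_smul (N : ℕ) (c : ℂ) (f : Fn 𝕜 (Option σ)) :
    zetaCoeff N (c • f) = c • zetaCoeff N f := rfl

theorem zetaCoeff_dVar (N : ℕ) (v : σ) (f : Fn 𝕜 (Option σ)) :
    zetaCoeff N (f.dVar (some v)) = (zetaCoeff N f).dVar v := by
  ext1 d
  simp only [coeff_dVar, coeff_zetaCoeff]
  have h1 : (Finsupp.embDomain Function.Embedding.some (d + Finsupp.single v 1) : Option σ →₀ ℕ)
      = Finsupp.embDomain Function.Embedding.some d + Finsupp.single (some v) 1 := by
    rw [Finsupp.embDomain_add, Finsupp.embDomain_single]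
    rfl
  rw [h1, add_right_comm]
  congr 3
  rw [embDomain_add_single_none, Finsupp.optionElim_apply_some]

theorem zetaCoeff_dVar_none (N : ℕ) (f : Fn 𝕜 (Option σ)) :
    zetaCoeff N (f.dVar none) = (N + 1 : ℂ) • zetaCoeff (N + 1) f := by
  ext1 d
  change _ = (N + 1 : ℂ) • MvPowerSeries.coeff d (zetaCoeff (N + 1) f)
  rw [coeff_zetaCoeff, coeff_zetaCoeff, coeff_dVar, add_assoc, ← Finsupp.single_add,
    embDomain_add_single_none N d, Finsupp.optionElim_apply_none, Algebra.smul_def, mul_comm,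
    map_add, map_natCast, map_one]

theorem zetaCoeff_dS (N : ℕ) (f : Fn 𝕜 (Option σ)) : zetaCoeff N f.dS = (zetaCoeff N f).dS := rfl

theorem zetaCoeff_shiftS (N : ℕ) (j : ℤ) (f : Fn 𝕜 (Option σ)) :
    zetaCoeff N (f.shiftS j) = (zetaCoeff N f).shiftS j := rfl

theorem FinDep.zetaCoeff (N : ℕ) : FinDep (fun f : Fn 𝕜 (Option σ) => zetaCoeff N f) :=
  .of_coeff (fun d => d.embDomain Function.Embedding.some + Finsupp.single none N)
    (fun _ => id) fun _ _ => rfl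

end Operations

variable {𝕜 : Type*} [RCLike 𝕜] [NormedAlgebra 𝕜 ℂ] {k m : ℕ+} {σ : Type}

/-! ### Substitutions and derivations -/

section Subst

open MvPowerSeries

variable {σ' : Type} {P : σ' → Fn 𝕜 σ}

theorem subst_derivation_eq_zero (hP : HasSubst P)
    {δ : Fn 𝕜 σ' → Fn 𝕜 σ} (hadd : ∀ f g, δ (f + g) = δ f + δ g)
    (hmul : ∀ f g, δ (f * g) = subst P f * δ g + subst P g * δ f) (hfin : FinDep δ)
    (hC : ∀ c, δ (C c) = 0) (hX : ∀ v, δ (X v) = 0) (f : Fn 𝕜 σ') : δ f = 0 :=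
  hfin.derivation_eq_zero (φ := (substAlgHom hP : Fn 𝕜 σ' →ₐ[SFun 𝕜] Fn 𝕜 σ).toRingHom) hadd
    (fun f g => by simpa using hmul f g) hC hX f

theorem dVar_add (v : σ) (f g : Fn 𝕜 σ) : (f + g).dVar v = f.dVar v + g.dVar v :=
  map_add (dVarDer 𝕜 v) f g

theorem dVar_sub (v : σ) (f g : Fn 𝕜 σ) : (f - g).dVar v = f.dVar v - g.dVar v :=
  map_sub (dVarDer 𝕜 v) f g

theorem dVar_smul (v : σ) (c : ℂ) (f : Fn 𝕜 σ) : (c • f).dVar v = c • f.dVar v :=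
  (dVarDer 𝕜 v).map_smul c f

theorem dVar_mul (v : σ) (f g : Fn 𝕜 σ) : (f * g).dVar v = f * g.dVar v + g * f.dVar v :=
  (dVarDer 𝕜 v).leibniz f g

theorem dVar_C (v : σ) (c : SFun 𝕜) : Fn.dVar v (C c : Fn 𝕜 σ) = 0 := pderiv_C

theorem dVar_X_self (v : σ) : Fn.dVar v (X v : Fn 𝕜 σ) = 1 := pderiv_X_self

theorem dVar_X_of_ne {v w : σ} (h : w ≠ v) : Fn.dVar v (X w : Fn 𝕜 σ) = 0 := pderiv_X_of_ne h

theorem dS_add (f g : Fn 𝕜 σ) : (f + g).dS = f.dS + g.dS := map_add (dSDer 𝕜 σ) f g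

theorem dS_smul (c : ℂ) (f : Fn 𝕜 σ) : (c • f).dS = c • f.dS := (dSDer 𝕜 σ).map_smul c f

theorem dS_mul (f g : Fn 𝕜 σ) : (f * g).dS = f * g.dS + g * f.dS := (dSDer 𝕜 σ).leibniz f g

theorem dS_X (v : σ) : Fn.dS (X v : Fn 𝕜 σ) = 0 := by
  classical
  ext1 d
  rw [coeff_dS, coeff_X, map_zero]
  split_ifs
  · exact (sDer 𝕜).map_one_eq_zero
  · exact map_zero (sDer 𝕜)

theorem dS_C (c : SFun 𝕜) : Fn.dS (C c : Fn 𝕜 σ) = C (sDeriv c) := by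
  classical
  ext1 d
  rw [coeff_dS, coeff_C, coeff_C]
  split_ifs
  · rfl
  · exact map_zero (sDer 𝕜)

theorem shiftS_X (j : ℤ) (v : σ) : Fn.shiftS j (X v : Fn 𝕜 σ) = X v := map_X _ _

theorem dVar_subst_eq_zero (hP : HasSubst P) (w : σ) (h : ∀ u, (P u).dVar w = 0) (f : Fn 𝕜 σ') :
    Fn.dVar w (subst P f : Fn 𝕜 σ) = 0 := by
  refine subst_derivation_eq_zero hP (δ := fun f => Fn.dVar w (subst P f : Fn 𝕜 σ))
    (fun f g => ?_) (fun f g => ?_) ?_ (fun c => ?_) (fun v => ?_) f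
  · simp only [subst_add hP, dVar_add]
  · simp only [subst_mul hP, dVar_mul]
  · exact (FinDep.pderiv w).comp (FinDep.subst hP)
  · rw [subst_C, dVar_C]
  · rw [subst_X hP, h]

/-- Chain rule for a variable that occurs only in the value substituted for `v`, linearly. -/
theorem dVar_subst (hP : HasSubst P) (w : σ) (v : σ') (h1 : (P v).dVar w = 1)
    (h : ∀ u, u ≠ v → (P u).dVar w = 0) (f : Fn 𝕜 σ') :
    Fn.dVar w (subst P f : Fn 𝕜 σ) = subst P (f.dVar v) := by
  rw [← sub_eq_zero]
  refine subst_derivation_eq_zero hP (δ := fun f => Fn.dVar w (subst P f : Fn 𝕜 σ)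
    - subst P (f.dVar v)) (fun f g => ?_) (fun f g => ?_) ?_ (fun c => ?_) (fun u => ?_) f
  · simp only [subst_add hP, dVar_add]
    ring
  · simp only [subst_mul hP, subst_add hP, dVar_mul]
    ring
  · exact ((FinDep.pderiv w).comp (FinDep.subst hP)).sub ((FinDep.subst hP).comp (FinDep.pderiv v))
  · rw [subst_C, dVar_C, dVar_C, ← coe_substAlgHom hP, map_zero, sub_zero]
  · rw [subst_X hP]
    by_cases hu : u = v
    · rw [hu, h1, dVar_X_self, ← coe_substAlgHom hP, map_one, sub_self]
    · rw [h u hu, dVar_X_of_ne hu, ← coe_substAlgHom hP, map_zero, sub_zero]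

theorem dS_subst (hP : HasSubst P) (h : ∀ u, (P u).dS = 0) (f : Fn 𝕜 σ') :
    Fn.dS (subst P f : Fn 𝕜 σ) = subst P f.dS := by
  rw [← sub_eq_zero]
  refine subst_derivation_eq_zero hP (δ := fun f => Fn.dS (subst P f : Fn 𝕜 σ) - subst P f.dS)
    (fun f g => ?_) (fun f g => ?_) ?_ (fun c => ?_) (fun u => ?_) f
  · simp only [subst_add hP, dS_add]
    ring
  · simp only [subst_mul hP, subst_add hP, dS_mul]
    ring
  · exact (FinDep.dS.comp (FinDep.subst hP)).sub ((FinDep.subst hP).comp FinDep.dS)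
  · rw [subst_C, dS_C, dS_C, subst_C, sub_self]
  · rw [subst_X hP, h, dS_X, ← coe_substAlgHom hP, map_zero, sub_zero]

theorem shiftS_subst (hP : HasSubst P) (j : ℤ) (h : ∀ u, (P u).shiftS j = P u) (f : Fn 𝕜 σ') :
    Fn.shiftS j (subst P f : Fn 𝕜 σ) = subst P (f.shiftS j) := by
  have := FinDep.ringHom_ext
    (φ := (MvPowerSeries.map (sShift j)).comp
      (substAlgHom hP : Fn 𝕜 σ' →ₐ[SFun 𝕜] Fn 𝕜 σ).toRingHom)
    (ψ := (substAlgHom hP : Fn 𝕜 σ' →ₐ[SFun 𝕜] Fn 𝕜 σ).toRingHom.comp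
      (MvPowerSeries.map (sShift j)))
    (by simpa using! (FinDep.shiftS j).comp (FinDep.subst hP))
    (by simpa using! (FinDep.subst hP).comp (FinDep.shiftS j))
    (fun c => by simp) (fun v => by simpa [subst_X hP] using! h v)
  simpa using! RingHom.congr_fun this f

end Subst

/-! ### The shifts `t ↦ t ± [z⁻¹]` -/

section Bracket

open MvPowerSeries

variable {p : ℕ+ → Time m}

theorem bracket_apply (hp : p.Injective) (ε : ℂ) (j : ℕ+) :
    (bracket p ε (p j) : Fn 𝕜 (Option σ)) = (ε / (j : ℂ)) • X none ^ (j : ℕ) := by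
  classical
  rw [bracket, finsum_eq_single _ j]
  · rw [finsum_eq_if, if_pos rfl]
  · intro i hi
    rw [finsum_eq_if, if_neg (fun h => hi (hp h))]

theorem bracket_eq_zero (ε : ℂ) {v : Time m} (hv : ∀ j, p j ≠ v) :
    (bracket p ε v : Fn 𝕜 (Option σ)) = 0 := by
  classical
  rw [bracket]
  refine finsum_eq_zero_of_forall_eq_zero fun j => ?_
  rw [finsum_eq_if, if_neg (hv j)]

theorem exists_of_coeff_bracket_ne_zero (hp : p.Injective) {ε : ℂ} {v : Time m}
    {d : Option σ →₀ ℕ} (h : coeff d (bracket p ε v : Fn 𝕜 (Option σ)) ≠ 0) :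
    ∃ j, p j = v ∧ d = Finsupp.single none (j : ℕ) := by
  classical
  by_cases hv : ∃ j, p j = v
  · obtain ⟨j, rfl⟩ := hv
    refine ⟨j, rfl, ?_⟩
    by_contra hd
    refine h ?_
    rw [bracket_apply hp]
    change (ε / (j : ℂ)) • coeff d (X none ^ (j : ℕ) : Fn 𝕜 (Option σ)) = 0
    rw [coeff_X_pow, if_neg hd, smul_zero]
  · push Not at hv
    rw [bracket_eq_zero ε hv, map_zero] at h
    exact absurd rfl h

theorem hasSubst_point (hp : p.Injective) (ε : ℂ) {T : Time m → σ} (hT : T.Injective)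
    {x : ℕ+ → Fn 𝕜 (Option σ)} (hx : HasSubst x) : HasSubst (point T (bracket p ε) x) := by
  classical
  refine ⟨?_, fun d => ?_⟩
  · rintro (v | l)
    · have h1 : constantCoeff (bracket p ε v : Fn 𝕜 (Option σ)) = 0 := by
        rw [← coeff_zero_eq_constantCoeff_apply]
        by_contra h
        obtain ⟨j, -, hj⟩ := exists_of_coeff_bracket_ne_zero hp h
        have := DFunLike.congr_fun hj none
        rw [Finsupp.single_eq_same, Finsupp.zero_apply] at this
        exact j.ne_zero this.symm
      simp [point, h1]
    · exact hx.1 l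
  · refine ((Set.Finite.union (s := {v | d = Finsupp.single (some (T v)) 1})
      (t := {v | ∃ j, p j = v ∧ d = Finsupp.single none (j : ℕ)}) ?_ ?_).image Var.time
        |>.union ((hx.2 d).image Var.x)).subset ?_
    · refine Set.Subsingleton.finite fun v hv w hw => ?_
      have := hv.symm.trans hw
      exact hT (Option.some_injective _ (Finsupp.single_left_injective one_ne_zero this))
    · refine Set.Subsingleton.finite ?_
      rintro v ⟨i, rfl, hi⟩ w ⟨j, rfl, hj⟩
      have := Finsupp.single_injective _ (hi.symm.trans hj)
      rw [PNat.coe_inj] at this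
      rw [this]
    · rintro (v | l) h
      · left
        refine ⟨v, ?_, rfl⟩
        by_cases h1 : d = Finsupp.single (some (T v)) 1
        · exact Or.inl h1
        · refine Or.inr (exists_of_coeff_bracket_ne_zero (ε := ε) (𝕜 := 𝕜) (σ := σ) hp ?_)
          intro h2
          apply h
          change coeff d (X (some (T v)) + bracket p ε v) = 0
          rw [map_add, h2, coeff_X, if_neg h1, add_zero]
      · exact Or.inr ⟨l, h, rfl⟩

theorem dS_bracket (hp : p.Injective) (ε : ℂ) (v : Time m) :
    (bracket p ε v : Fn 𝕜 (Option σ)).dS = 0 := by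
  by_cases hv : ∃ j, p j = v
  · obtain ⟨j, rfl⟩ := hv
    rw [bracket_apply hp, dS_smul, ← dSDer_apply, Derivation.leibniz_pow, dSDer_apply, dS_X]
    simp
  · push Not at hv
    rw [bracket_eq_zero ε hv]
    exact map_zero (dSDer 𝕜 _)

theorem shiftS_bracket (hp : p.Injective) (ε : ℂ) (j : ℤ) (v : Time m) :
    (bracket p ε v : Fn 𝕜 (Option σ)).shiftS j = bracket p ε v := by
  by_cases hv : ∃ j, p j = v
  · obtain ⟨i, rfl⟩ := hv
    rw [bracket_apply hp, shiftS_smul]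
    congr 1
    refine (map_pow (MvPowerSeries.map (sShift j)) _ _).trans ?_
    rw [map_X]
  · push Not at hv
    rw [bracket_eq_zero ε hv, shiftS_zero]

theorem dVar_some_bracket (hp : p.Injective) (ε : ℂ) (w : σ) (v : Time m) :
    (bracket p ε v : Fn 𝕜 (Option σ)).dVar (some w) = 0 := by
  by_cases hv : ∃ j, p j = v
  · obtain ⟨j, rfl⟩ := hv
    rw [bracket_apply hp, dVar_smul, ← dVarDer_apply, Derivation.leibniz_pow, dVarDer_apply,
      dVar_X_of_ne (Option.some_ne_none w).symm]
    simp
  · push Not at hv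
    rw [bracket_eq_zero ε hv]
    exact map_zero (dVarDer 𝕜 _)

theorem dVar_none_bracket (hp : p.Injective) (ε : ℂ) (j : ℕ) :
    (bracket p ε (p j.succPNat) : Fn 𝕜 (Option σ)).dVar none = ε • X none ^ j := by
  rw [bracket_apply hp, dVar_smul, ← dVarDer_apply, Derivation.leibniz_pow, dVarDer_apply,
    dVar_X_self, Nat.succPNat_coe, Nat.succ_sub_one, smul_eq_mul, mul_one,
    ← Nat.cast_smul_eq_nsmul ℂ, smul_smul]
  congr 1
  have : ((j.succ : ℕ) : ℂ) ≠ 0 := Nat.cast_ne_zero.2 (Nat.succ_ne_zero j)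
  exact div_mul_cancel₀ _ this

theorem hasSubst_X_comp {ι : Type} {e : ι → σ} (he : e.Injective) :
    HasSubst (fun l => (X (e l) : Fn 𝕜 σ)) := by
  classical
  refine ⟨fun l => by simp, fun d => Set.Subsingleton.finite fun v hv w hw => ?_⟩
  simp only [Set.mem_ofPred_eq, coeff_X] at hv hw
  have h1 : d = Finsupp.single (e v) 1 := by
    by_contra h
    simp [h] at hv
  have h2 : d = Finsupp.single (e w) 1 := by
    by_contra h
    simp [h] at hw
  exact he (Finsupp.single_left_injective one_ne_zero (h1.symm.trans h2))

/-- The coefficient of `ζ ^ N` in `f(s, t + ε [ζ])`, where `ε [ζ]` is added to the variables `p`. -/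
def shiftCoeff (p : ℕ+ → Time m) (ε : ℂ) (N : ℕ) (f : Fn 𝕜 (Var m)) : Fn 𝕜 (Var m) :=
  zetaCoeff N (tauShift p ε f)

theorem hasSubst_tauShift (hp : p.Injective) (ε : ℂ) :
    HasSubst (point (𝕜 := 𝕜) Var.time (bracket p ε) fun l => X (some (Var.x l))) :=
  hasSubst_point hp ε (fun _ _ h => Var.time.inj h)
    (hasSubst_X_comp (e := fun l => some (Var.x l))
      fun _ _ h => Var.x.inj (Option.some_injective _ h))

theorem shiftCoeff_add (hp : p.Injective) (ε : ℂ) (N : ℕ) (f g : Fn 𝕜 (Var m)) :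
    shiftCoeff p ε N (f + g) = shiftCoeff p ε N f + shiftCoeff p ε N g := by
  rw [shiftCoeff, tauShift, subst_add (hasSubst_tauShift hp ε)]
  rfl

theorem shiftCoeff_smul (hp : p.Injective) (ε : ℂ) (N : ℕ) (c : ℂ) (f : Fn 𝕜 (Var m)) :
    shiftCoeff p ε N (c • f) = c • shiftCoeff p ε N f := by
  rw [shiftCoeff, tauShift, subst_smul (hasSubst_tauShift hp ε)]
  rfl

theorem shiftCoeff_mul (hp : p.Injective) (ε : ℂ) (N : ℕ) (f g : Fn 𝕜 (Var m)) :
    shiftCoeff p ε N (f * g) = ∑ q ∈ Finset.HasAntidiagonal.antidiagonal N,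
      shiftCoeff p ε q.1 f * shiftCoeff p ε q.2 g := by
  rw [shiftCoeff, tauShift, subst_mul (hasSubst_tauShift hp ε), zetaCoeff_mul]
  rfl

/-- The coefficients of `ζ ^ N` in `f(s, t + ε [ζ])`, as linear maps of `f`. -/
def shiftCoeffLin (hp : p.Injective) (ε : ℂ) (N : ℕ) : Fn 𝕜 (Var m) →ₗ[ℂ] Fn 𝕜 (Var m) where
  toFun := shiftCoeff p ε N
  map_add' := shiftCoeff_add hp ε N
  map_smul' := shiftCoeff_smul hp ε N

@[simp] theorem shiftCoeffLin_apply (hp : p.Injective) (ε : ℂ) (N : ℕ) (f : Fn 𝕜 (Var m)) :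
    shiftCoeffLin hp ε N f = shiftCoeff p ε N f := rfl

theorem shiftCoeff_zero_index (hp : p.Injective) (ε : ℂ) (f : Fn 𝕜 (Var m)) :
    shiftCoeff p ε 0 f = f := by
  have hP := hasSubst_tauShift (𝕜 := 𝕜) hp ε
  have h := FinDep.ringHom_ext
    (φ := (PowerSeries.constantCoeff (R := Fn 𝕜 (Var m))).comp
      ((zetaSeries 𝕜 (Var m)).toRingHom.comp
      (substAlgHom hP : Fn 𝕜 (Var m) →ₐ[SFun 𝕜] Fn 𝕜 (Option (Var m))).toRingHom))
    (ψ := RingHom.id _) ?_ finDep_id ?_ ?_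
  · have h1 := RingHom.congr_fun h f
    rw [RingHom.id_apply] at h1
    refine Eq.trans ?_ h1
    rw [shiftCoeff, tauShift, ← coeff_zetaSeries, PowerSeries.coeff_zero_eq_constantCoeff]
    simp
  · have h1 := (FinDep.zetaCoeff (𝕜 := 𝕜) (σ := Var m) 0).comp (FinDep.subst (R := SFun 𝕜) hP)
    simp only [← coeff_zetaSeries, PowerSeries.coeff_zero_eq_constantCoeff] at h1
    simpa using! h1
  · intro c
    simp [zetaSeries, optionEquivLeft_C]
  · have h2 : ∀ v, PowerSeries.constantCoeff (zetaSeries 𝕜 (Var m) (bracket p ε v)) = 0 := by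
      intro v
      by_cases hv : ∃ j, p j = v
      · obtain ⟨j, rfl⟩ := hv
        rw [bracket_apply hp, AlgHom.map_smul_of_tower, map_pow]
        simp [zetaSeries, optionEquivLeft_X_none]
      · push Not at hv
        simp [bracket_eq_zero ε hv]
    rintro (v | l)
    · simp only [RingHom.comp_apply, AlgHom.toRingHom_eq_coe, RingHom.coe_coe, substAlgHom_apply,
        subst_X hP, point, map_add, h2, RingHom.id_apply]
      simp [zetaSeries, optionEquivLeft_X_some]
    · simp [subst_X hP, point, zetaSeries, optionEquivLeft_X_some]

theorem dVar_some_tauShift (hp : p.Injective) (ε : ℂ) (v : Var m) (f : Fn 𝕜 (Var m)) :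
    (tauShift p ε f).dVar (some v) = tauShift p ε (f.dVar v) := by
  refine dVar_subst (hasSubst_tauShift hp ε) (some v) v ?_ ?_ f
  · obtain v | l := v
    · simp only [point, dVar_add, dVar_X_self, dVar_some_bracket hp, add_zero]
    · simp only [point, dVar_X_self]
  · rintro (u | u) hu
    · simp only [point, dVar_add, dVar_some_bracket hp, add_zero]
      exact dVar_X_of_ne fun h => hu (Option.some_injective _ h)
    · exact dVar_X_of_ne fun h => hu (Option.some_injective _ h)

theorem dS_tauShift (hp : p.Injective) (ε : ℂ) (f : Fn 𝕜 (Var m)) :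
    (tauShift p ε f).dS = tauShift p ε f.dS := by
  refine dS_subst (hasSubst_tauShift hp ε) ?_ f
  rintro (u | u)
  · simp only [point, dS_add, dS_X, dS_bracket hp, add_zero]
  · exact dS_X _

theorem shiftS_tauShift (hp : p.Injective) (ε : ℂ) (j : ℤ) (f : Fn 𝕜 (Var m)) :
    (tauShift p ε f).shiftS j = tauShift p ε (f.shiftS j) := by
  refine shiftS_subst (hasSubst_tauShift hp ε) j ?_ f
  rintro (u | u)
  · simp only [point, shiftS_add, shiftS_X, shiftS_bracket hp]
  · exact shiftS_X _ _

theorem shiftCoeff_dVar (hp : p.Injective) (ε : ℂ) (N : ℕ) (v : Var m) (f : Fn 𝕜 (Var m)) :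
    shiftCoeff p ε N (f.dVar v) = (shiftCoeff p ε N f).dVar v := by
  rw [shiftCoeff, ← dVar_some_tauShift hp, zetaCoeff_dVar]
  rfl

theorem shiftCoeff_dS (hp : p.Injective) (ε : ℂ) (N : ℕ) (f : Fn 𝕜 (Var m)) :
    shiftCoeff p ε N f.dS = (shiftCoeff p ε N f).dS := by
  rw [shiftCoeff, ← dS_tauShift hp, zetaCoeff_dS]
  rfl

theorem shiftCoeff_shiftS (hp : p.Injective) (ε : ℂ) (N : ℕ) (j : ℤ) (f : Fn 𝕜 (Var m)) :
    shiftCoeff p ε N (f.shiftS j) = (shiftCoeff p ε N f).shiftS j := by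
  rw [shiftCoeff, ← shiftS_tauShift hp, zetaCoeff_shiftS]
  rfl

theorem zetaCoeff_X_none_pow_mul (N i : ℕ) (f : Fn 𝕜 (Option σ)) :
    zetaCoeff N (X none ^ i * f) = if i ≤ N then zetaCoeff (N - i) f else 0 := by
  rw [← coeff_zetaSeries, ← coeff_zetaSeries, map_mul, map_pow, zetaSeries]
  simp [optionEquivLeft_X_none, PowerSeries.coeff_X_pow_mul']

/-- The `ζ`-derivative of `f(s, t + ε [ζ])`, by the chain rule. -/
theorem shiftCoeff_succ (hp : p.Injective) (ε : ℂ) (N : ℕ) (f : Fn 𝕜 (Var m)) :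
    (N + 1 : ℂ) • shiftCoeff p ε (N + 1) f = ε • ∑ i ∈ Finset.range (N + 1),
      shiftCoeff p ε (N - i) (f.dVar (Var.time (p i.succPNat))) := by
  have hP := hasSubst_tauShift (𝕜 := 𝕜) hp ε
  set J : Ideal (Fn 𝕜 (Option (Var m))) := Ideal.span {X none ^ (N + 1)} with hJ
  -- the chain rule is exact modulo `ζ ^ (N + 1)` if only the variables `p 1, …, p (N + 1)`
  -- are taken into account
  set δ : Fn 𝕜 (Var m) → Fn 𝕜 (Option (Var m)) := fun f => (tauShift p ε f).dVar none
    - ∑ i ∈ Finset.range (N + 1), (ε • X none ^ i) *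
        tauShift p ε (f.dVar (Var.time (p i.succPNat))) with hδ
  have hX1 : ∀ i : ℕ, tauShift p ε ((X (Var.time (p i.succPNat)) : Fn 𝕜 (Var m))) =
      X (some (Var.time (p i.succPNat))) + bracket p ε (p i.succPNat) := fun i => by
    rw [tauShift, subst_X hP]; rfl
  have hone : tauShift p ε (1 : Fn 𝕜 (Var m)) = 1 := by
    rw [tauShift, ← coe_substAlgHom hP, map_one]
  have hzero : tauShift p ε (0 : Fn 𝕜 (Var m)) = 0 := by
    rw [tauShift, ← coe_substAlgHom hP, map_zero]
  have key : ∀ d : Option (Var m) →₀ ℕ, d none < N + 1 → coeff d (δ f) = 0 := by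
    intro d hd
    refine FinDep.coeff_derivation_eq_zero (δ := δ) (J := J)
      (φ := (substAlgHom hP : Fn 𝕜 (Var m) →ₐ[SFun 𝕜] Fn 𝕜 (Option (Var m))).toRingHom)
      (fun f g => ?_) (fun f g => ?_) ?_ (fun c => ?_) (fun v => ?_) d (fun g hg => ?_) f
    · simp only [hδ, tauShift, subst_add hP, dVar_add, mul_add, Finset.sum_add_distrib]
      ring
    · simp only [hδ, tauShift, subst_add hP, subst_mul hP, mul_add, dVar_mul,
        Finset.sum_add_distrib, AlgHom.toRingHom_eq_coe, RingHom.coe_coe, substAlgHom_apply,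
        mul_sub, Finset.mul_sum]
      have : ∀ a b c : Fn 𝕜 (Option (Var m)), a * (b * c) = b * (a * c) := fun a b c => by ring
      simp only [this (subst _ f), this (subst _ g)]
      ring
    · refine ((FinDep.pderiv none).comp (FinDep.subst hP)).sub (FinDep.sum _ fun i => ?_)
      exact FinDep.const_mul _ ((FinDep.subst hP).comp (FinDep.pderiv _))
    · simp only [hδ, dVar_C, hzero, mul_zero, Finset.sum_const_zero, sub_zero]
      rw [tauShift, subst_C]
      exact dVar_C none c
    · simp only [hδ]
      by_cases hv : ∃ i : ℕ, v = Var.time (p i.succPNat)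
      · obtain ⟨i, rfl⟩ := hv
        rw [hX1, dVar_add, dVar_X_of_ne (by simp), zero_add, dVar_none_bracket hp]
        have h1 : ∀ i' ∈ Finset.range (N + 1), (ε • X none ^ i') *
            tauShift p ε (Fn.dVar (Var.time (p i'.succPNat))
              (X (Var.time (p i.succPNat)) : Fn 𝕜 (Var m))) = if i' = i then ε • X none ^ i' else 0 := by
          intro i' _
          split_ifs with h
          · rw [h, dVar_X_self, hone, mul_one]
          · rw [dVar_X_of_ne, hzero, mul_zero]
            intro h2
            exact h (Nat.succPNat_injective (hp (Var.time.inj h2))).symm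
        rw [Finset.sum_congr rfl h1, Finset.sum_ite_eq']
        split_ifs with h
        · rw [sub_self]
          exact J.zero_mem
        · rw [sub_zero, Algebra.smul_def]
          refine J.mul_mem_left _ (Ideal.mem_span_singleton.2 (pow_dvd_pow _ ?_))
          rw [Finset.mem_range] at h
          omega
      · have h1 : ∀ i : ℕ, Fn.dVar (Var.time (p i.succPNat)) (X v : Fn 𝕜 (Var m)) = 0 := fun i =>
          dVar_X_of_ne fun h => hv ⟨i, h⟩
        simp only [h1, hzero, mul_zero, Finset.sum_const_zero, sub_zero]
        rw [tauShift, subst_X hP]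
        obtain v | l := v
        · have h2 : ∀ j, p j ≠ v := fun j hj => hv ⟨j.natPred, by rw [PNat.succPNat_natPred, hj]⟩
          rw [point, bracket_eq_zero ε h2, add_zero, dVar_X_of_ne (by simp)]
          exact J.zero_mem
        · rw [point, dVar_X_of_ne (by simp)]
          exact J.zero_mem
    · exact X_pow_dvd_iff.1 (Ideal.mem_span_singleton.1 hg) d hd
  have hz : zetaCoeff N (δ f) = 0 := by
    ext1 d
    rw [coeff_zetaCoeff, map_zero]
    refine key _ ?_
    rw [embDomain_add_single_none, Finsupp.optionElim_apply_none]
    exact Nat.lt_succ_self N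
  rw [hδ, ← coeff_zetaSeries, map_sub, map_sub, sub_eq_zero, coeff_zetaSeries,
    zetaCoeff_dVar_none, map_sum, map_sum] at hz
  refine hz.trans ?_
  rw [Finset.smul_sum]
  refine Finset.sum_congr rfl fun i hi => ?_
  rw [coeff_zetaSeries, smul_mul_assoc, zetaCoeff_smul, zetaCoeff_X_none_pow_mul,
    if_pos (Nat.lt_succ_iff.1 (Finset.mem_range.1 hi))]
  rfl

end Bracket

/-! ### Coefficients of Laurent series -/

section LCoeff

open MvPowerSeries

/-- The coefficient of `ζ ^ i` in a power series with Laurent series as coefficients. -/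
def lcoeff (i : ℤ) (Z : LFn 𝕜 σ) : Fn 𝕜 σ := fun d => (coeff d Z).coeff i

theorem coeff_lcoeff (i : ℤ) (Z : LFn 𝕜 σ) (d : σ →₀ ℕ) :
    coeff d (lcoeff i Z) = (coeff d Z).coeff i := rfl

theorem residueInfty_eq (Z : LFn 𝕜 σ) : residueInfty Z = lcoeff 1 Z := rfl

theorem residueZero_eq (Z : LFn 𝕜 σ) : residueZero Z = lcoeff (-1) Z := rfl

theorem lcoeff_add (i : ℤ) (Z Z' : LFn 𝕜 σ) : lcoeff i (Z + Z') = lcoeff i Z + lcoeff i Z' := by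
  ext1 d
  simp only [coeff_lcoeff, map_add, HahnSeries.coeff_add]

theorem lcoeff_zero (i : ℤ) : lcoeff i (0 : LFn 𝕜 σ) = 0 := by
  ext1 d
  simp only [coeff_lcoeff, map_zero, HahnSeries.coeff_zero]

theorem algebraMap_laurentSeries (c : ℂ) : algebraMap ℂ (LaurentSeries (SFun 𝕜)) c =
    HahnSeries.C (algebraMap ℂ (SFun 𝕜) c) := by
  rw [HahnSeries.algebraMap_apply', PowerSeries.algebraMap_apply, HahnSeries.ofPowerSeries_C]

theorem LFn_smul_eq (c : ℂ) (Z : LFn 𝕜 σ) :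
    c • Z = C (HahnSeries.C (algebraMap ℂ (SFun 𝕜) c)) * Z := by
  rw [Algebra.smul_def, MvPowerSeries.algebraMap_apply, algebraMap_laurentSeries]

theorem lcoeff_smul (i : ℤ) (c : ℂ) (Z : LFn 𝕜 σ) : lcoeff i (c • Z) = c • lcoeff i Z := by
  ext1 d
  rw [LFn_smul_eq, coeff_lcoeff, coeff_C_mul, HahnSeries.C_mul_eq_smul, HahnSeries.coeff_smul,
    smul_eq_mul, ← Algebra.smul_def]
  rfl

theorem lcoeff_C_zeta_mul (i q : ℤ) (Z : LFn 𝕜 σ) :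
    lcoeff i (C (zeta 𝕜 q) * Z) = lcoeff (i - q) Z := by
  ext1 d
  rw [coeff_lcoeff, coeff_lcoeff, coeff_C_mul, zeta, HahnSeries.coeff_single_mul, one_mul]

theorem zeta_mul (q r : ℤ) : zeta 𝕜 q * zeta 𝕜 r = zeta 𝕜 (q + r) := by
  rw [zeta, zeta, HahnSeries.single_mul_single, one_mul, zeta]

/-- The coefficient of `ζ ^ i`, for an integer `i`, in a power series in `ζ`. -/
def zetaCoeffInt (i : ℤ) (f : Fn 𝕜 (Option σ)) : Fn 𝕜 σ :=
  if i < 0 then 0 else zetaCoeff i.natAbs f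

theorem zetaCoeffInt_of_neg {i : ℤ} (hi : i < 0) (f : Fn 𝕜 (Option σ)) :
    zetaCoeffInt i f = 0 := if_pos hi

theorem zetaCoeffInt_natCast (N : ℕ) (f : Fn 𝕜 (Option σ)) :
    zetaCoeffInt (N : ℤ) f = zetaCoeff N f := by
  rw [zetaCoeffInt, if_neg (by omega), Int.natAbs_natCast]

theorem lcoeff_toLFn (i : ℤ) (f : Fn 𝕜 (Option σ)) : lcoeff i (toLFn f) = zetaCoeffInt i f := by
  ext1 d
  rw [coeff_lcoeff]
  change HahnSeries.coeff (HahnSeries.ofPowerSeries ℤ (SFun 𝕜) _) i = _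
  rw [PowerSeries.coeff_coe, zetaCoeffInt]
  split_ifs
  · rw [map_zero]
  · rw [PowerSeries.coeff_mk]

theorem LFn_ext {Z Z' : LFn 𝕜 σ} (h : ∀ i, lcoeff i Z = lcoeff i Z') : Z = Z' := by
  ext1 d
  ext1
  ext1 i
  exact congrArg (coeff d) (h i)

theorem zetaCoeffInt_dVar (i : ℤ) (v : σ) (f : Fn 𝕜 (Option σ)) :
    zetaCoeffInt i (f.dVar (some v)) = (zetaCoeffInt i f).dVar v := by
  rw [zetaCoeffInt, zetaCoeffInt]
  split_ifs
  · exact (map_zero (dVarDer 𝕜 v)).symm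
  · exact zetaCoeff_dVar _ v f

theorem lcoeff_pderiv (i : ℤ) (v : σ) (Z : LFn 𝕜 σ) :
    lcoeff i (pderiv _ v Z) = (lcoeff i Z).dVar v := by
  ext1 d
  rw [coeff_dVar, coeff_lcoeff, coeff_lcoeff, coeff_pderiv, mul_comm,
    mul_comm _ ((d v : SFun 𝕜) + 1), ← Nat.cast_add_one, ← Nat.cast_add_one, ← nsmul_eq_mul, ← nsmul_eq_mul]
  exact HahnSeries.coeff_smul

theorem pderiv_toLFn (v : σ) (f : Fn 𝕜 (Option σ)) :
    pderiv _ v (toLFn f) = toLFn (f.dVar (some v)) := by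
  refine LFn_ext fun i => ?_
  rw [lcoeff_pderiv, lcoeff_toLFn, lcoeff_toLFn, zetaCoeffInt_dVar]

/-- If the powers of `ζ` in two series are bounded from below uniformly in the monomials, the
coefficients of the product are given by finite sums. -/
theorem lcoeff_mul {Z Z' : LFn 𝕜 σ} {N N' : ℤ} (hZ : ∀ i < N, lcoeff i Z = 0)
    (hZ' : ∀ i < N', lcoeff i Z' = 0) (i : ℤ) :
    lcoeff i (Z * Z') = ∑ᶠ r, lcoeff r Z * lcoeff (i - r) Z' := by
  classical
  rw [finsum_eq_sum_of_support_subset (s := Finset.Icc N (i - N'))]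
  · ext1 d
    rw [coeff_lcoeff, coeff_mul, map_sum]
    simp only [coeff_mul]
    rw [Finset.sum_comm, HahnSeries.coeff_sum]
    refine Finset.sum_congr rfl fun a _ => ?_
    have h1 : (coeff a.1 Z).support ⊆ Set.Ici N := fun r hr => by
      by_contra h
      exact hr (congrArg (coeff a.1) (hZ r (not_le.1 h)))
    have h2 : (coeff a.2 Z').support ⊆ Set.Ici N' := fun r hr => by
      by_contra h
      exact hr (congrArg (coeff a.2) (hZ' r (not_le.1 h)))
    rw [HahnSeries.coeff_mul]
    refine Finset.sum_bij_ne_zero (fun q _ _ => q.1) ?_ ?_ ?_ ?_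
    · rintro ⟨q, r⟩ hq _
      rw [Finset.mem_antidiagonal] at hq
      have := h1 hq.1
      have := h2 hq.2.1
      simp only [Set.mem_Ici] at *
      rw [Finset.mem_Icc]
      omega
    · rintro ⟨q, r⟩ hq _ ⟨q', r'⟩ hq' _ h
      rw [Finset.mem_antidiagonal] at hq hq'
      simp only [Prod.mk.injEq] at *
      omega
    · intro q _ hne
      refine ⟨(q, i - q), ?_, hne, rfl⟩
      rw [Finset.mem_antidiagonal]
      exact ⟨left_ne_zero_of_mul hne, right_ne_zero_of_mul hne, by simp⟩
    · rintro ⟨q, r⟩ hq _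
      rw [Finset.mem_antidiagonal] at hq
      have : r = i - q := by simp only at hq; omega
      rw [this]
      rfl
  · intro r hr
    rw [Finset.coe_Icc, Set.mem_Icc]
    refine ⟨?_, ?_⟩
    · by_contra h
      exact hr (by simp only [hZ r (not_le.1 h), zero_mul])
    · by_contra h
      exact hr (by simp only [hZ' (i - r) (by omega), mul_zero])

end LCoeff

/-! ### Restriction to `t' = t` and `a = b = 0` -/

section Diag

open MvPowerSeries

/-- The variables of the bilinear equation that do not vanish under the restriction to `t' = t`,
`a = b = 0`. -/
inductive DVar (m : ℕ+) : Type
  | primed (v : Time m) : DVar m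
  | unprimed (v : Time m) : DVar m
  | x (l : ℕ+) : DVar m

/-- The inclusion of the variables `t', t, x` among the variables of the bilinear equation. -/
def DVar.incl : DVar m ↪ BVar m where
  toFun
    | DVar.primed v => BVar.primed v
    | DVar.unprimed v => BVar.unprimed v
    | DVar.x l => BVar.x l
  inj' := by
    rintro (_ | _ | _) (_ | _ | _) h <;> cases h <;> rfl

/-- The identification of the variables `t'` with the variables `t`. -/
def DVar.merge : DVar m → Var m
  | DVar.primed v => Var.time v
  | DVar.unprimed v => Var.time v
  | DVar.x l => Var.x l

instance : Filter.TendstoCofinite (DVar.merge (m := m)) := by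
  rw [Filter.tendstoCofinite_iff_finite_preimage_singleton]
  rintro (v | l)
  · refine (Set.toFinite {DVar.primed v, DVar.unprimed v}).subset ?_
    rintro (w | w | w) h <;> simp_all [DVar.merge]
  · refine (Set.toFinite {DVar.x l}).subset ?_
    rintro (w | w | w) h <;> simp_all [DVar.merge]

variable {R : Type*} [CommRing R]

/-- The restriction of a power series to `t' = t` and `a = b = 0`. -/
def diag : MvPowerSeries (BVar m) R →ₐ[R] MvPowerSeries (Var m) R :=
  (rename DVar.merge).comp (killCompl DVar.incl)

theorem exists_coeff_diag (d : Var m →₀ ℕ) : ∃ F : Finset (DVar m →₀ ℕ),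
    (∀ y, y ∈ F ↔ Finsupp.mapDomain DVar.merge y = d) ∧
    ∀ (R : Type _) [CommRing R] (G : MvPowerSeries (BVar m) R),
      coeff d (diag G) = ∑ y ∈ F, coeff (Finsupp.embDomain DVar.incl y) G :=
  ⟨(Filter.TendstoCofinite.finite_preimage_singleton
    (Finsupp.mapDomain DVar.merge) d).toFinset, fun y => by simp, fun _ _ _ => rfl⟩

theorem FinDep.diag : FinDep (fun G : MvPowerSeries (BVar m) R => diag G) := by
  classical
  intro d
  obtain ⟨F, -, hF⟩ := exists_coeff_diag d
  refine ⟨F.image (Finsupp.embDomain DVar.incl), fun f g h => ?_⟩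
  rw [hF, hF]
  exact Finset.sum_congr rfl fun y hy => h _ (Finset.mem_image_of_mem _ hy)

theorem diag_C (c : R) : diag (C c : MvPowerSeries (BVar m) R) = C c := by
  simp [diag]

theorem diag_X_incl (v : DVar m) : diag (X v.incl : MvPowerSeries (BVar m) R) = X v.merge := by
  simp [diag]

theorem diag_X_a (l : ℕ+) : diag (X (BVar.a l) : MvPowerSeries (BVar m) R) = 0 := by
  rw [diag, AlgHom.comp_apply, killCompl_X_eq_zero, map_zero]
  rintro ⟨_ | _ | _, h⟩ <;> cases h

theorem diag_X_b (l : ℕ+) : diag (X (BVar.b l) : MvPowerSeries (BVar m) R) = 0 := by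
  rw [diag, AlgHom.comp_apply, killCompl_X_eq_zero, map_zero]
  rintro ⟨_ | _ | _, h⟩ <;> cases h

theorem lcoeff_diag (i : ℤ) (Z : LFn 𝕜 (BVar m)) : lcoeff i (diag Z) = diag (lcoeff i Z) := by
  ext1 d
  obtain ⟨F, -, hF⟩ := exists_coeff_diag d
  refine (congrArg (fun x => HahnSeries.coeff x i) (hF (LaurentSeries (SFun 𝕜)) Z)).trans ?_
  rw [hF, HahnSeries.coeff_sum]
  rfl

/-- Vanishing of a Taylor expansion: if all derivatives of `G` with respect to `t'`, `a` and `b`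
vanish for `t' = t`, `a = b = 0`, then `G = 0`. -/
theorem eq_zero_of_forall_diag_eq_zero (𝒢 : Set (Fn 𝕜 (BVar m)))
    (hdiag : ∀ G ∈ 𝒢, diag G = 0) (hprimed : ∀ G ∈ 𝒢, ∀ v, G.dVar (BVar.primed v) ∈ 𝒢)
    (ha : ∀ G ∈ 𝒢, ∀ l, G.dVar (BVar.a l) ∈ 𝒢) (hb : ∀ G ∈ 𝒢, ∀ l, G.dVar (BVar.b l) ∈ 𝒢)
    {G : Fn 𝕜 (BVar m)} (hG : G ∈ 𝒢) : G = 0 := by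
  classical
  suffices h : ∀ (N : ℕ) (d : BVar m →₀ ℕ), d.degree = N → ∀ G ∈ 𝒢, coeff d G = 0 by
    ext1 d
    rw [h _ d rfl G hG, map_zero]
  intro N
  induction N using Nat.strong_induction_on with
  | _ N ih =>
  -- a coefficient that involves a variable `w` is a coefficient of smaller degree of `∂_w G`
  have step : ∀ (w : BVar m), (∀ G ∈ 𝒢, G.dVar w ∈ 𝒢) → ∀ d : BVar m →₀ ℕ, d.degree = N →
      d w ≠ 0 → ∀ G ∈ 𝒢, coeff d G = 0 := by
    intro w hw d hd hdw G hG
    obtain ⟨d', rfl⟩ : ∃ d', d = d' + Finsupp.single w 1 :=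
      ⟨d - Finsupp.single w 1, (tsub_add_cancel_of_le (Finsupp.single_le_iff.2
        (Nat.one_le_iff_ne_zero.2 hdw))).symm⟩
    rw [map_add, Finsupp.degree_single] at hd
    have h1 := ih d'.degree (by omega) d' rfl _ (hw G hG)
    rw [coeff_dVar, ← Nat.cast_add_one, mul_comm, ← nsmul_eq_mul] at h1
    rw [← Nat.cast_smul_eq_nsmul ℂ] at h1
    exact (smul_eq_zero.1 h1).resolve_left (Nat.cast_ne_zero.2 (Nat.succ_ne_zero _))
  intro d hd G hG
  by_cases h1 : ∃ v, d (BVar.primed v) ≠ 0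
  · obtain ⟨v, hv⟩ := h1
    exact step _ (fun G hG => hprimed G hG v) d hd hv G hG
  by_cases h2 : ∃ l, d (BVar.a l) ≠ 0
  · obtain ⟨l, hl⟩ := h2
    exact step _ (fun G hG => ha G hG l) d hd hl G hG
  by_cases h3 : ∃ l, d (BVar.b l) ≠ 0
  · obtain ⟨l, hl⟩ := h3
    exact step _ (fun G hG => hb G hG l) d hd hl G hG
  push Not at h1 h2 h3
  -- the remaining coefficients are those of the restriction of `G`
  obtain ⟨y, rfl⟩ : ∃ y, d = Finsupp.embDomain DVar.incl y := by
    have : d ∈ Set.range (Finsupp.embDomain DVar.incl) := by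
      rw [Finsupp.mem_range_embDomain_iff]
      intro w hw
      rw [Finset.mem_coe, Finsupp.mem_support_iff] at hw
      obtain v | v | l | l | l := w
      · exact absurd (h1 v) hw
      · exact ⟨DVar.unprimed v, rfl⟩
      · exact ⟨DVar.x l, rfl⟩
      · exact absurd (h2 l) hw
      · exact absurd (h3 l) hw
    exact ⟨_, this.choose_spec.symm⟩
  have hy : ∀ v, y (DVar.primed v) = 0 := fun v => by
    rw [← h1 v]
    exact (Finsupp.embDomain_apply_self DVar.incl y (DVar.primed v)).symm
  obtain ⟨F, hF1, hF2⟩ := exists_coeff_diag (Finsupp.mapDomain DVar.merge y)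
  have h4 := hF2 _ G
  rw [hdiag G hG, map_zero, Finset.sum_eq_single y] at h4
  · exact h4.symm
  · intro z hz hzy
    have hz' := (hF1 z).1 hz
    have hdeg : (Finsupp.embDomain DVar.incl z).degree = N := by
      rw [← hd, Finsupp.embDomain_eq_mapDomain, Finsupp.embDomain_eq_mapDomain,
        Finsupp.degree_mapDomain, Finsupp.degree_mapDomain,
        ← Finsupp.degree_mapDomain DVar.merge z, hz', Finsupp.degree_mapDomain]
    by_cases hz1 : ∃ v, z (DVar.primed v) ≠ 0
    · obtain ⟨v, hv⟩ := hz1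
      refine step (BVar.primed v) (fun G hG => hprimed G hG v) _ hdeg ?_ G hG
      exact fun h => hv (by
        rw [← h]; exact (Finsupp.embDomain_apply_self DVar.incl z (DVar.primed v)).symm)
    · push Not at hz1
      refine absurd ?_ hzy
      -- the exponents without primed variables are determined by their image
      have key : ∀ z : DVar m →₀ ℕ, (∀ v, z (DVar.primed v) = 0) → ∀ u : Var m, ∀ w : DVar m,
          w.merge = u → (∀ v, w ≠ DVar.primed v) → Finsupp.mapDomain DVar.merge z u = z w := by
        intro z hz u w hw hw'
        rw [Finsupp.mapDomain, Finsupp.sum_apply, Finsupp.sum, Finset.sum_eq_single w]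
        · rw [hw, Finsupp.single_eq_same]
        · intro w' hw1 hw2
          rw [Finsupp.single_eq_of_ne]
          rintro rfl
          rw [Finsupp.mem_support_iff] at hw1
          obtain v | v | l := w'
          · exact hw1 (hz v)
          · obtain v' | v' | l' := w
            · exact hw' _ rfl
            · exact hw2 (by cases hw; rfl)
            · cases hw
          · obtain v' | v' | l' := w
            · exact hw' _ rfl
            · cases hw
            · exact hw2 (by cases hw; rfl)
        · intro h
          rw [Finsupp.notMem_support_iff] at h
          rw [h, Finsupp.single_zero, Finsupp.zero_apply]
      ext w
      obtain v | v | l := w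
      · rw [hz1 v, hy v]
      · rw [← key z hz1 _ (DVar.unprimed v) rfl (by simp), hz',
          key y hy _ (DVar.unprimed v) rfl (by simp)]
      · rw [← key z hz1 _ (DVar.x l) rfl (by simp), hz', key y hy _ (DVar.x l) rfl (by simp)]
  · intro h
    exact absurd ((hF1 y).2 rfl) h

end Diag

/-! ### Sums of series of increasing order -/

section FormalSum

open MvPowerSeries

variable {R : Type*} [CommRing R]

/-- The terms of degree less than `r` vanish in `F r`. -/
def OrderGE (F : ℕ → MvPowerSeries σ R) : Prop :=
  ∀ (r : ℕ) (d : σ →₀ ℕ), d.degree < r → coeff d (F r) = 0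

/-- The sum `∑ r, F r`, where `F r` has order at least `r`. -/
def formalSum (F : ℕ → MvPowerSeries σ R) : MvPowerSeries σ R :=
  fun d => ∑ r ∈ Finset.range (d.degree + 1), coeff d (F r)

theorem coeff_formalSum {F : ℕ → MvPowerSeries σ R} (hF : OrderGE F) (d : σ →₀ ℕ) {N : ℕ}
    (hN : d.degree < N) : coeff d (formalSum F) = ∑ r ∈ Finset.range N, coeff d (F r) := by
  change ∑ r ∈ Finset.range (d.degree + 1), coeff d (F r) = _
  refine Finset.sum_subset (Finset.range_subset_range.2 hN) fun r _ hr => hF r d ?_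
  rw [Finset.mem_range] at hr
  omega

theorem OrderGE.pow_mul {E : MvPowerSeries σ R} (hE : constantCoeff E = 0)
    (T : ℕ → MvPowerSeries σ R) : OrderGE fun r => E ^ r * T r := by
  classical
  intro r d hd
  rw [coeff_mul]
  refine Finset.sum_eq_zero fun a ha => ?_
  have h1 : a.1.degree ≤ d.degree := by
    rw [← Finset.HasAntidiagonal.mem_antidiagonal.1 ha, map_add]
    exact Nat.le_add_right _ _
  rw [coeff_eq_zero_of_constantCoeff_nilpotent (m := 0 + 1) (by rw [hE]; simp) (by omega), zero_mul]

theorem OrderGE.const_mul {F : ℕ → MvPowerSeries σ R} (hF : OrderGE F) (c : MvPowerSeries σ R) :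
    OrderGE fun r => c * F r := by
  classical
  intro r d hd
  rw [coeff_mul]
  refine Finset.sum_eq_zero fun a ha => ?_
  have h1 : a.2.degree ≤ d.degree := by
    rw [← Finset.HasAntidiagonal.mem_antidiagonal.1 ha, map_add]
    exact Nat.le_add_left _ _
  rw [hF r a.2 (by omega), mul_zero]

theorem const_mul_formalSum {F : ℕ → MvPowerSeries σ R} (hF : OrderGE F) (c : MvPowerSeries σ R) :
    c * formalSum F = formalSum fun r => c * F r := by
  classical
  ext1 d
  rw [coeff_formalSum (hF.const_mul c) d (Nat.lt_succ_self _)]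
  simp only [coeff_mul]
  rw [Finset.sum_comm]
  refine Finset.sum_congr rfl fun a ha => ?_
  rw [coeff_formalSum hF (N := d.degree.succ), Finset.mul_sum]
  rw [← Finset.HasAntidiagonal.mem_antidiagonal.1 ha, map_add]
  exact Nat.lt_succ_of_le (Nat.le_add_left _ _)

/-- Differentiation term by term, where the derivative of the term of index `r + 1` may have
contributions `H r` and `G (r + 1)` of different orders. -/
theorem pderiv_formalSum {F G H : ℕ → MvPowerSeries σ R} (hF : OrderGE F) (hG : OrderGE G)
    (hH : OrderGE H) (w : σ) (h0 : pderiv R w (F 0) = G 0)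
    (hs : ∀ r, pderiv R w (F (r + 1)) = G (r + 1) + H r) :
    pderiv R w (formalSum F) = formalSum G + formalSum H := by
  ext1 d
  rw [coeff_pderiv, coeff_formalSum hF (N := d.degree + 2), Finset.sum_mul, map_add,
    coeff_formalSum hG d (N := d.degree + 2) (by omega),
    coeff_formalSum hH d (N := d.degree + 1) (by omega)]
  · simp_rw [← coeff_pderiv]
    rw [Finset.sum_range_succ', h0, Finset.sum_range_succ' (fun r => coeff d (G r))]
    simp_rw [hs, map_add]
    rw [Finset.sum_add_distrib]
    ring
  · rw [map_add, Finsupp.degree_single]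
    omega

theorem FinDep.formalSum_eq {τ : Type} {S : Type*} [CommRing S]
    {δ : MvPowerSeries σ R → MvPowerSeries τ S} (hδ : FinDep δ) {F : ℕ → MvPowerSeries σ R}
    (hF : OrderGE F) {G : MvPowerSeries τ S} (h : ∀ N, δ (∑ r ∈ Finset.range (N + 1), F r) = G) :
    δ (formalSum F) = G := by
  ext1 d
  obtain ⟨E, hE⟩ := hδ d
  rw [← h (E.sup Finsupp.degree)]
  refine hE _ _ fun e he => ?_
  rw [coeff_formalSum hF e (Nat.lt_succ_of_le (Finset.le_sup he)), map_sum]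

/-- Only the first term of a formal sum survives a restriction under which `E` vanishes. -/
theorem diag_formalSum_pow_mul {E : MvPowerSeries (BVar m) R} (hE : constantCoeff E = 0)
    (hE' : diag E = 0) (T : ℕ → MvPowerSeries (BVar m) R) :
    diag (formalSum fun r => E ^ r * T r) = diag (T 0) := by
  refine FinDep.formalSum_eq FinDep.diag (OrderGE.pow_mul hE T) fun N => ?_
  rw [map_sum, Finset.sum_range_succ']
  simp [hE', pow_succ]

end FormalSum

/-! ### Exponentials and Taylor expansions -/

section Taylor

open MvPowerSeries

variable {K : Type*} [CommRing K]

/-- The constant coefficient vanishes, so that the series may be substituted into others. -/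
def NoConst (E : MvPowerSeries σ K) : Prop := constantCoeff E = 0

theorem NoConst.coeff_zero {E : MvPowerSeries σ K} (hE : NoConst E) : constantCoeff E = 0 := hE

variable [Algebra ℂ K]

theorem pderiv_smul_complex (w : σ) (c : ℂ) (Z : MvPowerSeries σ K) :
    pderiv K w (c • Z) = c • pderiv K w Z :=
  ((pderiv K w).restrictScalars ℂ).map_smul c Z

theorem inv_factorial_smul (r : ℕ) (Z : MvPowerSeries σ K) :
    (1 / ((r + 1).factorial : ℂ)) • ((r + 1) • Z) = (1 / (r.factorial : ℂ)) • Z := by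
  rw [← Nat.cast_smul_eq_nsmul ℂ, smul_smul]
  congr 1
  rw [Nat.factorial_succ]
  have h1 : ((r + 1 : ℕ) : ℂ) ≠ 0 := Nat.cast_ne_zero.2 (Nat.succ_ne_zero r)
  have h2 : (r.factorial : ℂ) ≠ 0 := Nat.cast_ne_zero.2 (Nat.factorial_ne_zero r)
  push_cast at *
  field_simp

/-- The Taylor expansion `∑ r, η ^ r / r! * T r` of a function with derivatives `T r`. -/
def taylor (η : MvPowerSeries σ K) (T : ℕ → MvPowerSeries σ K) : MvPowerSeries σ K :=
  formalSum fun r => (1 / (r.factorial : ℂ)) • (η ^ r * T r)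

theorem OrderGE.taylor {η : MvPowerSeries σ K} (hη : NoConst η)
    (T : ℕ → MvPowerSeries σ K) : OrderGE fun r => (1 / (r.factorial : ℂ)) • (η ^ r * T r) := by
  simp_rw [← mul_smul_comm]
  exact OrderGE.pow_mul hη.coeff_zero _

theorem diag_taylor {η : MvPowerSeries (BVar m) K} (hη : NoConst η)
    (hη' : diag η = 0) (T : ℕ → MvPowerSeries (BVar m) K) : diag (taylor η T) = diag (T 0) := by
  rw [taylor]
  simp_rw [← mul_smul_comm]
  rw [diag_formalSum_pow_mul hη.coeff_zero hη']
  simp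

theorem pderiv_taylor {η : MvPowerSeries σ K} (hη : NoConst η)
    (T : ℕ → MvPowerSeries σ K) (w : σ) : pderiv K w (taylor η T) =
      taylor η (fun r => pderiv K w (T r)) + pderiv K w η * taylor η fun r => T (r + 1) := by
  rw [taylor, taylor, taylor, const_mul_formalSum (.taylor hη _)]
  refine pderiv_formalSum (.taylor hη _) (.taylor hη _) ((OrderGE.taylor hη _).const_mul _) w ?_
    fun r => ?_
  · simp
  · rw [pderiv_smul_complex, Derivation.leibniz, Derivation.leibniz_pow, smul_eq_mul, smul_eq_mul,
      smul_add, mul_smul_comm, inv_factorial_smul, Nat.add_sub_cancel, smul_eq_mul, mul_smul_comm]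
    congr 2
    ring

theorem exp_subst_eq_taylor {E : MvPowerSeries σ K} (hE : NoConst E) :
    PowerSeries.subst E (PowerSeries.exp ℂ) = taylor E fun _ => 1 := by
  ext1 d
  rw [PowerSeries.coeff_subst (PowerSeries.HasSubst.of_constantCoeff_zero hE.coeff_zero), taylor,
    coeff_formalSum (.taylor hE _) d (Nat.lt_succ_self _),
    finsum_eq_sum_of_support_subset (s := Finset.range d.degree.succ)]
  · refine Finset.sum_congr rfl fun r _ => ?_
    rw [mul_one, PowerSeries.coeff_exp]
    simp
  · intro r hr
    rw [Finset.coe_range, Set.mem_Iio]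
    by_contra h
    refine hr ?_
    simp only
    rw [coeff_eq_zero_of_constantCoeff_nilpotent (m := 0 + 1) (by rw [hE.coeff_zero]; simp) (by omega),
      smul_zero]

theorem diag_exp_subst {E : MvPowerSeries (BVar m) K} (hE : NoConst E)
    (hE' : diag E = 0) : diag (PowerSeries.subst E (PowerSeries.exp ℂ)) = 1 := by
  rw [exp_subst_eq_taylor hE, diag_taylor hE hE', map_one]

theorem taylor_zero {E : MvPowerSeries σ K} (hE : NoConst E) :
    taylor E (fun _ => (0 : MvPowerSeries σ K)) = 0 := by
  ext1 d
  rw [taylor, coeff_formalSum (.taylor hE _) d (Nat.lt_succ_self _)]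
  simp

theorem pderiv_exp_subst {E : MvPowerSeries σ K} (hE : NoConst E) (w : σ) :
    pderiv K w (PowerSeries.subst E (PowerSeries.exp ℂ)) =
      pderiv K w E * PowerSeries.subst E (PowerSeries.exp ℂ) := by
  rw [exp_subst_eq_taylor hE, pderiv_taylor hE, pderiv_one, taylor_zero hE, zero_add]

end Taylor

/-! ### The factors of the bilinear equation -/

section Factors

open MvPowerSeries

theorem iterate_dS_dVar (v : σ) (r : ℕ) (f : Fn 𝕜 σ) :
    Fn.dS^[r] (f.dVar v) = (Fn.dS^[r] f).dVar v := by
  induction r generalizing f with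
  | zero => rfl
  | succ r ih => rw [Function.iterate_succ_apply, Function.iterate_succ_apply, ← dVar_dS, ih]

theorem toLFn_zero : toLFn (0 : Fn 𝕜 (Option σ)) = 0 := by
  refine LFn_ext fun i => ?_
  rw [lcoeff_toLFn, lcoeff_zero, zetaCoeffInt]
  split_ifs <;> rfl

end Factors

/-! ### Linear forms -/

section LinForm

open MvPowerSeries

variable {K : Type*} [CommRing K]

open Classical in
/-- The linear form `∑ i, c i * v i` in the variables `v i`. -/
def linForm (v : ℕ+ → σ) (c : ℕ+ → K) : MvPowerSeries σ K :=
  fun d => ∑ᶠ i : ℕ+, if d = Finsupp.single (v i) 1 then c i else 0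


theorem coeff_linForm_single {v : ℕ+ → σ} (hv : v.Injective) (c : ℕ+ → K)
    (i : ℕ+) : coeff (Finsupp.single (v i) 1) (linForm v c) = c i := by
  classical
  refine (finsum_eq_single _ i ?_).trans (if_pos rfl)
  intro i' hi
  rw [if_neg]
  intro h
  exact hi (hv (Finsupp.single_left_injective one_ne_zero h)).symm

theorem coeff_linForm_eq_zero {v : ℕ+ → σ} (c : ℕ+ → K) {d : σ →₀ ℕ}
    (hd : ∀ i, d ≠ Finsupp.single (v i) 1) : coeff d (linForm v c) = 0 :=
  finsum_eq_zero_of_forall_eq_zero fun i => if_neg (hd i)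

theorem noConst_linForm (v : ℕ+ → σ) (c : ℕ+ → K) :
    NoConst (linForm v c) := by
  rw [NoConst]
  rw [← coeff_zero_eq_constantCoeff_apply]
  refine coeff_linForm_eq_zero c fun i h => ?_
  have := DFunLike.congr_fun h (v i)
  rw [Finsupp.single_eq_same] at this
  exact zero_ne_one this

theorem pderiv_linForm_eq_zero {v : ℕ+ → σ} (c : ℕ+ → K) {w : σ}
    (hw : ∀ i, v i ≠ w) : pderiv _ w (linForm v c) = 0 := by
  ext1 d
  rw [coeff_pderiv, coeff_linForm_eq_zero, zero_mul, map_zero]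
  intro i h
  have := DFunLike.congr_fun h w
  rw [Finsupp.add_apply, Finsupp.single_eq_same, Finsupp.single_eq_of_ne (hw i).symm] at this
  omega

theorem pderiv_linForm {v : ℕ+ → σ} (hv : v.Injective) (c : ℕ+ → K)
    (i : ℕ+) : pderiv _ (v i) (linForm v c) = C (c i) := by
  classical
  ext1 d
  rw [coeff_pderiv, coeff_C]
  split_ifs with h
  · rw [h, zero_add, coeff_linForm_single hv]
    simp
  · rw [coeff_linForm_eq_zero, zero_mul]
    intro i' h1
    refine h ?_
    have h2 := DFunLike.congr_fun h1 (v i)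
    have h3 : v i' = v i := by
      by_contra h3
      rw [Finsupp.add_apply, Finsupp.single_eq_same, Finsupp.single_eq_of_ne (Ne.symm h3)] at h2
      omega
    rw [h3] at h1
    exact add_eq_right.1 h1

theorem diag_linForm_eq_zero {v : ℕ+ → BVar m} (c : ℕ+ → K)
    (hv : ∀ i, v i ∉ Set.range DVar.incl) : diag (linForm v c) = 0 := by
  ext1 d
  obtain ⟨F, -, hF⟩ := exists_coeff_diag d
  refine (hF _ _).trans ?_
  rw [map_zero]
  refine Finset.sum_eq_zero fun y _ => coeff_linForm_eq_zero c fun i h => ?_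
  have := DFunLike.congr_fun h (v i)
  rw [Finsupp.single_eq_same, Finsupp.embDomain_of_notMem_range _ _ _ (hv i)] at this
  exact zero_ne_one this

theorem diag_linForm_incl {v : ℕ+ → DVar m} (hv : (fun i => (v i).merge).Injective)
    (c : ℕ+ → K) :
    diag (linForm (fun i => (v i).incl) c) = linForm (fun i => (v i).merge) c := by
  classical
  ext1 d
  obtain ⟨F, hF1, hF2⟩ := exists_coeff_diag d
  refine (hF2 _ _).trans ?_
  have hv' : (fun i => (v i).incl).Injective := fun i i' h =>
    hv (congrArg DVar.merge (DVar.incl.injective h))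
  have hsingle : ∀ y i, Finsupp.embDomain DVar.incl y = Finsupp.single (v i).incl 1 →
      y = Finsupp.single (v i) 1 := fun y i h => by
    rw [← Finsupp.embDomain_single] at h
    exact Finsupp.embDomain_injective _ h
  by_cases hd : ∃ i, d = Finsupp.single (v i).merge 1
  · obtain ⟨i, rfl⟩ := hd
    rw [coeff_linForm_single hv, Finset.sum_eq_single (Finsupp.single (v i) 1),
      Finsupp.embDomain_single, coeff_linForm_single hv']
    · intro y hy hne
      refine coeff_linForm_eq_zero c fun i' h => hne ?_
      have h1 := hsingle y i' h
      have h2 := (hF1 y).1 hy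
      rw [h1, Finsupp.mapDomain_single] at h2
      rw [h1, hv (Finsupp.single_left_injective one_ne_zero h2)]
    · intro h
      exact absurd ((hF1 _).2 Finsupp.mapDomain_single) h
  · push Not at hd
    rw [coeff_linForm_eq_zero c hd]
    refine Finset.sum_eq_zero fun y hy => coeff_linForm_eq_zero c fun i h => hd i ?_
    rw [← (hF1 y).1 hy, hsingle y i h, Finsupp.mapDomain_single]

end LinForm

/-! ### Restrictions of the factors of the bilinear equation -/

section DiagZeta

open MvPowerSeries

variable {p : ℕ+ → Time m}

/-- The restriction to `t' = t`, `a = b = 0` of the coefficients with respect to `ζ`. -/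
def diagZeta (𝕜 : Type*) [RCLike 𝕜] [NormedAlgebra 𝕜 ℂ] (m : ℕ+) :
    Fn 𝕜 (Option (BVar m)) →+* PowerSeries (Fn 𝕜 (Var m)) :=
  (PowerSeries.map (diag (m := m) (R := SFun 𝕜)).toRingHom).comp (zetaSeries 𝕜 (BVar m)).toRingHom

theorem coeff_diagZeta (N : ℕ) (f : Fn 𝕜 (Option (BVar m))) :
    PowerSeries.coeff N (diagZeta 𝕜 m f) = diag (zetaCoeff N f) := by
  rw [← coeff_zetaSeries, diagZeta, RingHom.comp_apply, PowerSeries.coeff_map]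
  rfl

theorem diagZeta_C (c : SFun 𝕜) : diagZeta 𝕜 m (C c) = zetaSeries 𝕜 (Var m) (C c) := by
  simp [diagZeta, zetaSeries, optionEquivLeft_C, diag_C]

theorem diagZeta_X_some (w : BVar m) :
    diagZeta 𝕜 m (X (some w)) = PowerSeries.C (diag (X w)) := by
  simp [diagZeta, zetaSeries, optionEquivLeft_X_some]

theorem diagZeta_X_none : diagZeta 𝕜 m (X none) = zetaSeries 𝕜 (Var m) (X none) := by
  simp [diagZeta, zetaSeries, optionEquivLeft_X_none]

theorem zetaSeries_X_some (w : σ) : zetaSeries 𝕜 σ (X (some w)) = PowerSeries.C (X w) := by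
  simp [zetaSeries, optionEquivLeft_X_some]

theorem diagZeta_smul (c : ℂ) (f : Fn 𝕜 (Option (BVar m))) :
    diagZeta 𝕜 m (c • f) = algebraMap ℂ _ c * diagZeta 𝕜 m f := by
  rw [Algebra.smul_def, map_mul, MvPowerSeries.algebraMap_apply, diagZeta_C]
  congr 1
  rw [← MvPowerSeries.algebraMap_apply]
  exact ((zetaSeries 𝕜 (Var m)).restrictScalars ℂ).commutes c

theorem diagZeta_bracket (hp : p.Injective) (ε : ℂ) (v : Time m) :
    diagZeta 𝕜 m (bracket p ε v) = zetaSeries 𝕜 (Var m) (bracket p ε v) := by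
  by_cases hv : ∃ j, p j = v
  · obtain ⟨j, rfl⟩ := hv
    rw [bracket_apply hp, bracket_apply hp, diagZeta_smul, map_pow, diagZeta_X_none,
      AlgHom.map_smul_of_tower, map_pow, Algebra.smul_def]
  · push Not at hv
    rw [bracket_eq_zero ε hv, bracket_eq_zero ε hv, map_zero, map_zero]

/-- The restriction of `τ(s, T + ε [ζ], x)` to `t' = t`, `a = b = 0`. -/
theorem diag_zetaCoeff_subst (hp : p.Injective) (ε : ℂ) {T : Time m → BVar m}
    {x : ℕ+ → Fn 𝕜 (Option (BVar m))} (hP : HasSubst (point T (bracket p ε) x))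
    (hT : ∀ v, diag (X (T v) : Fn 𝕜 (BVar m)) = X (Var.time v))
    (hx : ∀ l, diagZeta 𝕜 m (x l) = PowerSeries.C (X (Var.x l))) (N : ℕ) (f : Fn 𝕜 (Var m)) :
    diag (zetaCoeff N (subst (point T (bracket p ε) x) f)) = shiftCoeff p ε N f := by
  have hP' := hasSubst_tauShift (𝕜 := 𝕜) hp ε
  have hpoly : ∀ q : MvPolynomial (Var m) (SFun 𝕜),
      diagZeta 𝕜 m (subst (point T (bracket p ε) x) (q : Fn 𝕜 (Var m))) =
        zetaSeries 𝕜 (Var m) (tauShift p ε (q : Fn 𝕜 (Var m))) := by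
    intro q
    unfold tauShift
    rw [← substAlgHom_apply (R := SFun 𝕜) hP, ← substAlgHom_apply (R := SFun 𝕜) hP']
    have := MvPolynomial.ringHom_ext
      (f := ((diagZeta 𝕜 m).comp (substAlgHom hP : Fn 𝕜 (Var m) →ₐ[SFun 𝕜] _).toRingHom).comp
        (MvPolynomial.coeToMvPowerSeries.ringHom (σ := Var m) (R := SFun 𝕜)))
      (g := ((zetaSeries 𝕜 (Var m)).toRingHom.comp
        (substAlgHom hP' : Fn 𝕜 (Var m) →ₐ[SFun 𝕜] _).toRingHom).comp
        (MvPolynomial.coeToMvPowerSeries.ringHom (σ := Var m) (R := SFun 𝕜))) ?_ ?_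
    · exact RingHom.congr_fun this q
    · intro c
      simp [diagZeta_C]
    · rintro (v | l)
      · simp [subst_X hP, subst_X hP', point, diagZeta_X_some, zetaSeries_X_some, hT,
          diagZeta_bracket hp]
      · simp [subst_X hP, subst_X hP', point, zetaSeries_X_some, hx]
  have h1 : FinDep fun f : Fn 𝕜 (Var m) =>
      diag (zetaCoeff N (subst (point T (bracket p ε) x) f)) :=
    FinDep.diag.comp ((FinDep.zetaCoeff N).comp (FinDep.subst (R := SFun 𝕜) hP))
  have h2 : FinDep fun f : Fn 𝕜 (Var m) => shiftCoeff p ε N f :=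
    (FinDep.zetaCoeff N).comp (FinDep.subst (R := SFun 𝕜) hP')
  ext1 d
  classical
  obtain ⟨E, hE⟩ := h1 d
  obtain ⟨F, hF⟩ := h2 d
  obtain ⟨q, hq⟩ := exists_mvPolynomial_coeff_eq (E ∪ F) f
  rw [← hE q f fun e he => hq e (Finset.mem_union_left _ he),
    ← hF q f fun e he => hq e (Finset.mem_union_right _ he)]
  change _ = coeff d (zetaCoeff N (tauShift p ε (q : Fn 𝕜 (Var m))))
  rw [← coeff_zetaSeries, ← hpoly, coeff_diagZeta]

/-- The coefficient of `ζ ^ i` in `f(s, t + ε [ζ])`, for an integer `i`. -/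
def shiftCoeffInt (p : ℕ+ → Time m) (ε : ℂ) (i : ℤ) (f : Fn 𝕜 (Var m)) : Fn 𝕜 (Var m) :=
  zetaCoeffInt i (tauShift p ε f)

theorem shiftCoeffInt_of_neg {i : ℤ} (hi : i < 0) (ε : ℂ) (f : Fn 𝕜 (Var m)) :
    shiftCoeffInt p ε i f = 0 := zetaCoeffInt_of_neg hi _

theorem shiftCoeffInt_natCast (N : ℕ) (ε : ℂ) (f : Fn 𝕜 (Var m)) :
    shiftCoeffInt p ε N f = shiftCoeff p ε N f := zetaCoeffInt_natCast N _

theorem shiftCoeffInt_dVar (hp : p.Injective) (ε : ℂ) (i : ℤ) (v : Var m) (f : Fn 𝕜 (Var m)) :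
    shiftCoeffInt p ε i (f.dVar v) = (shiftCoeffInt p ε i f).dVar v := by
  rw [shiftCoeffInt, ← dVar_some_tauShift hp, zetaCoeffInt_dVar]
  rfl

theorem shiftCoeffInt_shiftS (hp : p.Injective) (ε : ℂ) (i j : ℤ) (f : Fn 𝕜 (Var m)) :
    shiftCoeffInt p ε i (f.shiftS j) = (shiftCoeffInt p ε i f).shiftS j := by
  obtain hi | ⟨N, rfl⟩ : i < 0 ∨ ∃ N : ℕ, i = N :=
    (lt_or_ge i 0).imp_right fun h => ⟨i.toNat, (Int.toNat_of_nonneg h).symm⟩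
  · rw [shiftCoeffInt_of_neg hi, shiftCoeffInt_of_neg hi, shiftS_zero]
  · rw [shiftCoeffInt_natCast, shiftCoeffInt_natCast, shiftCoeff_shiftS hp]

theorem shiftCoeffInt_dS (hp : p.Injective) (ε : ℂ) (i : ℤ) (f : Fn 𝕜 (Var m)) :
    shiftCoeffInt p ε i f.dS = (shiftCoeffInt p ε i f).dS := by
  obtain hi | ⟨N, rfl⟩ : i < 0 ∨ ∃ N : ℕ, i = N :=
    (lt_or_ge i 0).imp_right fun h => ⟨i.toNat, (Int.toNat_of_nonneg h).symm⟩
  · rw [shiftCoeffInt_of_neg hi, shiftCoeffInt_of_neg hi]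
    exact (map_zero (dSDer 𝕜 (Var m))).symm
  · rw [shiftCoeffInt_natCast, shiftCoeffInt_natCast, shiftCoeff_dS hp]

theorem lcoeff_diag_toLFn_subst (hp : p.Injective) (ε : ℂ) {T : Time m → BVar m}
    {x : ℕ+ → Fn 𝕜 (Option (BVar m))} (hP : HasSubst (point T (bracket p ε) x))
    (hT : ∀ v, diag (X (T v) : Fn 𝕜 (BVar m)) = X (Var.time v))
    (hx : ∀ l, diagZeta 𝕜 m (x l) = PowerSeries.C (X (Var.x l))) (i : ℤ) (f : Fn 𝕜 (Var m)) :
    lcoeff i (diag (toLFn (subst (point T (bracket p ε) x) f))) = shiftCoeffInt p ε i f := by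
  rw [lcoeff_diag, lcoeff_toLFn]
  obtain hi | ⟨N, rfl⟩ : i < 0 ∨ ∃ N : ℕ, i = N :=
    (lt_or_ge i 0).imp_right fun h => ⟨i.toNat, (Int.toNat_of_nonneg h).symm⟩
  · rw [zetaCoeffInt_of_neg hi, shiftCoeffInt_of_neg hi, map_zero]
  · rw [zetaCoeffInt_natCast, shiftCoeffInt_natCast, diag_zetaCoeff_subst hp ε hP hT hx]

end DiagZeta

/-! ### The points of evaluation and the exponents -/

section Points

open MvPowerSeries

theorem Time.t_injective : (Time.t (m := m)).Injective := fun _ _ h => Time.t.inj h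

theorem Time.tb_injective : (Time.tb k m).Injective := by
  intro i j h
  unfold Time.tb at h
  split_ifs at h with h1 h2 h2
  · have h3 := mul_left_cancel (Time.t.inj h)
    rw [← PNat.mul_div_exact h1, ← PNat.mul_div_exact h2, h3]
  · exact Time.tbar.inj h

theorem hasSubst_X_add_X {ι : Type} {u v : ι → σ} (hu : u.Injective) (hv : v.Injective) :
    HasSubst (fun l => (X (u l) + X (v l) : Fn 𝕜 σ)) :=
  (hasSubst_X_comp hu).add (hasSubst_X_comp hv)

theorem hasSubst_xPlusA : HasSubst (xPlusA (𝕜 := 𝕜) (m := m)) :=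
  hasSubst_X_add_X (u := fun l => some (BVar.x l)) (v := fun l => some (BVar.a l))
    (fun _ _ h => BVar.x.inj (Option.some_injective _ h))
    fun _ _ h => BVar.a.inj (Option.some_injective _ h)

theorem hasSubst_xPlusB : HasSubst (xPlusB (𝕜 := 𝕜) (m := m)) :=
  hasSubst_X_add_X (u := fun l => some (BVar.x l)) (v := fun l => some (BVar.b l))
    (fun _ _ h => BVar.x.inj (Option.some_injective _ h))
    fun _ _ h => BVar.b.inj (Option.some_injective _ h)

variable {p : ℕ+ → Time m}

theorem hasSubst_primed (hp : p.Injective) (ε : ℂ) :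
    HasSubst (point (𝕜 := 𝕜) BVar.primed (bracket p ε) xPlusA) :=
  hasSubst_point hp ε (fun _ _ h => BVar.primed.inj h) hasSubst_xPlusA

theorem hasSubst_unprimed (hp : p.Injective) (ε : ℂ) :
    HasSubst (point (𝕜 := 𝕜) BVar.unprimed (bracket p ε) xPlusB) :=
  hasSubst_point hp ε (fun _ _ h => BVar.unprimed.inj h) hasSubst_xPlusB

theorem diag_X_primed (v : Time m) : diag (X (BVar.primed v) : Fn 𝕜 (BVar m)) = X (Var.time v) :=
  diag_X_incl (DVar.primed v)

theorem diag_X_unprimed (v : Time m) :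
    diag (X (BVar.unprimed v) : Fn 𝕜 (BVar m)) = X (Var.time v) :=
  diag_X_incl (DVar.unprimed v)

theorem diag_X_x (l : ℕ+) : diag (X (BVar.x l) : Fn 𝕜 (BVar m)) = X (Var.x l) :=
  diag_X_incl (DVar.x l)

theorem diagZeta_xPlusA (l : ℕ+) :
    diagZeta 𝕜 m (xPlusA l) = PowerSeries.C (X (Var.x l)) := by
  rw [xPlusA, map_add, diagZeta_X_some, diagZeta_X_some, diag_X_x, diag_X_a, map_zero, add_zero]

theorem diagZeta_xPlusB (l : ℕ+) :
    diagZeta 𝕜 m (xPlusB l) = PowerSeries.C (X (Var.x l)) := by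
  rw [xPlusB, map_add, diagZeta_X_some, diagZeta_X_some, diag_X_x, diag_X_b, map_zero, add_zero]

theorem dVar_point_time (hp : p.Injective) (ε : ℂ) (T : Time m → σ)
    (x : ℕ+ → Fn 𝕜 (Option σ)) (v : Time m) (w : σ) [Decidable (T v = w)] :
    (point T (bracket p ε) x (Var.time v)).dVar (some w) = if T v = w then 1 else 0 := by
  rw [point, dVar_add, dVar_some_bracket hp, add_zero]
  split_ifs with h
  · rw [h, dVar_X_self]
  · rw [dVar_X_of_ne fun h' => h (Option.some_injective _ h')]

theorem dVar_X_add_X [DecidableEq σ] (u v w : σ) (huv : u ≠ v) :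
    Fn.dVar (some w) (X (some u) + X (some v) : Fn 𝕜 (Option σ)) =
      if u = w ∨ v = w then 1 else 0 := by
  rw [dVar_add]
  split_ifs with h
  · obtain rfl | rfl := h
    · rw [dVar_X_self, dVar_X_of_ne (fun h => huv (Option.some_injective _ h).symm), add_zero]
    · rw [dVar_X_self, dVar_X_of_ne (fun h => huv (Option.some_injective _ h)), zero_add]
  · push Not at h
    rw [dVar_X_of_ne (fun h' => h.1 (Option.some_injective _ h')),
      dVar_X_of_ne (fun h' => h.2 (Option.some_injective _ h')), add_zero]

theorem sub_half_smul {V : Type*} [AddCommGroup V] [Module ℂ V] (Z : V) :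
    Z - (1 / 2 : ℂ) • Z = (1 / 2 : ℂ) • Z := by
  rw [sub_eq_iff_eq_add, ← add_smul]
  norm_num

open Classical in
/-- The factor with which the variable of index `i` appears in `ξ - ξ_q / 2`. -/
def weight (q i : ℕ+) : ℂ := if q ∣ i then 1 / 2 else 1

section Xi

variable {K : Type*} [CommRing K] [Algebra ℂ K] (ζ : ℤ → K)

/-- The exponent `ξ - ξ_q / 2` for the sequence `p` of time variables, where `ζ i` is the `i`th
power of `z⁻¹` for `p = Time.t`, `q = k`, and of `z` for `p = Time.tb k m`, `q = m`. -/
def xi (p : ℕ+ → Time m) (q : ℕ+) (T : Time m → BVar m) : MvPowerSeries (BVar m) K :=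
  linForm (fun i => T (p i)) (fun i => ζ (-(i : ℤ)))
    - (1 / 2 : ℂ) • linForm (fun n => T (p (n * q))) (fun n => ζ (-((n * q : ℕ+) : ℤ)))

theorem noConst_xi (p : ℕ+ → Time m) (q : ℕ+) (T : Time m → BVar m) : NoConst (xi ζ p q T) := by
  rw [NoConst, xi, map_sub, Algebra.smul_def, map_mul, (noConst_linForm _ _).coeff_zero,
    (noConst_linForm _ _).coeff_zero, mul_zero, sub_zero]

theorem pderiv_xi (hp : p.Injective) (q : ℕ+) {T : Time m → BVar m} (hT : T.Injective) (i : ℕ+) :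
    pderiv _ (T (p i)) (xi ζ p q T) = weight q i • C (ζ (-(i : ℤ))) := by
  rw [xi, map_sub, pderiv_smul_complex, pderiv_linForm (v := fun i => T (p i)) (hT.comp hp), weight]
  split_ifs with h
  · obtain ⟨n, rfl⟩ := h
    rw [mul_comm q n, pderiv_linForm (v := fun n => T (p (n * q)))
      fun n n' h => mul_right_cancel (hp (hT h))]
    exact sub_half_smul _
  · rw [pderiv_linForm_eq_zero, smul_zero, sub_zero, one_smul]
    intro n hn
    exact h ⟨n, by rw [mul_comm, hp (hT hn)]⟩

theorem pderiv_xi_eq_zero (q : ℕ+) {T : Time m → BVar m} {w : BVar m} (hw : ∀ i, T (p i) ≠ w) :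
    pderiv _ w (xi ζ p q T) = 0 := by
  rw [xi, map_sub, pderiv_smul_complex, pderiv_linForm_eq_zero _ hw,
    pderiv_linForm_eq_zero _ fun n => hw _, smul_zero, sub_zero]

theorem diag_xi (hp : p.Injective) (q : ℕ+) {T : Time m → DVar m}
    (hT : ∀ v, (T v).merge = Var.time v) : diag (xi ζ p q fun v => (T v).incl) =
      linForm (fun i => Var.time (p i)) (fun i => ζ (-(i : ℤ))) - (1 / 2 : ℂ) •
        linForm (fun n => Var.time (p (n * q))) (fun n => ζ (-((n * q : ℕ+) : ℤ))) := by
  have hinj : (fun v : Time m => (Var.time v : Var m)).Injective := fun _ _ h => Var.time.inj h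
  rw [xi, map_sub, AlgHom.map_smul_of_tower, diag_linForm_incl (v := fun i => T (p i)),
    diag_linForm_incl (v := fun n => T (p (n * q)))]
  · simp_rw [hT]
  · simp_rw [hT]
    exact hinj.comp (hp.comp fun n n' h => mul_right_cancel h)
  · simp_rw [hT]
    exact hinj.comp hp

theorem diag_xi_primed (hp : p.Injective) (q : ℕ+) :
    diag (xi ζ p q BVar.primed) = diag (xi ζ p q BVar.unprimed) :=
  (diag_xi ζ hp q (T := DVar.primed) fun _ => rfl).trans
    (diag_xi ζ hp q (T := DVar.unprimed) fun _ => rfl).symm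

/-! ### The functions generated by the factors of the bilinear equation -/

/-- The product of a power of `ζ`, an exponential and a Taylor expansion, where `F` evaluates
functions at a point. -/
def factor (E η : MvPowerSeries (BVar m) K) (F : Fn 𝕜 (Var m) → MvPowerSeries (BVar m) K)
    (g : ℤ × Fn 𝕜 (Var m)) : MvPowerSeries (BVar m) K :=
  C (ζ g.1) * PowerSeries.subst E (PowerSeries.exp ℂ) * taylor η fun r => F (Fn.dS^[r] g.2)

variable {ζ} {E η : MvPowerSeries (BVar m) K} {F : Fn 𝕜 (Var m) → MvPowerSeries (BVar m) K}

theorem diag_factor (hE : NoConst E) (hη : NoConst η) (hE' : diag E = 0) (hη' : diag η = 0)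
    (g : ℤ × Fn 𝕜 (Var m)) : diag (factor ζ E η F g) = C (ζ g.1) * diag (F g.2) := by
  rw [factor, map_mul, map_mul, diag_C, diag_exp_subst hE hE', diag_taylor hη hη', mul_one]
  rfl

theorem pderiv_factor (hζ : ∀ a b, ζ a * ζ b = ζ (a + b)) (hE : NoConst E) (hη : NoConst η)
    {w : BVar m} {v : Var m} {c c' : ℂ} {a a' : ℤ} (hF : ∀ f, pderiv _ w (F f) = F (f.dVar v))
    (hE' : pderiv _ w E = c • C (ζ a)) (hη' : pderiv _ w η = c' • C (ζ a'))
    (g : ℤ × Fn 𝕜 (Var m)) :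
    pderiv _ w (factor ζ E η F g) = factor ζ E η F (g.1, g.2.dVar v) +
      c • factor ζ E η F (g.1 + a, g.2) + c' • factor ζ E η F (g.1 + a', g.2.dS) := by
  simp only [factor, Derivation.leibniz, pderiv_C, pderiv_exp_subst hE, pderiv_taylor hη, hE', hη',
    smul_eq_mul, ← hζ, map_mul, hF, iterate_dS_dVar, Function.iterate_succ_apply]
  simp only [Algebra.smul_def]
  ring

theorem pderiv_factor_eq_zero (hE : NoConst E) (hη : NoConst η) {w : BVar m}
    (hF : ∀ f, pderiv _ w (F f) = 0) (hE' : pderiv _ w E = 0) (hη' : pderiv _ w η = 0)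
    (g : ℤ × Fn 𝕜 (Var m)) : pderiv _ w (factor ζ E η F g) = 0 := by
  simp [factor, Derivation.leibniz, pderiv_exp_subst hE, pderiv_taylor hη, hE', hη', hF,
    taylor_zero hη]

end Xi

/-- The relation between `M` and `N` spanned by a family of pairs `(g i, h i)`. -/
inductive SpanRel {ι M N : Type*} [Add M] [SMul ℂ M] [Add N] [SMul ℂ N] (g : ι → M) (h : ι → N) :
    M → N → Prop
  | gen (i : ι) : SpanRel g h (g i) (h i)
  | add {x x' : M} {y y' : N} : SpanRel g h x y → SpanRel g h x' y' →
      SpanRel g h (x + x') (y + y')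
  | smul (c : ℂ) {x : M} {y : N} : SpanRel g h x y → SpanRel g h (c • x) (c • y)

theorem SpanRel.map {ι M N : Type*} [AddCommGroup M] [Module ℂ M] [AddCommGroup N] [Module ℂ N]
    {g : ι → M} {h : ι → N} {D : M → M} (hD : ∀ x y, D (x + y) = D x + D y)
    (hD' : ∀ (c : ℂ) x, D (c • x) = c • D x) (D' : N →ₗ[ℂ] N)
    (H : ∀ i, SpanRel g h (D (g i)) (D' (h i))) {x : M} {y : N} (hxy : SpanRel g h x y) :
    SpanRel g h (D x) (D' y) := by
  induction hxy with
  | gen i => exact H i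
  | add _ _ h1 h2 => rw [hD, map_add]; exact h1.add h2
  | smul c _ h1 => rw [hD', map_smul]; exact h1.smul c

theorem SpanRel.map_eq_zero {ι M N : Type*} [AddCommGroup M] [Module ℂ M] [Add N] [SMul ℂ N]
    {g : ι → M} {h : ι → N} {D : M → M} (hD : ∀ x y, D (x + y) = D x + D y)
    (hD' : ∀ (c : ℂ) x, D (c • x) = c • D x) (H : ∀ i, D (g i) = 0) {x : M} {y : N}
    (hxy : SpanRel g h x y) : D x = 0 := by
  induction hxy with
  | gen i => exact H i
  | add _ _ h1 h2 => rw [hD, h1, h2, add_zero]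
  | smul c _ h1 => rw [hD', h1, smul_zero]

end Points

/-! ### The bilinear equation in terms of difference operators -/

section Symbols

open MvPowerSeries

/-- The operator `X ↦ ∂_v X + c X Λ ^ q + c' (∂_s X) Λ ^ q'`. -/
def rightD (v : Var m) (c : ℂ) (q : ℤ) (c' : ℂ) (q' : ℤ) : DiffOp 𝕜 m →ₗ[ℂ] DiffOp 𝕜 m where
  toFun X := (fun i => (X i).dVar v) + c • (fun i => X (i - q)) + c' • fun i => (X (i - q')).dS
  map_add' X Y := by
    ext1 i
    simp only [Pi.add_apply, Pi.smul_apply, dVar_add, dS_add, smul_add]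
    abel
  map_smul' d X := by
    ext1 i
    simp only [Pi.add_apply, Pi.smul_apply, dVar_smul, dS_smul, smul_add, RingHom.id_apply,
      smul_comm d]

/-- The operator `Y ↦ ∂_v Y + c' Λ ^ q' (∂_s Y)`. -/
def leftD (v : Var m) (c' : ℂ) (q' : ℤ) : DiffOp 𝕜 m →ₗ[ℂ] DiffOp 𝕜 m where
  toFun Y := (fun i => (Y i).dVar v) + c' • fun i => ((Y (i - q')).dS).shiftS q'
  map_add' X Y := by
    ext1 i
    simp only [Pi.add_apply, Pi.smul_apply, dVar_add, dS_add, smul_add, shiftS_add]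
    abel
  map_smul' d X := by
    ext1 i
    simp only [Pi.add_apply, Pi.smul_apply, dVar_smul, dS_smul, smul_add, RingHom.id_apply,
      smul_comm d, shiftS_smul]

/-- The operator with symbol `z ^ q * f(s, t + ε [ζ])`, where `ζ = z ^ e` and `q` is `g.1`. -/
def rightOp (e : ℤ) (p : ℕ+ → Time m) (ε : ℂ) (g : ℤ × Fn 𝕜 (Var m)) : DiffOp 𝕜 m :=
  fun i => shiftCoeffInt p ε (e * i - g.1) g.2

/-- The operator whose dual symbol, with the coefficients to the right of the powers of `Λ`,
is given by `f(s, t + ε [ζ])`. -/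
def leftOp (e : ℤ) (p : ℕ+ → Time m) (ε : ℂ) (g : ℤ × Fn 𝕜 (Var m)) : DiffOp 𝕜 m :=
  fun i => (shiftCoeffInt p ε (e * (i - 1) - g.1) g.2).shiftS i

variable {p : ℕ+ → Time m} {e : ℤ} {ε : ℂ} {j : ℤ}

section Generic

variable {K : Type*} [CommRing K] [Algebra ℂ K] {ζ : ℤ → K} {E η : MvPowerSeries (BVar m) K}
  {F : Fn 𝕜 (Var m) → MvPowerSeries (BVar m) K}

theorem spanRel_rightOp_pderiv (hp : p.Injective) (he : e * e = 1)
    (hζ : ∀ a b, ζ a * ζ b = ζ (a + b)) (hE : NoConst E) (hη : NoConst η)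
    {w : BVar m} {v : Var m} {c c' : ℂ} {a a' : ℤ} (hF : ∀ f, pderiv _ w (F f) = F (f.dVar v))
    (hE' : pderiv _ w E = c • C (ζ a)) (hη' : pderiv _ w η = c' • C (ζ a'))
    {Z : MvPowerSeries (BVar m) K} {X : DiffOp 𝕜 m}
    (h : SpanRel (factor ζ E η F) (rightOp e p ε) Z X) :
    SpanRel (factor ζ E η F) (rightOp e p ε) (pderiv _ w Z)
      (rightD v c (e * a) c' (e * a') X) := by
  refine SpanRel.map (map_add _) (pderiv_smul_complex w) _ (fun g => ?_) h
  rw [pderiv_factor hζ hE hη hF hE' hη']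
  convert! ((SpanRel.gen (g.1, g.2.dVar v)).add ((SpanRel.gen (g.1 + a, g.2)).smul c)).add
    ((SpanRel.gen (g.1 + a', g.2.dS)).smul c') using 1
  ext1 i
  have h1 : ∀ a, e * (i - e * a) - g.1 = e * i - (g.1 + a) := fun a => by
    linear_combination (-a) * he
  simp only [rightD, LinearMap.coe_mk, AddHom.coe_mk, Pi.add_apply, Pi.smul_apply, rightOp, h1,
    shiftCoeffInt_dVar hp, shiftCoeffInt_dS hp]

theorem spanRel_leftOp_pderiv (hp : p.Injective) (he : e * e = 1)
    (hζ : ∀ a b, ζ a * ζ b = ζ (a + b)) (hη : NoConst η)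
    {w : BVar m} {v : Var m} {c' : ℂ} {a' : ℤ} (hF : ∀ f, pderiv _ w (F f) = F (f.dVar v))
    (hη' : pderiv _ w η = c' • C (ζ a'))
    {Z : MvPowerSeries (BVar m) K} {X : DiffOp 𝕜 m}
    (h : SpanRel (factor ζ 0 η F) (leftOp e p ε) Z X) :
    SpanRel (factor ζ 0 η F) (leftOp e p ε) (pderiv _ w Z) (leftD v c' (e * a') X) := by
  refine SpanRel.map (map_add _) (pderiv_smul_complex w) _ (fun g => ?_) h
  rw [pderiv_factor hζ (map_zero _) hη hF (c := 0) (a := 0) (by rw [map_zero, zero_smul]) hη',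
    zero_smul, add_zero]
  convert! (SpanRel.gen (g.1, g.2.dVar v)).add ((SpanRel.gen (g.1 + a', g.2.dS)).smul c') using 1
  ext1 i
  have h1 : e * (i - e * a' - 1) - g.1 = e * (i - 1) - (g.1 + a') := by
    linear_combination (-a') * he
  simp only [leftD, LinearMap.coe_mk, AddHom.coe_mk, Pi.add_apply, Pi.smul_apply, leftOp, h1,
    shiftCoeffInt_dVar hp, shiftCoeffInt_dS hp, shiftS_dVar, ← shiftS_dS, shiftS_shiftS,
    add_sub_cancel]

theorem spanRel_pderiv_eq_zero {h : ℤ × Fn 𝕜 (Var m) → DiffOp 𝕜 m} (hE : NoConst E)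
    (hη : NoConst η) {w : BVar m}
    (hF : ∀ f, pderiv _ w (F f) = 0) (hE' : pderiv _ w E = 0) (hη' : pderiv _ w η = 0)
    {Z : MvPowerSeries (BVar m) K} {X : DiffOp 𝕜 m}
    (hZ : SpanRel (factor ζ E η F) h Z X) : pderiv _ w Z = 0 :=
  SpanRel.map_eq_zero (map_add _) (pderiv_smul_complex w)
    (fun g => pderiv_factor_eq_zero hE hη hF hE' hη' g) hZ

end Generic

/-! #### Values on the diagonal -/

variable {E η : LFn 𝕜 (BVar m)} {F : Fn 𝕜 (Var m) → LFn 𝕜 (BVar m)}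

theorem diag_smul_complex {K : Type*} [CommRing K] [Algebra ℂ K] (c : ℂ)
    (Z : MvPowerSeries (BVar m) K) : diag (c • Z) = c • diag Z :=
  AlgHom.map_smul_of_tower _ _ _

theorem diag_add_LFn (Z Z' : LFn 𝕜 (BVar m)) : diag (Z + Z') = diag Z + diag Z' :=
  map_add _ _ _

theorem diag_smul_LFn (c : ℂ) (Z : LFn 𝕜 (BVar m)) : diag (c • Z) = c • diag Z :=
  diag_smul_complex (K := LaurentSeries (SFun 𝕜)) c Z

/-- The vanishing of the coefficients of small powers of `ζ`, uniformly in the monomials. -/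
def LBdd (Z : LFn 𝕜 σ) : Prop := ∃ N : ℤ, ∀ i < N, lcoeff i Z = 0

theorem LBdd.add {Z Z' : LFn 𝕜 σ} (h : LBdd Z) (h' : LBdd Z') : LBdd (Z + Z') := by
  obtain ⟨N, hN⟩ := h
  obtain ⟨N', hN'⟩ := h'
  refine ⟨min N N', fun i hi => ?_⟩
  rw [lcoeff_add, hN i (lt_of_lt_of_le hi (min_le_left _ _)),
    hN' i (lt_of_lt_of_le hi (min_le_right _ _)), add_zero]

theorem LBdd.smul (c : ℂ) {Z : LFn 𝕜 σ} (h : LBdd Z) : LBdd (c • Z) := by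
  obtain ⟨N, hN⟩ := h
  refine ⟨N, fun i hi => ?_⟩
  rw [lcoeff_smul, hN i hi]
  exact smul_zero c

theorem SpanRel.lbdd_diag {h : ℤ × Fn 𝕜 (Var m) → DiffOp 𝕜 m}
    {Z : LFn 𝕜 (BVar m)} {X : DiffOp 𝕜 m} {g : ℤ × Fn 𝕜 (Var m) → LFn 𝕜 (BVar m)}
    (H : ∀ i, LBdd (diag (g i))) (hZ : SpanRel g h Z X) : LBdd (diag Z) := by
  induction hZ with
  | gen i => exact H i
  | add _ _ h1 h2 => rw [diag_add_LFn]; exact h1.add h2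
  | smul c _ h1 => rw [diag_smul_LFn]; exact h1.smul c

theorem lcoeff_diag_factor (hE : NoConst E) (hη : NoConst η) (hE' : diag E = 0) (hη' : diag η = 0)
    (i : ℤ) (g : ℤ × Fn 𝕜 (Var m)) :
    lcoeff i (diag (factor (zeta 𝕜) E η F g)) = lcoeff (i - g.1) (diag (F g.2)) := by
  rw [← lcoeff_C_zeta_mul]
  exact congrArg (lcoeff i) (diag_factor (K := LaurentSeries (SFun 𝕜)) hE hη hE' hη' g)

theorem SpanRel.lcoeff_diag_right {Z : LFn 𝕜 (BVar m)} {X : DiffOp 𝕜 m}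
    {g : ℤ × Fn 𝕜 (Var m) → LFn 𝕜 (BVar m)}
    (H : ∀ x i, lcoeff (e * i) (diag (g x)) = (rightOp e p ε x i).shiftS j)
    (hZ : SpanRel g (rightOp e p ε) Z X) (i : ℤ) :
    lcoeff (e * i) (diag Z) = (X i).shiftS j := by
  induction hZ with
  | gen x => exact H x i
  | add _ _ h1 h2 => rw [diag_add_LFn, lcoeff_add, h1, h2, Pi.add_apply, shiftS_add]
  | smul c _ h1 => rw [diag_smul_LFn, lcoeff_smul, h1, Pi.smul_apply, shiftS_smul]

theorem SpanRel.lcoeff_diag_left {Z : LFn 𝕜 (BVar m)} {X : DiffOp 𝕜 m}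
    {g : ℤ × Fn 𝕜 (Var m) → LFn 𝕜 (BVar m)}
    (H : ∀ x i, lcoeff (e * (i - 1)) (diag (g x)) = (leftOp e p ε x i).shiftS (-i))
    (hZ : SpanRel g (leftOp e p ε) Z X) (i : ℤ) :
    lcoeff (e * (i - 1)) (diag Z) = (X i).shiftS (-i) := by
  induction hZ with
  | gen x => exact H x i
  | add _ _ h1 h2 => rw [diag_add_LFn, lcoeff_add, h1, h2, Pi.add_apply, shiftS_add]
  | smul c _ h1 => rw [diag_smul_LFn, lcoeff_smul, h1, Pi.smul_apply, shiftS_smul]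

theorem shiftS_finsum (j : ℤ) (f : ℤ → Fn 𝕜 σ) :
    (∑ᶠ i, f i).shiftS j = ∑ᶠ i, (f i).shiftS j := by
  refine AddMonoidHom.map_finsum_of_injective
    (MvPowerSeries.map (σ := σ) (sShift (𝕜 := 𝕜) j)).toAddMonoidHom ?_ f
  intro x y h
  have h1 : Fn.shiftS (-j) (Fn.shiftS j x) = Fn.shiftS (-j) (Fn.shiftS j y) :=
    congrArg (Fn.shiftS (-j)) h
  rwa [shiftS_shiftS, shiftS_shiftS, neg_add_cancel, shiftS_zero_index, shiftS_zero_index] at h1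

theorem mul_Lam (X : DiffOp 𝕜 m) (q : ℤ) : mul X (Lam q) = fun i => X (i - q) := by
  ext1 i
  refine (finsum_eq_single _ (i - q) fun i' hi' => ?_).trans ?_
  · rw [Lam, Pi.single_eq_of_ne (by omega), shiftS_zero, mul_zero]
  · rw [Lam, sub_sub_cancel, Pi.single_eq_same, shiftS_one, mul_one]

theorem Lam_mul (q : ℤ) (Y : DiffOp 𝕜 m) : mul (Lam q) Y = fun i => (Y (i - q)).shiftS q := by
  ext1 i
  refine (finsum_eq_single _ q fun i' hi' => ?_).trans ?_
  · rw [Lam, Pi.single_eq_of_ne hi', zero_mul]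
  · rw [Lam, Pi.single_eq_same, one_mul]

/-- The residue of a product of two factors is a coefficient of the product of the corresponding
operators. -/
theorem lcoeff_diag_mul (he : e * e = 1) {Z T : LFn 𝕜 (BVar m)} {X Y : DiffOp 𝕜 m}
    (hZ : LBdd (diag Z)) (hT : LBdd (diag T)) (hX : ∀ i, lcoeff (e * i) (diag Z) = (X i).shiftS j)
    (hY : ∀ i, lcoeff (e * (i - 1)) (diag T) = (Y i).shiftS (-i)) (M : ℤ) :
    diag (lcoeff (-e) (C (zeta 𝕜 (e * (M + j))) * Z * T)) =
      (mul (mul X (Lam M)) Y (-j)).shiftS j := by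
  obtain ⟨N, hN⟩ := hZ
  obtain ⟨N', hN'⟩ := hT
  have h1 : diag (C (zeta 𝕜 (e * (M + j))) * Z * T) =
      C (zeta 𝕜 (e * (M + j))) * (diag Z * diag T) := by
    rw [mul_assoc, map_mul, map_mul, diag_C]
  rw [← lcoeff_diag, h1, lcoeff_C_zeta_mul, lcoeff_mul hN hN', mul_Lam, mul, shiftS_finsum]
  have hbij : Function.Bijective fun i : ℤ => e * (i - M) := by
    refine ⟨fun i i' h => ?_, fun r => ⟨e * r + M, ?_⟩⟩
    · have : e * (e * (i - M)) = e * (e * (i' - M)) := congrArg (e * ·) h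
      rw [← mul_assoc, ← mul_assoc, he] at this
      linarith
    · linear_combination r * he
  refine (finsum_eq_of_bijective _ hbij fun i => ?_).symm
  have h2 : -e - e * (M + j) - e * (i - M) = e * (-j - i - 1) := by ring
  rw [h2, hX, hY, shiftS_mul, shiftS_shiftS]
  congr 2
  ring

end Symbols

/-! ### The two sides of the bilinear equation as products of factors -/

section Bilinear

open MvPowerSeries

variable {p : ℕ+ → Time m} {e : ℤ} {ε : ℂ} {j : ℤ} {q : ℕ+}

open Classical in
/-- The factor with which the time variable `v` appears in `ξ - ξ_q / 2` for the sequence `p`. -/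
def timeWeight (p : ℕ+ → Time m) (q : ℕ+) (v : Time m) : ℂ :=
  if h : ∃ i, p i = v then weight q h.choose else 0

open Classical in
/-- The index of the time variable `v` in the sequence `p`. -/
def timeIndex (p : ℕ+ → Time m) (v : Time m) : ℤ :=
  if h : ∃ i, p i = v then (h.choose : ℤ) else 0

theorem timeWeight_apply (hp : p.Injective) (q i : ℕ+) : timeWeight p q (p i) = weight q i := by
  have h : ∃ i', p i' = p i := ⟨i, rfl⟩
  rw [timeWeight, dif_pos h, hp h.choose_spec]

theorem timeIndex_apply (hp : p.Injective) (i : ℕ+) : timeIndex p (p i) = i := by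
  have h : ∃ i', p i' = p i := ⟨i, rfl⟩
  rw [timeIndex, dif_pos h, hp h.choose_spec]

theorem timeWeight_eq_zero (q : ℕ+) {v : Time m} (hv : ∀ i, p i ≠ v) : timeWeight p q v = 0 :=
  dif_neg fun h => hv _ h.choose_spec

section Generic

variable {K : Type*} [CommRing K]

theorem noConst_neg_linForm (v : ℕ+ → BVar m) (c : ℕ+ → K) : NoConst (-linForm v c) := by
  rw [NoConst, map_neg, (noConst_linForm _ _).coeff_zero, neg_zero]

theorem diag_neg_linForm_eq_zero {v : ℕ+ → BVar m} (c : ℕ+ → K)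
    (hv : ∀ i, v i ∉ Set.range DVar.incl) : diag (-linForm v c) = 0 := by
  rw [map_neg, diag_linForm_eq_zero c hv, neg_zero]

theorem pderiv_neg_linForm_eq_zero {v : ℕ+ → BVar m} (c : ℕ+ → K) {w : BVar m}
    (hw : ∀ i, v i ≠ w) : pderiv _ w (-linForm v c) = 0 := by
  rw [map_neg, pderiv_linForm_eq_zero c hw, neg_zero]

theorem pderiv_C_mul_mul (w : σ) (c : K) (Z T : MvPowerSeries σ K) :
    pderiv _ w (C c * Z * T) = C c * pderiv _ w Z * T + C c * Z * pderiv _ w T := by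
  simp only [Derivation.leibniz, pderiv_C, smul_eq_mul]
  ring

theorem pderiv_zero_exponent (w : σ) : pderiv K w (0 : MvPowerSeries σ K) = 0 := map_zero _

theorem noConst_zero : NoConst (0 : MvPowerSeries σ K) := map_zero _

variable [Algebra ℂ K] (ζ : ℤ → K)

theorem pderiv_xi_apply (hp : p.Injective) (q : ℕ+) {T : Time m → BVar m} (hT : T.Injective)
    (v : Time m) : pderiv _ (T v) (xi ζ p q T) = timeWeight p q v • C (ζ (-timeIndex p v)) := by
  by_cases hv : ∃ i, p i = v
  · obtain ⟨i, rfl⟩ := hv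
    rw [pderiv_xi ζ hp q hT, timeWeight_apply hp, timeIndex_apply hp]
  · push Not at hv
    rw [pderiv_xi_eq_zero ζ q fun i h => hv i (hT h), timeWeight_eq_zero q hv, zero_smul]

/-- The difference of the exponents for two copies of the time variables. -/
def xiSub (p : ℕ+ → Time m) (q : ℕ+) (T T' : Time m → BVar m) : MvPowerSeries (BVar m) K :=
  xi ζ p q T - xi ζ p q T'

theorem noConst_xiSub (T T' : Time m → BVar m) : NoConst (xiSub ζ p q T T') := by
  rw [NoConst, xiSub, map_sub, (noConst_xi _ _ _ _).coeff_zero, (noConst_xi _ _ _ _).coeff_zero,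
    sub_zero]

theorem diag_xiSub (hp : p.Injective) :
    diag (xiSub ζ p q BVar.primed BVar.unprimed) = 0 ∧
      diag (xiSub ζ p q BVar.unprimed BVar.primed) = 0 := by
  rw [xiSub, xiSub, map_sub, map_sub, diag_xi_primed ζ hp, sub_self]
  exact ⟨rfl, rfl⟩

theorem primed_injective : (BVar.primed (m := m)).Injective := fun _ _ h => BVar.primed.inj h

theorem pderiv_primed_xiSub (hp : p.Injective) (v : Time m) :
    pderiv _ (BVar.primed v) (xiSub ζ p q BVar.primed BVar.unprimed) =
      timeWeight p q v • C (ζ (-timeIndex p v)) := by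
  rw [xiSub, map_sub, pderiv_xi_apply ζ hp q primed_injective,
    pderiv_xi_eq_zero ζ (T := BVar.unprimed) q (fun i h => by cases h), sub_zero]

theorem pderiv_primed_xiSub' (hp : p.Injective) (v : Time m) :
    pderiv _ (BVar.primed v) (xiSub ζ p q BVar.unprimed BVar.primed) =
      (-timeWeight p q v) • C (ζ (-timeIndex p v)) := by
  rw [xiSub, map_sub, pderiv_xi_apply ζ hp q primed_injective,
    pderiv_xi_eq_zero ζ (T := BVar.unprimed) q (fun i h => by cases h), zero_sub,
    neg_smul]

theorem pderiv_xiSub_eq_zero {T T' : Time m → BVar m} {w : BVar m} (h : ∀ i, T (p i) ≠ w)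
    (h' : ∀ i, T' (p i) ≠ w) : pderiv _ w (xiSub ζ p q T T') = 0 := by
  rw [xiSub, map_sub, pderiv_xi_eq_zero ζ q h, pderiv_xi_eq_zero ζ q h', sub_zero]

theorem pderiv_neg_linForm {v : ℕ+ → BVar m} (hv : v.Injective) (c : ℕ+ → K) (i : ℕ+) :
    pderiv _ (v i) (-linForm v c) = (-1 : ℂ) • C (c i) := by
  rw [map_neg, pderiv_linForm hv, neg_one_smul]

theorem exp_subst_zero :
    PowerSeries.subst (0 : MvPowerSeries σ K) (PowerSeries.exp ℂ) = 1 := by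
  rw [exp_subst_eq_taylor noConst_zero]
  ext1 d
  rw [taylor, coeff_formalSum (.taylor noConst_zero _) d (Nat.lt_succ_self _),
    Finset.sum_eq_single 0]
  · simp
  · intro r _ hr
    simp [zero_pow hr]
  · simp

end Generic

/-- The factors of the bilinear equation that depend on the primed variables. -/
def primedFactor (p : ℕ+ → Time m) (ε : ℂ) (q : ℕ+) (j : ℤ) (E : LFn 𝕜 (BVar m)) :
    ℤ × Fn 𝕜 (Var m) → LFn 𝕜 (BVar m) :=
  factor (K := LaurentSeries (SFun 𝕜)) (zeta 𝕜) E
    (-linForm BVar.a fun l => zeta 𝕜 (-(q * l : ℤ)))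
    fun f => toLFn (subst (point BVar.primed (bracket p ε) xPlusA) (f.shiftS j))

/-- The factors of the bilinear equation that depend on the unprimed variables. -/
def unprimedFactor (p : ℕ+ → Time m) (ε : ℂ) (q : ℕ+) :
    ℤ × Fn 𝕜 (Var m) → LFn 𝕜 (BVar m) :=
  factor (K := LaurentSeries (SFun 𝕜)) (zeta 𝕜) 0
    (-linForm BVar.b fun l => zeta 𝕜 (-(q * l : ℤ)))
    fun f => toLFn (subst (point BVar.unprimed (bracket p ε) xPlusB) (f.shiftS 0))

theorem one_mul_one_mul {K : Type*} [CommRing K] (Z : MvPowerSeries σ K) : C 1 * 1 * Z = Z := by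
  simp

theorem C_one_mul {K : Type*} [CommRing K] (Z : MvPowerSeries σ K) : C 1 * Z = Z := by
  simp

theorem mul_assoc_series {K : Type*} [CommRing K] (Z Z' Z'' : MvPowerSeries σ K) :
    Z * Z' * Z'' = Z * (Z' * Z'') := mul_assoc _ _ _

theorem mul_assoc_LFn (Z Z' Z'' : LFn 𝕜 σ) : Z * Z' * Z'' = Z * (Z' * Z'') :=
  mul_assoc_series (K := LaurentSeries (SFun 𝕜)) Z Z' Z''

theorem bilinearLeft_eq (τ : Fn 𝕜 (Var m)) (n : ℕ) (j : ℤ) :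
    bilinearLeft k τ n j = C (zeta 𝕜 (-1 * (n * k + j))) *
      primedFactor Time.t (-1) k j
        (xiSub (K := LaurentSeries (SFun 𝕜)) (zeta 𝕜) Time.t k BVar.primed BVar.unprimed) (0, τ) *
      unprimedFactor Time.t 1 k (0, τ) := by
  have h1 : unprimedFactor Time.t 1 k (0, τ) =
      tauAt τ 0 (-linSum BVar.b fun l => zeta 𝕜 (-(k * l : ℤ)))
        (point BVar.unprimed (bracket Time.t 1) xPlusB) := by
    rw [unprimedFactor, factor, exp_subst_zero]
    exact one_mul_one_mul (K := LaurentSeries (SFun 𝕜)) _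
  have h2 : primedFactor Time.t (-1) k j
      (xiSub (K := LaurentSeries (SFun 𝕜)) (zeta 𝕜) Time.t k BVar.primed BVar.unprimed) (0, τ) =
      lexp (xiT 𝕜 k BVar.primed - xiT 𝕜 k BVar.unprimed) *
      tauAt τ j (-linSum BVar.a fun l => zeta 𝕜 (-(k * l : ℤ)))
        (point BVar.primed (bracket Time.t (-1)) xPlusA) := by
    rw [primedFactor, factor, mul_assoc]
    exact C_one_mul (K := LaurentSeries (SFun 𝕜)) _
  rw [h1, h2, bilinearLeft, neg_one_mul, ← mul_assoc_LFn]

theorem bilinearRight_eq (τ : Fn 𝕜 (Var m)) (n : ℕ) (j : ℤ) :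
    bilinearRight k τ n j = C (zeta 𝕜 (1 * (-(n * m) + j))) *
      primedFactor (Time.tb k m) 1 m j
        (xiSub (K := LaurentSeries (SFun 𝕜)) (zeta 𝕜) (Time.tb k m) m BVar.unprimed BVar.primed)
        (0, τ.shiftS 1) *
      unprimedFactor (Time.tb k m) (-1) m (0, τ.shiftS (-1)) := by
  have hit : ∀ i r, Fn.dS^[r] (τ.shiftS i) = (Fn.dS^[r] τ).shiftS i := fun i r => by
    induction r with
    | zero => rfl
    | succ r ih => rw [Function.iterate_succ_apply', Function.iterate_succ_apply', ih, shiftS_dS]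
  have h1 : unprimedFactor (Time.tb k m) (-1) m (0, τ.shiftS (-1)) =
      tauAt τ (-1) (-linSum BVar.b fun l => zeta 𝕜 (-(m * l : ℤ)))
        (point BVar.unprimed (bracket (Time.tb k m) (-1)) xPlusB) := by
    rw [unprimedFactor, factor, exp_subst_zero]
    refine (one_mul_one_mul (K := LaurentSeries (SFun 𝕜)) _).trans ?_
    simp only [hit, shiftS_shiftS, zero_add]
    rfl
  have h2 : primedFactor (Time.tb k m) 1 m j
      (xiSub (K := LaurentSeries (SFun 𝕜)) (zeta 𝕜) (Time.tb k m) m BVar.unprimed BVar.primed)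
      (0, τ.shiftS 1) =
      lexp (xiTbar 𝕜 k BVar.unprimed - xiTbar 𝕜 k BVar.primed) *
      tauAt τ (j + 1) (-linSum BVar.a fun l => zeta 𝕜 (-(m * l : ℤ)))
        (point BVar.primed (bracket (Time.tb k m) 1) xPlusA) := by
    rw [primedFactor, factor, mul_assoc]
    refine (C_one_mul (K := LaurentSeries (SFun 𝕜)) _).trans ?_
    simp only [hit, shiftS_shiftS]
    rfl
  rw [h1, h2, bilinearRight, one_mul, ← mul_assoc_LFn]

end Bilinear

/-! ### Differentiation of the factors -/

section Relations

open MvPowerSeries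

variable {p : ℕ+ → Time m} {e : ℤ} {ε : ℂ} {j : ℤ} {q : ℕ+}

/-! #### Derivatives of the functions evaluated at the points of the bilinear equation -/

theorem dVar_primed_point (hp : p.Injective) (ε : ℂ) (v : Time m) :
    Fn.dVar (some (BVar.primed v))
        (point (𝕜 := 𝕜) BVar.primed (bracket p ε) xPlusA (Var.time v)) = 1 ∧
      ∀ u, u ≠ Var.time v → Fn.dVar (some (BVar.primed v))
        (point (𝕜 := 𝕜) BVar.primed (bracket p ε) xPlusA u) = 0 := by
  classical
  refine ⟨by rw [dVar_point_time hp, if_pos rfl], ?_⟩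
  rintro (u | l) hu
  · rw [dVar_point_time hp, if_neg fun h => hu (by cases h; rfl)]
  · exact (dVar_X_add_X _ _ _ (by simp)).trans (if_neg (by simp))

theorem dVar_a_point (hp : p.Injective) (ε : ℂ) (l : ℕ+) :
    Fn.dVar (some (BVar.a l))
        (point (𝕜 := 𝕜) BVar.primed (bracket p ε) xPlusA (Var.x l)) = 1 ∧
      ∀ u, u ≠ Var.x l → Fn.dVar (some (BVar.a l))
        (point (𝕜 := 𝕜) BVar.primed (bracket p ε) xPlusA u) = 0 := by
  classical
  refine ⟨(dVar_X_add_X _ _ _ (by simp)).trans (if_pos (Or.inr rfl)), ?_⟩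
  rintro (u | l') hu
  · rw [dVar_point_time hp, if_neg (by simp)]
  · exact (dVar_X_add_X _ _ _ (by simp)).trans (if_neg fun h => hu (by
      obtain h | h := h <;> cases h; rfl))

theorem dVar_b_point (hp : p.Injective) (ε : ℂ) (l : ℕ+) (u : Var m) :
    Fn.dVar (some (BVar.b l)) (point (𝕜 := 𝕜) BVar.primed (bracket p ε) xPlusA u) = 0 := by
  classical
  obtain u | l' := u
  · rw [dVar_point_time hp, if_neg (by simp)]
  · exact (dVar_X_add_X _ _ _ (by simp)).trans (if_neg (by simp))

theorem dVar_b_point' (hp : p.Injective) (ε : ℂ) (l : ℕ+) :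
    Fn.dVar (some (BVar.b l))
        (point (𝕜 := 𝕜) BVar.unprimed (bracket p ε) xPlusB (Var.x l)) = 1 ∧
      ∀ u, u ≠ Var.x l → Fn.dVar (some (BVar.b l))
        (point (𝕜 := 𝕜) BVar.unprimed (bracket p ε) xPlusB u) = 0 := by
  classical
  refine ⟨(dVar_X_add_X _ _ _ (by simp)).trans (if_pos (Or.inr rfl)), ?_⟩
  rintro (u | l') hu
  · rw [dVar_point_time hp, if_neg (by simp)]
  · exact (dVar_X_add_X _ _ _ (by simp)).trans (if_neg fun h => hu (by
      obtain h | h := h <;> cases h; rfl))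

theorem dVar_primed_point' (hp : p.Injective) (ε : ℂ) (v : Time m) (u : Var m) :
    Fn.dVar (some (BVar.primed v))
      (point (𝕜 := 𝕜) BVar.unprimed (bracket p ε) xPlusB u) = 0 := by
  classical
  obtain u | l' := u
  · rw [dVar_point_time hp, if_neg (by simp)]
  · exact (dVar_X_add_X _ _ _ (by simp)).trans (if_neg (by simp))

theorem dVar_a_point' (hp : p.Injective) (ε : ℂ) (l : ℕ+) (u : Var m) :
    Fn.dVar (some (BVar.a l))
      (point (𝕜 := 𝕜) BVar.unprimed (bracket p ε) xPlusB u) = 0 := by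
  classical
  obtain u | l' := u
  · rw [dVar_point_time hp, if_neg (by simp)]
  · exact (dVar_X_add_X _ _ _ (by simp)).trans (if_neg (by simp))

theorem pderiv_toLFn_subst {P : Var m → Fn 𝕜 (Option (BVar m))} (hP : HasSubst P) {w : BVar m}
    {v : Var m} (h : Fn.dVar (some w) (P v) = 1 ∧ ∀ u, u ≠ v → Fn.dVar (some w) (P u) = 0)
    (j : ℤ) (f : Fn 𝕜 (Var m)) : pderiv _ w (toLFn (subst P (f.shiftS j))) =
      toLFn (subst P ((f.dVar v).shiftS j)) := by
  rw [pderiv_toLFn, dVar_subst hP (some w) v h.1 h.2, shiftS_dVar]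

theorem pderiv_toLFn_subst_eq_zero {P : Var m → Fn 𝕜 (Option (BVar m))} (hP : HasSubst P)
    {w : BVar m} (h : ∀ u, Fn.dVar (some w) (P u) = 0) (f : Fn 𝕜 (Var m)) :
    pderiv _ w (toLFn (subst P f)) = 0 := by
  rw [pderiv_toLFn, dVar_subst_eq_zero hP _ h, toLFn_zero]

/-! #### The factors and the corresponding operators -/

/-- The functions generated by the factor of the bilinear equation which depends on the primed
variables, and the operators of which they are the symbols. -/
def PrimedRel (e : ℤ) (p : ℕ+ → Time m) (ε : ℂ) (q : ℕ+) (j : ℤ) (E : LFn 𝕜 (BVar m)) :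
    LFn 𝕜 (BVar m) → DiffOp 𝕜 m → Prop :=
  SpanRel (primedFactor p ε q j E) (rightOp e p ε)

/-- The functions generated by the factor of the bilinear equation which depends on the unprimed
variables, and the operators of which they are the dual symbols. -/
def UnprimedRel (𝕜 : Type*) [RCLike 𝕜] [NormedAlgebra 𝕜 ℂ] (e : ℤ) (p : ℕ+ → Time m) (ε : ℂ)
    (q : ℕ+) : LFn 𝕜 (BVar m) → DiffOp 𝕜 m → Prop :=
  SpanRel (unprimedFactor p ε q) (leftOp e p ε)

/-- The properties of the exponents of the bilinear equation, where `r v` is the factor with which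
the variable `v'` appears. -/
structure IsExponent {K : Type*} [CommRing K] [Algebra ℂ K] (ζ : ℤ → K) (p : ℕ+ → Time m)
    (r : Time m → ℂ) (E : MvPowerSeries (BVar m) K) : Prop where
  noConst : NoConst E
  diag_eq : diag E = 0
  primed : ∀ v, pderiv K (BVar.primed v) E = r v • C (ζ (-timeIndex p v))
  a : ∀ l, pderiv K (BVar.a l) E = 0
  b : ∀ l, pderiv K (BVar.b l) E = 0

theorem isExponent_xiSub {K : Type*} [CommRing K] [Algebra ℂ K] (ζ : ℤ → K) (hp : p.Injective) :
    IsExponent ζ p (timeWeight p q) (xiSub ζ p q BVar.primed BVar.unprimed) where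
  noConst := noConst_xiSub ζ _ _
  diag_eq := (diag_xiSub ζ hp).1
  primed := pderiv_primed_xiSub ζ hp
  a _ := pderiv_xiSub_eq_zero ζ (by simp) (by simp)
  b _ := pderiv_xiSub_eq_zero ζ (by simp) (by simp)

theorem isExponent_xiSub' {K : Type*} [CommRing K] [Algebra ℂ K] (ζ : ℤ → K) (hp : p.Injective) :
    IsExponent ζ p (fun v => -timeWeight p q v) (xiSub ζ p q BVar.unprimed BVar.primed) where
  noConst := noConst_xiSub ζ _ _
  diag_eq := (diag_xiSub ζ hp).2
  primed := pderiv_primed_xiSub' ζ hp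
  a _ := pderiv_xiSub_eq_zero ζ (by simp) (by simp)
  b _ := pderiv_xiSub_eq_zero ζ (by simp) (by simp)

theorem eq_zero_smul_C {K : Type*} [CommRing K] [Algebra ℂ K] {Z : MvPowerSeries σ K} (h : Z = 0)
    (c : K) : Z = (0 : ℂ) • C c := by rw [h, zero_smul]

section Primed

variable {r : Time m → ℂ} {E : LFn 𝕜 (BVar m)} {Z : LFn 𝕜 (BVar m)} {X : DiffOp 𝕜 m}

theorem a_injective : (BVar.a (m := m)).Injective := fun _ _ h => BVar.a.inj h

theorem b_injective : (BVar.b (m := m)).Injective := fun _ _ h => BVar.b.inj h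

theorem PrimedRel.pderiv_primed (hp : p.Injective) (he : e * e = 1)
    (hE : IsExponent (K := LaurentSeries (SFun 𝕜)) (zeta 𝕜) p r E) (v : Time m)
    (h : PrimedRel e p ε q j E Z X) :
    PrimedRel e p ε q j E (pderiv _ (BVar.primed v) Z)
      (rightD (Var.time v) (r v) (e * -timeIndex p v) 0 (e * 0) X) := by
  refine spanRel_rightOp_pderiv (K := LaurentSeries (SFun 𝕜)) hp he zeta_mul hE.noConst
    (noConst_neg_linForm _ _)
    (pderiv_toLFn_subst (hasSubst_primed hp ε) (dVar_primed_point hp ε v) j) (hE.primed v)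
    (eq_zero_smul_C (pderiv_neg_linForm_eq_zero _ (by simp)) _) h

theorem PrimedRel.pderiv_a (hp : p.Injective) (he : e * e = 1)
    (hE : IsExponent (K := LaurentSeries (SFun 𝕜)) (zeta 𝕜) p r E) (l : ℕ+)
    (h : PrimedRel e p ε q j E Z X) :
    PrimedRel e p ε q j E (pderiv _ (BVar.a l) Z)
      (rightD (Var.x l) 0 (e * 0) (-1) (e * (-(q * l : ℤ))) X) := by
  refine spanRel_rightOp_pderiv (K := LaurentSeries (SFun 𝕜)) hp he zeta_mul hE.noConst
    (noConst_neg_linForm _ _)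
    (pderiv_toLFn_subst (hasSubst_primed hp ε) (dVar_a_point hp ε l) j)
    (eq_zero_smul_C (hE.a l) _) (pderiv_neg_linForm (K := LaurentSeries (SFun 𝕜)) (v := BVar.a) a_injective
      (fun l => zeta 𝕜 (-(q * l : ℤ))) l) h

theorem PrimedRel.pderiv_b (hp : p.Injective)
    (hE : IsExponent (K := LaurentSeries (SFun 𝕜)) (zeta 𝕜) p r E) (l : ℕ+)
    (h : PrimedRel e p ε q j E Z X) : pderiv (LaurentSeries (SFun 𝕜)) (BVar.b l) Z = 0 :=
  spanRel_pderiv_eq_zero (K := LaurentSeries (SFun 𝕜)) hE.noConst (noConst_neg_linForm _ _)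
    (fun _ => pderiv_toLFn_subst_eq_zero (hasSubst_primed hp ε) (dVar_b_point hp ε l) _) (hE.b l)
    (pderiv_neg_linForm_eq_zero _ (by simp)) h

theorem a_notMem_range (l : ℕ+) : (BVar.a l : BVar m) ∉ Set.range DVar.incl := by
  rintro ⟨_ | _ | _, h⟩ <;> cases h

theorem b_notMem_range (l : ℕ+) : (BVar.b l : BVar m) ∉ Set.range DVar.incl := by
  rintro ⟨_ | _ | _, h⟩ <;> cases h

theorem PrimedRel.lbdd (hp : p.Injective)
    (hE : IsExponent (K := LaurentSeries (SFun 𝕜)) (zeta 𝕜) p r E)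
    (h : PrimedRel e p ε q j E Z X) : LBdd (diag Z) := by
  refine SpanRel.lbdd_diag (fun g => ⟨g.1, fun i hi => ?_⟩) h
  rw [primedFactor, lcoeff_diag_factor hE.noConst
    (noConst_neg_linForm (K := LaurentSeries (SFun 𝕜)) _ _)
    hE.diag_eq (diag_neg_linForm_eq_zero (K := LaurentSeries (SFun 𝕜)) _ a_notMem_range),
    lcoeff_diag_toLFn_subst hp ε (hasSubst_primed hp ε) diag_X_primed diagZeta_xPlusA,
    shiftCoeffInt_of_neg (by omega)]

theorem PrimedRel.lcoeff (hp : p.Injective)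
    (hE : IsExponent (K := LaurentSeries (SFun 𝕜)) (zeta 𝕜) p r E)
    (h : PrimedRel e p ε q j E Z X) (i : ℤ) : lcoeff (e * i) (diag Z) = (X i).shiftS j := by
  refine SpanRel.lcoeff_diag_right (fun g i => ?_) h i
  rw [primedFactor, lcoeff_diag_factor hE.noConst
    (noConst_neg_linForm (K := LaurentSeries (SFun 𝕜)) _ _)
    hE.diag_eq (diag_neg_linForm_eq_zero (K := LaurentSeries (SFun 𝕜)) _ a_notMem_range),
    lcoeff_diag_toLFn_subst hp ε (hasSubst_primed hp ε) diag_X_primed diagZeta_xPlusA,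
    shiftCoeffInt_shiftS hp]
  rfl

theorem UnprimedRel.pderiv_b (hp : p.Injective) (he : e * e = 1) {l : ℕ+}
    (h : UnprimedRel 𝕜 e p ε q Z X) :
    UnprimedRel 𝕜 e p ε q (pderiv _ (BVar.b l) Z)
      (leftD (Var.x l) (-1) (e * (-(q * l : ℤ))) X) :=
  spanRel_leftOp_pderiv (K := LaurentSeries (SFun 𝕜)) hp he zeta_mul
    (noConst_neg_linForm _ _)
    (pderiv_toLFn_subst (hasSubst_unprimed hp ε) (dVar_b_point' hp ε l) 0)
    (pderiv_neg_linForm (K := LaurentSeries (SFun 𝕜)) (v := BVar.b) b_injective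
      (fun l => zeta 𝕜 (-(q * l : ℤ))) l) h

theorem UnprimedRel.pderiv_primed (hp : p.Injective) (v : Time m)
    (h : UnprimedRel 𝕜 e p ε q Z X) :
    pderiv (LaurentSeries (SFun 𝕜)) (BVar.primed v) Z = 0 :=
  spanRel_pderiv_eq_zero (K := LaurentSeries (SFun 𝕜)) noConst_zero (noConst_neg_linForm _ _)
    (fun _ => pderiv_toLFn_subst_eq_zero (hasSubst_unprimed hp ε) (dVar_primed_point' hp ε v) _)
    (pderiv_zero_exponent _) (pderiv_neg_linForm_eq_zero _ (by simp)) h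

theorem UnprimedRel.pderiv_a (hp : p.Injective) (l : ℕ+) (h : UnprimedRel 𝕜 e p ε q Z X) :
    pderiv (LaurentSeries (SFun 𝕜)) (BVar.a l) Z = 0 :=
  spanRel_pderiv_eq_zero (K := LaurentSeries (SFun 𝕜)) noConst_zero (noConst_neg_linForm _ _)
    (fun _ => pderiv_toLFn_subst_eq_zero (hasSubst_unprimed hp ε) (dVar_a_point' hp ε l) _)
    (pderiv_zero_exponent _) (pderiv_neg_linForm_eq_zero _ (by simp)) h

theorem UnprimedRel.lbdd (hp : p.Injective) (h : UnprimedRel 𝕜 e p ε q Z X) : LBdd (diag Z) := by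
  refine SpanRel.lbdd_diag (fun g => ⟨g.1, fun i hi => ?_⟩) h
  rw [unprimedFactor, lcoeff_diag_factor (noConst_zero (K := LaurentSeries (SFun 𝕜)))
    (noConst_neg_linForm (K := LaurentSeries (SFun 𝕜)) _ _) (map_zero _)
    (diag_neg_linForm_eq_zero (K := LaurentSeries (SFun 𝕜)) _ b_notMem_range),
    lcoeff_diag_toLFn_subst hp ε (hasSubst_unprimed hp ε) diag_X_unprimed diagZeta_xPlusB,
    shiftCoeffInt_of_neg (by omega)]

theorem UnprimedRel.lcoeff (hp : p.Injective) (h : UnprimedRel 𝕜 e p ε q Z X) (i : ℤ) :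
    lcoeff (e * (i - 1)) (diag Z) = (X i).shiftS (-i) := by
  refine SpanRel.lcoeff_diag_left (fun g i => ?_) h i
  rw [unprimedFactor, lcoeff_diag_factor (noConst_zero (K := LaurentSeries (SFun 𝕜)))
    (noConst_neg_linForm (K := LaurentSeries (SFun 𝕜)) _ _) (map_zero _)
    (diag_neg_linForm_eq_zero (K := LaurentSeries (SFun 𝕜)) _ b_notMem_range),
    lcoeff_diag_toLFn_subst hp ε (hasSubst_unprimed hp ε) diag_X_unprimed diagZeta_xPlusB,
    leftOp, shiftS_shiftS, neg_add_cancel, shiftCoeffInt_shiftS hp]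

theorem diag_lcoeff_mul (hp : p.Injective) (he : e * e = 1)
    (hE : IsExponent (K := LaurentSeries (SFun 𝕜)) (zeta 𝕜) p r E)
    (h : PrimedRel e p ε q j E Z X) {ε' : ℂ} {T : LFn 𝕜 (BVar m)} {Y : DiffOp 𝕜 m}
    (h' : UnprimedRel 𝕜 e p ε' q T Y) (M : ℤ) :
    diag (EBTH.lcoeff (-e) (C (zeta 𝕜 (e * (M + j))) * Z * T)) =
      (mul (mul X (Lam M)) Y (-j)).shiftS j :=
  lcoeff_diag_mul he (h.lbdd hp hE) (h'.lbdd hp) (h.lcoeff hp hE) (h'.lcoeff hp) M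

end Primed

/-! #### Derivatives of the bilinear equation -/

theorem lcoeff_C_mul_mul_dVar (i : ℤ) (w : σ) (c : LaurentSeries (SFun 𝕜)) (Z T : LFn 𝕜 σ) :
    (lcoeff i (C c * Z * T)).dVar w =
      lcoeff i (C c * pderiv (LaurentSeries (SFun 𝕜)) w Z * T) +
        lcoeff i (C c * Z * pderiv (LaurentSeries (SFun 𝕜)) w T) := by
  rw [← lcoeff_pderiv, ← lcoeff_add]
  exact congrArg (lcoeff i) (pderiv_C_mul_mul (K := LaurentSeries (SFun 𝕜)) w c Z T)

theorem lcoeff_mul_zero (i : ℤ) (Z : LFn 𝕜 σ) : lcoeff i (Z * 0) = 0 := by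
  rw [← lcoeff_zero i]
  congr 1
  exact mul_zero Z

theorem lcoeff_mul_zero_mul (i : ℤ) (Z T : LFn 𝕜 σ) : lcoeff i (Z * 0 * T) = 0 := by
  have h : Z * 0 = 0 := mul_zero Z
  have h' : (0 : LFn 𝕜 σ) * T = 0 := zero_mul T
  rw [h, h', lcoeff_zero]

end Relations

/-! ### The bilinear equation as a family of operator identities -/

section Operators

open MvPowerSeries

/-- The operator `X ↦ ∂_v X + r X Λ ^ i`, for `v = t_i`, where `r` is the factor of `t_i z ^ i`
in the exponent `ξ - ξ_k / 2`. -/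
def timeD (k : ℕ+) (v : Time m) : DiffOp 𝕜 m →ₗ[ℂ] DiffOp 𝕜 m :=
  rightD (Var.time v) (timeWeight Time.t k v) (-1 * -timeIndex Time.t v) 0 (-1 * 0)

/-- The operator `X ↦ ∂_v X - r X Λ ^ (-j)`, for `v = tbar_j`, where `r` is the factor of
`tbar_j z ^ (-j)` in the exponent `ξ - ξ_m / 2`. -/
def barTimeD (k : ℕ+) (v : Time m) : DiffOp 𝕜 m →ₗ[ℂ] DiffOp 𝕜 m :=
  rightD (Var.time v) (-timeWeight (Time.tb k m) m v) (1 * -timeIndex (Time.tb k m) v) 0 (1 * 0)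

/-- The operator `X ↦ ∂_{x_l} X - (∂_s X) Λ ^ q`. -/
def logD (q : ℤ) (l : ℕ+) : DiffOp 𝕜 m →ₗ[ℂ] DiffOp 𝕜 m := rightD (Var.x l) 0 0 (-1) q

/-- The operator `Y ↦ ∂_{x_l} Y - Λ ^ q (∂_s Y)`. -/
def dualLogD (q : ℤ) (l : ℕ+) : DiffOp 𝕜 m →ₗ[ℂ] DiffOp 𝕜 m := leftD (Var.x l) (-1) q

/-- The operator with symbol `τ(s, t - [z⁻¹])`. -/
def upOp (τ : Fn 𝕜 (Var m)) : DiffOp 𝕜 m := rightOp (-1) Time.t (-1) (0, τ)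

/-- The operator with symbol `τ(s + 1, tbar + [z])`. -/
def downOp (k : ℕ+) (τ : Fn 𝕜 (Var m)) : DiffOp 𝕜 m :=
  rightOp 1 (Time.tb k m) 1 (0, τ.shiftS 1)

/-- The operator with dual symbol given by `τ(s, t + [z⁻¹])`. -/
def dualUpOp (τ : Fn 𝕜 (Var m)) : DiffOp 𝕜 m := leftOp (-1) Time.t 1 (0, τ)

/-- The operator with dual symbol given by `τ(s - 1, tbar - [z])`. -/
def dualDownOp (k : ℕ+) (τ : Fn 𝕜 (Var m)) : DiffOp 𝕜 m :=
  leftOp 1 (Time.tb k m) (-1) (0, τ.shiftS (-1))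

/-- The relation between factors and operators, for the left-hand side of the bilinear equation. -/
def UpRel (𝕜 : Type*) [RCLike 𝕜] [NormedAlgebra 𝕜 ℂ] (k : ℕ+) (j : ℤ) :
    LFn 𝕜 (BVar m) → DiffOp 𝕜 m → Prop :=
  PrimedRel (-1) Time.t (-1) k j
    (xiSub (K := LaurentSeries (SFun 𝕜)) (zeta 𝕜) Time.t k BVar.primed BVar.unprimed)

/-- The relation between factors and operators, for the right-hand side of the bilinear
equation. -/
def DownRel (𝕜 : Type*) [RCLike 𝕜] [NormedAlgebra 𝕜 ℂ] (k : ℕ+) (j : ℤ) :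
    LFn 𝕜 (BVar m) → DiffOp 𝕜 m → Prop :=
  PrimedRel 1 (Time.tb k m) 1 m j
    (xiSub (K := LaurentSeries (SFun 𝕜)) (zeta 𝕜) (Time.tb k m) m BVar.unprimed BVar.primed)

/-- The integrand of the left-hand side for general factors. -/
def upResidue (k : ℕ+) (n : ℕ) (j : ℤ) (Z T : LFn 𝕜 (BVar m)) : Fn 𝕜 (BVar m) :=
  lcoeff 1 (C (zeta 𝕜 (-1 * (n * k + j))) * Z * T)

/-- The integrand of the right-hand side for general factors. -/
def downResidue (m : ℕ+) (n : ℕ) (j : ℤ) (Z T : LFn 𝕜 (BVar m)) : Fn 𝕜 (BVar m) :=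
  lcoeff (-1) (C (zeta 𝕜 (1 * (-(n * m) + j))) * Z * T)

theorem residueInfty_bilinearLeft (τ : Fn 𝕜 (Var m)) (n : ℕ) (j : ℤ) :
    ∃ Z T, UpRel 𝕜 k j Z (upOp τ) ∧ UnprimedRel 𝕜 (-1) Time.t 1 k T (dualUpOp τ) ∧
      residueInfty (bilinearLeft k τ n j) = upResidue k n j Z T :=
  ⟨_, _, SpanRel.gen (0, τ), SpanRel.gen (0, τ), by
    rw [residueInfty_eq, bilinearLeft_eq]; rfl⟩

theorem residueZero_bilinearRight (τ : Fn 𝕜 (Var m)) (n : ℕ) (j : ℤ) :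
    ∃ Z T, DownRel 𝕜 k j Z (downOp k τ) ∧
      UnprimedRel 𝕜 1 (Time.tb k m) (-1) m T (dualDownOp k τ) ∧
      residueZero (bilinearRight k τ n j) = downResidue m n j Z T :=
  ⟨_, _, SpanRel.gen (0, τ.shiftS 1), SpanRel.gen (0, τ.shiftS (-1)), by
    rw [residueZero_eq, bilinearRight_eq]; rfl⟩

variable {n : ℕ} {j : ℤ} {Z T : LFn 𝕜 (BVar m)} {X Y : DiffOp 𝕜 m}

theorem diag_upResidue (hZ : UpRel 𝕜 k j Z X) (hT : UnprimedRel 𝕜 (-1) Time.t 1 k T Y) (n : ℕ) :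
    diag (upResidue k n j Z T) = (mul (mul X (Lam (n * k))) Y (-j)).shiftS j :=
  diag_lcoeff_mul Time.t_injective (by norm_num)
    (isExponent_xiSub (K := LaurentSeries (SFun 𝕜)) (zeta 𝕜) Time.t_injective) hZ hT (n * k)

theorem diag_downResidue (hZ : DownRel 𝕜 k j Z X)
    (hT : UnprimedRel 𝕜 1 (Time.tb k m) (-1) m T Y) (n : ℕ) :
    diag (downResidue m n j Z T) = (mul (mul X (Lam (-(n * m)))) Y (-j)).shiftS j :=
  diag_lcoeff_mul Time.tb_injective (by norm_num)
    (isExponent_xiSub' (K := LaurentSeries (SFun 𝕜)) (zeta 𝕜) Time.tb_injective) hZ hT (-(n * m))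

theorem upResidue_primed (hZ : UpRel 𝕜 k j Z X) (hT : UnprimedRel 𝕜 (-1) Time.t 1 k T Y) (n : ℕ)
    (v : Time m) : ∃ Z', UpRel 𝕜 k j Z' (timeD k v X) ∧
      (upResidue k n j Z T).dVar (BVar.primed v) = upResidue k n j Z' T := by
  refine ⟨_, PrimedRel.pderiv_primed Time.t_injective (by norm_num)
    (isExponent_xiSub (K := LaurentSeries (SFun 𝕜)) (zeta 𝕜) Time.t_injective) v hZ, ?_⟩
  rw [upResidue, lcoeff_C_mul_mul_dVar, hT.pderiv_primed Time.t_injective v, lcoeff_mul_zero,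
    add_zero, upResidue]

theorem upResidue_a (hZ : UpRel 𝕜 k j Z X) (hT : UnprimedRel 𝕜 (-1) Time.t 1 k T Y) (n : ℕ)
    (l : ℕ+) : ∃ Z', UpRel 𝕜 k j Z' (logD (k * l) l X) ∧
      (upResidue k n j Z T).dVar (BVar.a l) = upResidue k n j Z' T := by
  refine ⟨pderiv (LaurentSeries (SFun 𝕜)) (BVar.a l) Z, ?_, ?_⟩
  · have := PrimedRel.pderiv_a Time.t_injective (by norm_num)
      (isExponent_xiSub (K := LaurentSeries (SFun 𝕜)) (zeta 𝕜) Time.t_injective) l hZ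
    rwa [neg_one_mul, neg_one_mul, neg_neg, neg_zero] at this
  · rw [upResidue, lcoeff_C_mul_mul_dVar, hT.pderiv_a Time.t_injective l, lcoeff_mul_zero,
      add_zero, upResidue]

theorem upResidue_b (hZ : UpRel 𝕜 k j Z X) (hT : UnprimedRel 𝕜 (-1) Time.t 1 k T Y) (n : ℕ)
    (l : ℕ+) : ∃ T', UnprimedRel 𝕜 (-1) Time.t 1 k T' (dualLogD (k * l) l Y) ∧
      (upResidue k n j Z T).dVar (BVar.b l) = upResidue k n j Z T' := by
  refine ⟨pderiv (LaurentSeries (SFun 𝕜)) (BVar.b l) T, ?_, ?_⟩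
  · have := hT.pderiv_b Time.t_injective (by norm_num) (l := l)
    rwa [neg_one_mul, neg_neg] at this
  · rw [upResidue, lcoeff_C_mul_mul_dVar, PrimedRel.pderiv_b Time.t_injective
      (isExponent_xiSub (K := LaurentSeries (SFun 𝕜)) (zeta 𝕜) Time.t_injective) l hZ,
      lcoeff_mul_zero_mul, zero_add, upResidue]

theorem downResidue_primed (hZ : DownRel 𝕜 k j Z X)
    (hT : UnprimedRel 𝕜 1 (Time.tb k m) (-1) m T Y) (n : ℕ)
    (v : Time m) : ∃ Z', DownRel 𝕜 k j Z' (barTimeD k v X) ∧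
      (downResidue m n j Z T).dVar (BVar.primed v) = downResidue m n j Z' T := by
  refine ⟨_, PrimedRel.pderiv_primed Time.tb_injective (by norm_num)
    (isExponent_xiSub' (K := LaurentSeries (SFun 𝕜)) (zeta 𝕜) Time.tb_injective) v hZ, ?_⟩
  rw [downResidue, lcoeff_C_mul_mul_dVar, hT.pderiv_primed Time.tb_injective v, lcoeff_mul_zero,
    add_zero, downResidue]

theorem downResidue_a (hZ : DownRel 𝕜 k j Z X)
    (hT : UnprimedRel 𝕜 1 (Time.tb k m) (-1) m T Y) (n : ℕ)
    (l : ℕ+) : ∃ Z', DownRel 𝕜 k j Z' (logD (-(m * l)) l X) ∧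
      (downResidue m n j Z T).dVar (BVar.a l) = downResidue m n j Z' T := by
  refine ⟨pderiv (LaurentSeries (SFun 𝕜)) (BVar.a l) Z, ?_, ?_⟩
  · have := PrimedRel.pderiv_a Time.tb_injective (by norm_num)
      (isExponent_xiSub' (K := LaurentSeries (SFun 𝕜)) (zeta 𝕜) Time.tb_injective) l hZ
    rwa [one_mul, one_mul] at this
  · rw [downResidue, lcoeff_C_mul_mul_dVar, hT.pderiv_a Time.tb_injective l, lcoeff_mul_zero,
      add_zero, downResidue]

theorem downResidue_b (hZ : DownRel 𝕜 k j Z X)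
    (hT : UnprimedRel 𝕜 1 (Time.tb k m) (-1) m T Y) (n : ℕ)
    (l : ℕ+) : ∃ T', UnprimedRel 𝕜 1 (Time.tb k m) (-1) m T' (dualLogD (-(m * l)) l Y) ∧
      (downResidue m n j Z T).dVar (BVar.b l) = downResidue m n j Z T' := by
  refine ⟨pderiv (LaurentSeries (SFun 𝕜)) (BVar.b l) T, ?_, ?_⟩
  · have := hT.pderiv_b Time.tb_injective (by norm_num) (l := l)
    rwa [one_mul] at this
  · rw [downResidue, lcoeff_C_mul_mul_dVar, PrimedRel.pderiv_b Time.tb_injective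
      (isExponent_xiSub' (K := LaurentSeries (SFun 𝕜)) (zeta 𝕜) Time.tb_injective) l hZ,
      lcoeff_mul_zero_mul, zero_add, downResidue]

/-- The bilinear equation holds as soon as the operators with the symbols in question belong to
families of pairs that are compatible with the derivatives of the bilinear equation, and whose
products agree. -/
theorem satisfiesBilinear_of_pairs {τ : Fn 𝕜 (Var m)} (M₁ M₂ : DiffOp 𝕜 m → DiffOp 𝕜 m → Prop)
    (htime : ∀ X Xb, M₁ X Xb → ∀ v, M₁ (timeD k v X) (barTimeD k v Xb))
    (hlog : ∀ X Xb, M₁ X Xb → ∀ l : ℕ+, M₁ (logD (k * l) l X) (logD (-(m * l)) l Xb))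
    (hdual : ∀ Y Yb, M₂ Y Yb → ∀ l : ℕ+, M₂ (dualLogD (k * l) l Y) (dualLogD (-(m * l)) l Yb))
    (hmul : ∀ X Xb Y Yb, M₁ X Xb → M₂ Y Yb → ∀ n : ℕ,
      mul (mul X (Lam (n * k))) Y = mul (mul Xb (Lam (-(n * m)))) Yb)
    (h₁ : M₁ (upOp τ) (downOp k τ)) (h₂ : M₂ (dualUpOp τ) (dualDownOp k τ)) :
    SatisfiesBilinear k τ := by
  intro n j
  obtain ⟨Z, T, hZ, hT, hl⟩ := residueInfty_bilinearLeft (k := k) τ n j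
  obtain ⟨Z', T', hZ', hT', hr⟩ := residueZero_bilinearRight (k := k) τ n j
  rw [hl, hr, ← sub_eq_zero]
  refine eq_zero_of_forall_diag_eq_zero {G | ∃ X Xb Y Yb Z T Z' T', M₁ X Xb ∧ M₂ Y Yb ∧
    UpRel 𝕜 k j Z X ∧ UnprimedRel 𝕜 (-1) Time.t 1 k T Y ∧ DownRel 𝕜 k j Z' Xb ∧
    UnprimedRel 𝕜 1 (Time.tb k m) (-1) m T' Yb ∧
    G = upResidue k n j Z T - downResidue m n j Z' T'} ?_ ?_ ?_ ?_
    ⟨_, _, _, _, Z, T, Z', T', h₁, h₂, hZ, hT, hZ', hT', rfl⟩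
  · rintro _ ⟨X, Xb, Y, Yb, Z, T, Z', T', hM₁, hM₂, hZ, hT, hZ', hT', rfl⟩
    rw [map_sub, diag_upResidue hZ hT, diag_downResidue hZ' hT', hmul X Xb Y Yb hM₁ hM₂ n, sub_self]
  · rintro _ ⟨X, Xb, Y, Yb, Z, T, Z', T', hM₁, hM₂, hZ, hT, hZ', hT', rfl⟩ v
    obtain ⟨W, hW, hW'⟩ := upResidue_primed hZ hT n v
    obtain ⟨V, hV, hV'⟩ := downResidue_primed hZ' hT' n v
    exact ⟨_, _, _, _, _, _, _, _, htime _ _ hM₁ v, hM₂, hW, hT, hV, hT', by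
      rw [dVar_sub, hW', hV']⟩
  · rintro _ ⟨X, Xb, Y, Yb, Z, T, Z', T', hM₁, hM₂, hZ, hT, hZ', hT', rfl⟩ l
    obtain ⟨W, hW, hW'⟩ := upResidue_a hZ hT n l
    obtain ⟨V, hV, hV'⟩ := downResidue_a hZ' hT' n l
    exact ⟨_, _, _, _, _, _, _, _, hlog _ _ hM₁ l, hM₂, hW, hT, hV, hT', by
      rw [dVar_sub, hW', hV']⟩
  · rintro _ ⟨X, Xb, Y, Yb, Z, T, Z', T', hM₁, hM₂, hZ, hT, hZ', hT', rfl⟩ l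
    obtain ⟨W, hW, hW'⟩ := upResidue_b hZ hT n l
    obtain ⟨V, hV, hV'⟩ := downResidue_b hZ' hT' n l
    exact ⟨_, _, _, _, _, _, _, _, hM₁, hdual _ _ hM₂ l, hZ, hW, hZ', hV, by
      rw [dVar_sub, hW', hV']⟩

theorem shiftS_injective (j : ℤ) : Function.Injective (Fn.shiftS (𝕜 := 𝕜) (σ := σ) j) := by
  intro x y h
  have h1 : Fn.shiftS (-j) (Fn.shiftS j x) = Fn.shiftS (-j) (Fn.shiftS j y) :=
    congrArg (Fn.shiftS (-j)) h
  rwa [shiftS_shiftS, shiftS_shiftS, neg_add_cancel, shiftS_zero_index, shiftS_zero_index] at h1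

/-- The bilinear equation and its first derivatives for `t' = t`, `a = b = 0`, as identities
between difference operators. -/
theorem SatisfiesBilinear.operators {τ : Fn 𝕜 (Var m)} (h : SatisfiesBilinear k τ) (n : ℕ) :
    mul (mul (upOp τ) (Lam (n * k))) (dualUpOp τ) =
        mul (mul (downOp k τ) (Lam (-(n * m)))) (dualDownOp k τ) ∧
      (∀ v, mul (mul (timeD k v (upOp τ)) (Lam (n * k))) (dualUpOp τ) =
        mul (mul (barTimeD k v (downOp k τ)) (Lam (-(n * m)))) (dualDownOp k τ)) ∧
      ∀ l : ℕ+, mul (mul (logD (k * l) l (upOp τ)) (Lam (n * k))) (dualUpOp τ) =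
        mul (mul (logD (-(m * l)) l (downOp k τ)) (Lam (-(n * m)))) (dualDownOp k τ) := by
  refine ⟨?_, fun v => ?_, fun l => ?_⟩ <;>
  · ext1 i
    obtain ⟨j, rfl⟩ : ∃ j, i = -j := ⟨-i, (neg_neg i).symm⟩
    apply shiftS_injective j
    have hG := h n j
    obtain ⟨Z, T, hZ, hT, hl⟩ := residueInfty_bilinearLeft (k := k) τ n j
    obtain ⟨Z', T', hZ', hT', hr⟩ := residueZero_bilinearRight (k := k) τ n j
    rw [hl, hr] at hG
    first
    | rw [← diag_upResidue hZ hT, ← diag_downResidue hZ' hT', hG]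
    | obtain ⟨W, hW, hW'⟩ := upResidue_primed hZ hT n v
      obtain ⟨V, hV, hV'⟩ := downResidue_primed hZ' hT' n v
      rw [← diag_upResidue hW hT, ← diag_downResidue hV hT', ← hW', ← hV', hG]
    | obtain ⟨W, hW, hW'⟩ := upResidue_a hZ hT n l
      obtain ⟨V, hV, hV'⟩ := downResidue_a hZ' hT' n l
      rw [← diag_upResidue hW hT, ← diag_downResidue hV hT', ← hW', ← hV', hG]

end Operators

/-! ### Rings of difference operators -/

section Rings

/-- The powers of `Λ` are bounded from above, for `e = 1`, or from below, for `e = -1`,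
by the number `N` or `-N`. -/
def BddBy (e : ℤˣ) (N : ℤ) (A : DiffOp 𝕜 m) : Prop := ∀ i : ℤ, N < e * i → A i = 0

/-- The powers of `Λ` are bounded from above, for `e = 1`, or from below, for `e = -1`. -/
def Bdd (e : ℤˣ) (A : DiffOp 𝕜 m) : Prop := ∃ N : ℤ, BddBy e N A

theorem bdd_one_iff {A : DiffOp 𝕜 m} : Bdd 1 A ↔ A.BddAbove := by
  simp [Bdd, BddBy, DiffOp.BddAbove]

theorem bdd_neg_one_iff {A : DiffOp 𝕜 m} : Bdd (-1) A ↔ A.BddBelow := by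
  constructor
  · rintro ⟨N, hN⟩
    exact ⟨-N, fun i hi => hN i (by simp; omega)⟩
  · rintro ⟨N, hN⟩
    exact ⟨-N, fun i hi => hN i (by simp at hi; omega)⟩

/-- All coefficients of the product of `A` and `B` are given by finite sums. -/
def FinMul (A B : DiffOp 𝕜 m) : Prop := ∀ p, {i : ℤ | A i ≠ 0 ∧ B (p - i) ≠ 0}.Finite

variable {e : ℤˣ} {A B C : DiffOp 𝕜 m}

theorem unit_mul_unit_mul (e : ℤˣ) (i : ℤ) : (e : ℤ) * (e * i) = i := by
  rw [← mul_assoc, Int.units_coe_mul_self, one_mul]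

theorem unit_mul_injective (e : ℤˣ) : Function.Injective fun i : ℤ => (e : ℤ) * i :=
  fun i i' h => by rw [← unit_mul_unit_mul e i, ← unit_mul_unit_mul e i']; exact congrArg _ h

theorem finMul_of_bdd (hA : Bdd e A) (hB : Bdd e B) : FinMul A B := by
  obtain ⟨N, hN⟩ := hA
  obtain ⟨N', hN'⟩ := hB
  intro p
  refine ((Set.finite_Icc (e * p - N') N).preimage (unit_mul_injective e).injOn).subset ?_
  rintro i ⟨h1, h2⟩
  have h3 : (e : ℤ) * i ≤ N := by
    by_contra h
    exact h1 (hN i (not_le.1 h))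
  have h4 : (e : ℤ) * (p - i) ≤ N' := by
    by_contra h
    exact h2 (hN' _ (not_le.1 h))
  rw [mul_sub] at h4
  exact ⟨by dsimp only; linarith, h3⟩

theorem finMul_of_finite (hA : ∀ e, Bdd e A) (B : DiffOp 𝕜 m) : FinMul A B := by
  obtain ⟨N, hN⟩ := hA 1
  obtain ⟨N', hN'⟩ := hA (-1)
  intro p
  refine (Set.finite_Icc (-N') N).subset ?_
  rintro i ⟨h1, -⟩
  constructor
  · by_contra h
    exact h1 (hN' i (by simp; omega))
  · by_contra h
    exact h1 (hN i (by simp; omega))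

theorem FinMul.hasFiniteSupport (h : FinMul A B) (p : ℤ) :
    (Function.support fun i => A i * (B (p - i)).shiftS i).Finite := by
  refine (h p).subset fun i hi => ⟨left_ne_zero_of_mul hi, fun h0 => right_ne_zero_of_mul hi ?_⟩
  rw [h0, shiftS_zero]

theorem FinMul.mul_add (h : FinMul A B) (h' : FinMul A C) :
    mul A (B + C) = mul A B + mul A C := by
  ext1 p
  rw [Pi.add_apply, mul, mul, mul, ← finsum_add_distrib (h.hasFiniteSupport p)
    (h'.hasFiniteSupport p)]
  simp only [Pi.add_apply, shiftS_add, _root_.mul_add]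

theorem FinMul.add_mul (h : FinMul A C) (h' : FinMul B C) :
    mul (A + B) C = mul A C + mul B C := by
  ext1 p
  rw [Pi.add_apply, mul, mul, mul, ← finsum_add_distrib (h.hasFiniteSupport p)
    (h'.hasFiniteSupport p)]
  simp only [Pi.add_apply, _root_.add_mul]

theorem smul_mul (c : ℂ) (A B : DiffOp 𝕜 m) : mul (c • A) B = c • mul A B := by
  ext1 p
  rw [Pi.smul_apply, mul, mul]
  by_cases hc : c = 0
  · simp [hc]
  · have h := AddMonoidHom.map_finsum_of_injective
      (DistribSMul.toAddMonoidHom (Fn 𝕜 (Var m)) c) (smul_right_injective _ hc)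
      fun i => A i * (B (p - i)).shiftS i
    refine Eq.trans ?_ h.symm
    simp only [Pi.smul_apply, smul_mul_assoc, DistribSMul.toAddMonoidHom_apply]

theorem mul_smul' (c : ℂ) (A B : DiffOp 𝕜 m) : mul A (c • B) = c • mul A B := by
  ext1 p
  rw [← smul_mul, mul, mul]
  simp only [Pi.smul_apply, shiftS_smul, smul_mul_assoc, mul_smul_comm]

theorem mul_assoc_of_bdd (hA : Bdd e A) (hB : Bdd e B) (hC : Bdd e C) :
    mul (mul A B) C = mul A (mul B C) := by
  have hAB := finMul_of_bdd hA hB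
  have hBC := finMul_of_bdd hB hC
  ext1 p
  let f : ℤ × ℤ → Fn 𝕜 (Var m) := fun x => A x.2 * (B (x.1 - x.2)).shiftS x.2 *
    (C (p - x.1)).shiftS x.1
  have hf : (Function.support f).Finite := by
    obtain ⟨N, hN⟩ := hA
    obtain ⟨N', hN'⟩ := hB
    obtain ⟨N'', hN''⟩ := hC
    have hinj : Function.Injective fun x : ℤ × ℤ => ((e : ℤ) * x.1, (e : ℤ) * x.2) :=
      fun x y h => Prod.ext (unit_mul_injective e (Prod.mk.inj h).1)
        (unit_mul_injective e (Prod.mk.inj h).2)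
    refine (((Set.finite_Icc (e * p - N'') (N + N')).prod
      (Set.finite_Icc (e * p - N'' - N') N)).preimage hinj.injOn).subset ?_
    rintro ⟨i, j⟩ hx
    have h1 := right_ne_zero_of_mul hx
    have h2 := left_ne_zero_of_mul (left_ne_zero_of_mul hx)
    have h3 := right_ne_zero_of_mul (left_ne_zero_of_mul hx)
    simp only at h1 h2 h3
    have h4 : (e : ℤ) * j ≤ N := by
      by_contra h
      exact h2 (hN _ (not_le.1 h))
    have h5 : (e : ℤ) * (i - j) ≤ N' := by
      by_contra h
      rw [hN' _ (not_le.1 h), shiftS_zero] at h3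
      exact h3 rfl
    have h6 : (e : ℤ) * (p - i) ≤ N'' := by
      by_contra h
      rw [hN'' _ (not_le.1 h), shiftS_zero] at h1
      exact h1 rfl
    rw [mul_sub] at h5 h6
    simp only [Set.mem_preimage, Set.mem_prod, Set.mem_Icc]
    refine ⟨⟨?_, ?_⟩, ?_, ?_⟩ <;> linarith
  have h1 : mul (mul A B) C p = ∑ᶠ x, f x := by
    rw [finsum_curry f hf]
    refine finsum_congr fun i => ?_
    exact finsum_mul' _ _ (hAB.hasFiniteSupport i)
  have h2 : mul A (mul B C) p = ∑ᶠ x, f (Prod.swap x) := by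
    rw [finsum_curry (fun x => f (Prod.swap x)) (hf.preimage Prod.swap_injective.injOn)]
    refine finsum_congr fun j => ?_
    rw [mul, shiftS_finsum, mul_finsum']
    · refine (finsum_comp_equiv (Equiv.addRight (-j)) (f := fun l => A j *
        (B l * (C (p - j - l)).shiftS l).shiftS j)).symm.trans (finsum_congr fun i => ?_)
      simp only [f, Equiv.coe_addRight, Prod.swap, shiftS_mul, shiftS_shiftS, ← sub_eq_add_neg,
        add_sub_cancel, sub_sub_sub_cancel_right, mul_assoc]
    · refine (hBC.hasFiniteSupport (p - j)).subset fun l hl h0 => hl ?_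
      simp only [h0, shiftS_zero]
  rw [h1, h2]
  exact (finsum_comp_equiv (Equiv.prodComm ℤ ℤ)).symm

theorem BddBy.mono {N N' : ℤ} (h : BddBy e N A) (hN : N ≤ N') : BddBy e N' A :=
  fun i hi => h i (by omega)

theorem BddBy.mul {N N' : ℤ} (hA : BddBy e N A) (hB : BddBy e N' B) :
    BddBy e (N + N') (mul A B) := by
  intro p hp
  refine finsum_eq_zero_of_forall_eq_zero fun i => ?_
  by_cases h : N < e * i
  · rw [hA i h, zero_mul]
  · rw [hB (p - i) (by rw [mul_sub]; omega), shiftS_zero, mul_zero]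

/-- The leading coefficient of a product. -/
theorem BddBy.mul_apply {i j : ℤ} (hA : BddBy e (e * i) A) (hB : BddBy e (e * j) B) :
    DiffOp.mul A B (i + j) = A i * (B j).shiftS i := by
  refine (finsum_eq_single _ i fun i' hi' => ?_).trans (by rw [add_sub_cancel_left])
  by_cases h : (e : ℤ) * i < e * i'
  · rw [hA i' h, zero_mul]
  · have h1 : (e : ℤ) * i' ≠ e * i := fun h => hi' (unit_mul_injective e h)
    rw [hB (i + j - i'), shiftS_zero, mul_zero]
    rw [mul_sub, _root_.mul_add]
    omega

theorem Bdd.mul (hA : Bdd e A) (hB : Bdd e B) : Bdd e (mul A B) := by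
  obtain ⟨N, hN⟩ := hA
  obtain ⟨N', hN'⟩ := hB
  exact ⟨N + N', hN.mul hN'⟩

theorem bdd_single (e : ℤˣ) (n : ℤ) (f : Fn 𝕜 (Var m)) : Bdd e (Pi.single n f : DiffOp 𝕜 m) :=
  ⟨e * n, fun i hi => Pi.single_eq_of_ne (by rintro rfl; exact lt_irrefl _ hi) _⟩

variable (𝕜 m e) in
/-- The difference operators whose powers of `Λ` are bounded from above, for `e = 1`, or from
below, for `e = -1`. -/
def boundedOps : Submodule ℂ (DiffOp 𝕜 m) where
  carrier := {A | Bdd e A}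
  add_mem' := by
    rintro A B ⟨N, hN⟩ ⟨N', hN'⟩
    refine ⟨max N N', fun i hi => ?_⟩
    rw [Pi.add_apply, hN i (lt_of_le_of_lt (le_max_left _ _) hi),
      hN' i (lt_of_le_of_lt (le_max_right _ _) hi), add_zero]
  zero_mem' := ⟨0, fun _ _ => rfl⟩
  smul_mem' := by
    rintro c A ⟨N, hN⟩
    exact ⟨N, fun i hi => by rw [Pi.smul_apply, hN i hi, smul_zero]⟩

variable (𝕜 m e) in
/-- The ring of difference operators bounded in one direction. -/
abbrev Op : Type _ := boundedOps 𝕜 m e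

instance : Mul (Op 𝕜 m e) := ⟨fun a b => ⟨mul a b, Bdd.mul a.2 b.2⟩⟩

instance : One (Op 𝕜 m e) := ⟨⟨Lam 0, bdd_single e 0 1⟩⟩

@[simp] theorem Op.coe_mul (a b : Op 𝕜 m e) : ((a * b : Op 𝕜 m e) : DiffOp 𝕜 m) = mul a b := rfl

theorem Op.coe_one : ((1 : Op 𝕜 m e) : DiffOp 𝕜 m) = Lam 0 := rfl

theorem Op.ext {a b : Op 𝕜 m e} (h : ∀ i, (a : DiffOp 𝕜 m) i = (b : DiffOp 𝕜 m) i) : a = b :=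
  Subtype.ext (funext h)

theorem mul_zero' (A : DiffOp 𝕜 m) : mul A 0 = 0 := by
  ext1 p
  simp [mul, shiftS_zero]

theorem zero_mul' (A : DiffOp 𝕜 m) : mul 0 A = 0 := by
  ext1 p
  simp [mul]

theorem mul_Lam_zero (A : DiffOp 𝕜 m) : mul A (Lam 0) = A := by
  rw [mul_Lam]
  simp

theorem Lam_zero_mul (A : DiffOp 𝕜 m) : mul (Lam 0) A = A := by
  rw [Lam_mul]
  simp [shiftS_zero_index]

instance : Ring (Op 𝕜 m e) :=
  { (inferInstance : AddCommGroup (Op 𝕜 m e)) with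
    mul_assoc := fun a b c => Subtype.ext (mul_assoc_of_bdd a.2 b.2 c.2)
    one_mul := fun a => Subtype.ext (Lam_zero_mul _)
    mul_one := fun a => Subtype.ext (mul_Lam_zero _)
    left_distrib := fun a b c =>
      Subtype.ext ((finMul_of_bdd a.2 b.2).mul_add (finMul_of_bdd a.2 c.2))
    right_distrib := fun a b c =>
      Subtype.ext ((finMul_of_bdd a.2 c.2).add_mul (finMul_of_bdd b.2 c.2))
    zero_mul := fun a => Subtype.ext (zero_mul' _)
    mul_zero := fun a => Subtype.ext (mul_zero' _) }

instance : Algebra ℂ (Op 𝕜 m e) :=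
  Algebra.ofModule (fun c _ _ => Subtype.ext (smul_mul c _ _))
    fun c _ _ => Subtype.ext (mul_smul' c _ _)

variable (e) in
/-- The operator `f Λ ^ n`. -/
def mono (f : Fn 𝕜 (Var m)) (n : ℤ) : Op 𝕜 m e := ⟨Pi.single n f, bdd_single e n f⟩

theorem coe_mono_one (n : ℤ) : ((mono e 1 n : Op 𝕜 m e) : DiffOp 𝕜 m) = Lam n := rfl

theorem mono_apply_self (f : Fn 𝕜 (Var m)) (n : ℤ) : (mono e f n : DiffOp 𝕜 m) n = f :=
  Pi.single_eq_same (M := fun _ => Fn 𝕜 (Var m)) n f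

theorem mono_apply_of_ne (f : Fn 𝕜 (Var m)) {n i : ℤ} (h : i ≠ n) :
    (mono e f n : DiffOp 𝕜 m) i = 0 := Pi.single_eq_of_ne (M := fun _ => Fn 𝕜 (Var m)) h f

theorem mono_mul_apply (f : Fn 𝕜 (Var m)) (n : ℤ) (a : Op 𝕜 m e) (i : ℤ) :
    ((mono e f n * a : Op 𝕜 m e) : DiffOp 𝕜 m) i =
      f * ((a : DiffOp 𝕜 m) (i - n)).shiftS n := by
  refine (finsum_eq_single _ n fun i' hi' => ?_).trans ?_
  · rw [mono_apply_of_ne f hi', zero_mul]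
  · rw [mono_apply_self]

theorem mul_mono_apply (f : Fn 𝕜 (Var m)) (n : ℤ) (a : Op 𝕜 m e) (i : ℤ) :
    ((a * mono e f n : Op 𝕜 m e) : DiffOp 𝕜 m) i =
      (a : DiffOp 𝕜 m) (i - n) * f.shiftS (i - n) := by
  refine (finsum_eq_single _ (i - n) fun i' hi' => ?_).trans ?_
  · rw [mono_apply_of_ne f (by omega), shiftS_zero, mul_zero]
  · rw [sub_sub_cancel, mono_apply_self]

theorem mono_mul_mono (f g : Fn 𝕜 (Var m)) (n n' : ℤ) :
    (mono e f n * mono e g n' : Op 𝕜 m e) = mono e (f * g.shiftS n) (n + n') := by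
  refine Op.ext fun i => ?_
  rw [mono_mul_apply]
  by_cases h : i = n + n'
  · rw [h, add_sub_cancel_left, mono_apply_self, mono_apply_self]
  · rw [mono_apply_of_ne _ h, mono_apply_of_ne _ (by omega), shiftS_zero, mul_zero]

theorem mono_one_zero : (mono e 1 0 : Op 𝕜 m e) = 1 := rfl

theorem coe_npow (a : Op 𝕜 m e) (n : ℕ) :
    ((a ^ n : Op 𝕜 m e) : DiffOp 𝕜 m) = DiffOp.npow a n := by
  induction n with
  | zero => rfl
  | succ n ih => rw [pow_succ', Op.coe_mul, ih]; rfl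

/-- A derivation of the functions that commutes with the translations of `s` acts as a derivation
on difference operators. -/
def opDer (e : ℤˣ) (δ : Derivation ℂ (Fn 𝕜 (Var m)) (Fn 𝕜 (Var m))) :
    Op 𝕜 m e →ₗ[ℂ] Op 𝕜 m e where
  toFun a := ⟨fun i => δ ((a : DiffOp 𝕜 m) i), by
    obtain ⟨N, hN⟩ := a.2
    exact ⟨N, fun i hi => (congrArg δ (hN i hi)).trans (map_zero δ)⟩⟩
  map_add' a b := Op.ext fun i => map_add δ _ _
  map_smul' c a := Op.ext fun i => δ.map_smul c _

variable {δ : Derivation ℂ (Fn 𝕜 (Var m)) (Fn 𝕜 (Var m))}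

theorem opDer_apply (a : Op 𝕜 m e) (i : ℤ) :
    (opDer e δ a : DiffOp 𝕜 m) i = δ ((a : DiffOp 𝕜 m) i) := rfl

theorem opDer_mul (hδ : ∀ j f, δ (Fn.shiftS j f) = (δ f).shiftS j) (a b : Op 𝕜 m e) :
    opDer e δ (a * b) = opDer e δ a * b + a * opDer e δ b := by
  refine Op.ext fun p => ?_
  have h1 := finMul_of_bdd a.2 b.2
  have h2 := finMul_of_bdd (opDer e δ a).2 b.2
  have h3 := finMul_of_bdd a.2 (opDer e δ b).2
  have h4 := AddMonoidHom.map_finsum (f := fun i => (a : DiffOp 𝕜 m) i *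
    ((b : DiffOp 𝕜 m) (p - i)).shiftS i) (δ : Fn 𝕜 (Var m) →+ Fn 𝕜 (Var m)) (h1.hasFiniteSupport p)
  refine h4.trans ?_
  change _ = mul _ _ p + mul _ _ p
  rw [mul, mul, ← finsum_add_distrib (h2.hasFiniteSupport p) (h3.hasFiniteSupport p)]
  refine finsum_congr fun i => ?_
  change δ (_ * _) = _
  rw [δ.leibniz, smul_eq_mul, smul_eq_mul, hδ, opDer_apply, opDer_apply]
  ring

theorem opDer_mono (hδ : δ 1 = 0) (n : ℤ) : opDer e δ (mono e 1 n) = 0 := by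
  refine Op.ext fun i => ?_
  rw [opDer_apply]
  by_cases h : i = n
  · rw [h, mono_apply_self, hδ]; rfl
  · rw [mono_apply_of_ne _ h, map_zero]; rfl

theorem opDer_one : opDer e δ 1 = 0 := opDer_mono δ.map_one_eq_zero 0

end Rings

/-! ### Dressing -/

section Dressing

variable {e : ℤˣ}

/-- An operator bounded from above and an operator bounded from below are the same (finite)
difference operator. -/
def Agree (a : Op 𝕜 m 1) (b : Op 𝕜 m (-1)) : Prop := (a : DiffOp 𝕜 m) = b

theorem Agree.add {a a' : Op 𝕜 m 1} {b b' : Op 𝕜 m (-1)} (h : Agree a b) (h' : Agree a' b') :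
    Agree (a + a') (b + b') := congrArg₂ (· + ·) h h'

theorem Agree.sub {a a' : Op 𝕜 m 1} {b b' : Op 𝕜 m (-1)} (h : Agree a b) (h' : Agree a' b') :
    Agree (a - a') (b - b') := congrArg₂ (· - ·) h h'

theorem Agree.mul {a a' : Op 𝕜 m 1} {b b' : Op 𝕜 m (-1)} (h : Agree a b) (h' : Agree a' b') :
    Agree (a * a') (b * b') := congrArg₂ DiffOp.mul h h'

theorem agree_one : Agree (1 : Op 𝕜 m 1) 1 := rfl

theorem agree_mono (f : Fn 𝕜 (Var m)) (n : ℤ) : Agree (mono 1 f n) (mono (-1) f n) := rfl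

theorem Agree.pow {a : Op 𝕜 m 1} {b : Op 𝕜 m (-1)} (h : Agree a b) (n : ℕ) :
    Agree (a ^ n) (b ^ n) := by
  induction n with
  | zero => exact agree_one
  | succ n ih => rw [pow_succ, pow_succ]; exact ih.mul h

theorem Agree.opDer {a : Op 𝕜 m 1} {b : Op 𝕜 m (-1)} (h : Agree a b)
    (δ : Derivation ℂ (Fn 𝕜 (Var m)) (Fn 𝕜 (Var m))) : Agree (opDer 1 δ a) (opDer (-1) δ b) :=
  congrArg (fun (A : DiffOp 𝕜 m) i => δ (A i)) h

theorem mono_one_mul_mono_one (n n' : ℤ) :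
    (mono e 1 n * mono e 1 n' : Op 𝕜 m e) = mono e 1 (n + n') := by
  rw [mono_mul_mono, shiftS_one, mul_one]

theorem mono_one_pow (n : ℤ) (l : ℕ) : (mono e 1 n : Op 𝕜 m e) ^ l = mono e 1 (l * n) := by
  induction l with
  | zero => rw [pow_zero, Nat.cast_zero, zero_mul]; rfl
  | succ l ih =>
    rw [pow_succ, ih, mono_one_mul_mono_one]
    congr 1
    push_cast
    ring

theorem conj_pow' {R : Type*} [Ring R] {w w' : R} (h : w' * w = 1) (h' : w * w' = 1) (u : R)
    (l : ℕ) : (w * u * w') ^ l = w * u ^ l * w' := by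
  induction l with
  | zero => rw [pow_zero, pow_zero, mul_one, h']
  | succ l ih =>
    rw [pow_succ, ih, pow_succ]
    calc w * u ^ l * w' * (w * u * w') = w * u ^ l * (w' * w) * u * w' := by noncomm_ring
      _ = _ := by rw [h]; noncomm_ring

variable {δ : Derivation ℂ (Fn 𝕜 (Var m)) (Fn 𝕜 (Var m))}

/-- The derivative of an inverse. -/
theorem mul_opDer_inv (hδ : ∀ j f, δ (Fn.shiftS j f) = (δ f).shiftS j) {w w' : Op 𝕜 m e}
    (h' : w * w' = 1) : w * opDer e δ w' = -(opDer e δ w * w') := by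
  have h1 := congrArg (opDer e δ) h'
  rw [opDer_mul hδ, opDer_one] at h1
  rwa [eq_neg_iff_add_eq_zero, add_comm]

/-- The derivative of a conjugate of a constant operator is a commutator. -/
theorem opDer_conj (hδ : ∀ j f, δ (Fn.shiftS j f) = (δ f).shiftS j) {w w' u : Op 𝕜 m e}
    (h : w' * w = 1) (h' : w * w' = 1) (hu : opDer e δ u = 0) :
    opDer e δ (w * u * w') = opDer e δ w * w' * (w * u * w') -
      w * u * w' * (opDer e δ w * w') := by
  have h1 := mul_opDer_inv hδ h'
  rw [opDer_mul hδ, opDer_mul hδ, hu, mul_zero, add_zero]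
  have h2 : opDer e δ w' = w' * w * opDer e δ w' := by rw [h, one_mul]
  have h3 : opDer e δ w * w' * (w * u * w') = opDer e δ w * (w' * w) * u * w' := by noncomm_ring
  have h4 : w * u * (w' * w * opDer e δ w') = w * u * w' * (w * opDer e δ w') := by noncomm_ring
  rw [h2, h4, h1, h3, h]
  noncomm_ring

/-- Dressing operators for which `W Λ ^ k W⁻¹ = Wb Λ ^ (-m) Wb⁻¹`. -/
structure IsDressing (k : ℕ+) (W Winv : Op 𝕜 m 1) (Wb Wbinv : Op 𝕜 m (-1)) : Prop where
  mul_inv : W * Winv = 1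
  inv_mul : Winv * W = 1
  bar_mul_inv : Wb * Wbinv = 1
  bar_inv_mul : Wbinv * Wb = 1
  agree : Agree (W * mono 1 1 k * Winv) (Wb * mono (-1) 1 (-m) * Wbinv)

variable {W Winv : Op 𝕜 m 1} {Wb Wbinv : Op 𝕜 m (-1)}

theorem IsDressing.pow (h : IsDressing k W Winv Wb Wbinv) (l : ℕ) :
    (W * mono 1 1 k * Winv) ^ l = W * mono 1 1 (l * k) * Winv := by
  rw [conj_pow' h.inv_mul h.mul_inv, mono_one_pow]

theorem IsDressing.bar_pow (h : IsDressing k W Winv Wb Wbinv) (l : ℕ) :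
    (Wb * mono (-1) 1 (-m) * Wbinv) ^ l = Wb * mono (-1) 1 (-(l * m)) * Wbinv := by
  rw [conj_pow' h.bar_inv_mul h.bar_mul_inv, mono_one_pow, mul_neg]

theorem IsDressing.agree_pow (h : IsDressing k W Winv Wb Wbinv) (l : ℕ) :
    Agree (W * mono 1 1 (l * k) * Winv) (Wb * mono (-1) 1 (-(l * m)) * Wbinv) := by
  rw [← h.pow, ← h.bar_pow]
  exact h.agree.pow l

/-- The flow with respect to the derivation `δ`, for an operator with parts `B_+` and `B_-`, in a
form where the two dressing operators enter symmetrically: `(δ W) W⁻¹ + B = (δ Wb) Wb⁻¹`. -/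
def IsFlow (W Winv : Op 𝕜 m 1) (Wb Wbinv : Op 𝕜 m (-1))
    (δ : Derivation ℂ (Fn 𝕜 (Var m)) (Fn 𝕜 (Var m))) (B : DiffOp 𝕜 m) : Prop :=
  ((opDer 1 δ W * Winv : Op 𝕜 m 1) : DiffOp 𝕜 m) + B = (opDer (-1) δ Wb * Wbinv : Op 𝕜 m (-1))

theorem pos_add_neg (B : DiffOp 𝕜 m) : B.pos + B.neg = B := by
  ext1 i
  rw [Pi.add_apply, DiffOp.pos, DiffOp.neg]
  split_ifs <;> first | omega | simp

theorem neg_bdd (B : DiffOp 𝕜 m) : Bdd 1 B.neg :=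
  ⟨-1, fun i hi => if_neg (by simp at hi; omega)⟩

theorem pos_bdd (B : DiffOp 𝕜 m) : Bdd (-1) B.pos :=
  ⟨0, fun i hi => if_neg (by simp at hi; omega)⟩

theorem isFlow_of_flows (h : IsDressing k W Winv Wb Wbinv) {B : DiffOp 𝕜 m}
    (hW : (opDer 1 δ W : DiffOp 𝕜 m) = -mul B.neg W)
    (hWb : (opDer (-1) δ Wb : DiffOp 𝕜 m) = mul B.pos Wb) : IsFlow W Winv Wb Wbinv δ B := by
  have h1 : opDer 1 δ W = -((⟨B.neg, neg_bdd B⟩ : Op 𝕜 m 1) * W) := Subtype.ext hW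
  have h2 : opDer (-1) δ Wb = (⟨B.pos, pos_bdd B⟩ : Op 𝕜 m (-1)) * Wb := Subtype.ext hWb
  rw [IsFlow, h1, h2, neg_mul, mul_assoc, mul_assoc, h.mul_inv, h.bar_mul_inv, mul_one, mul_one]
  change -B.neg + B = B.pos
  nth_rw 2 [← pos_add_neg B]
  abel

theorem IsFlow.parts (hWtop : BddBy 1 0 (W : DiffOp 𝕜 m))
    (hW0 : (W : DiffOp 𝕜 m) 0 = 1) (hWinv : BddBy 1 0 (Winv : DiffOp 𝕜 m))
    (hWb : BddBy (-1) 0 (Wb : DiffOp 𝕜 m)) (hWbinv : BddBy (-1) 0 (Wbinv : DiffOp 𝕜 m))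
    {B : DiffOp 𝕜 m} (hB : IsFlow W Winv Wb Wbinv δ B) :
    B.neg = -((opDer 1 δ W * Winv : Op 𝕜 m 1) : DiffOp 𝕜 m) ∧
      B.pos = (opDer (-1) δ Wb * Wbinv : Op 𝕜 m (-1)) := by
  have h1 : BddBy 1 (-1 + 0) ((opDer 1 δ W * Winv : Op 𝕜 m 1) : DiffOp 𝕜 m) := by
    refine BddBy.mul (fun i hi => ?_) hWinv
    rw [opDer_apply]
    obtain rfl | h0 : i = 0 ∨ 0 < i := by simp at hi; omega
    · rw [hW0, δ.map_one_eq_zero]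
    · rw [hWtop i (by simpa using h0), map_zero]
  have h2 : BddBy (-1) (0 + 0) ((opDer (-1) δ Wb * Wbinv : Op 𝕜 m (-1)) : DiffOp 𝕜 m) := by
    refine BddBy.mul (fun i hi => ?_) hWbinv
    rw [opDer_apply, hWb i hi, map_zero]
  have h3 : ∀ i, ((opDer 1 δ W * Winv : Op 𝕜 m 1) : DiffOp 𝕜 m) i + B i =
      ((opDer (-1) δ Wb * Wbinv : Op 𝕜 m (-1)) : DiffOp 𝕜 m) i := fun i => congrFun hB i
  constructor <;> ext1 i
  · rw [DiffOp.neg, Pi.neg_apply]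
    split_ifs with hi
    · have h4 := h3 i
      rw [h2 i (by simp; omega)] at h4
      rw [eq_neg_iff_add_eq_zero, add_comm, h4]
    · rw [h1 i (by simp; omega), neg_zero]
  · rw [DiffOp.pos]
    split_ifs with hi
    · rw [← h3, h1 i (by simp; omega), zero_add]
    · rw [h2 i (by simp; omega)]

end Dressing

/-! ### The flows in terms of the dressing operators -/

section Flows

variable {e : ℤˣ} {W Winv : Op 𝕜 m 1} {Wb Wbinv : Op 𝕜 m (-1)}

theorem timeDer_comm (v : Var m) (j : ℤ) (f : Fn 𝕜 (Var m)) :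
    dVarDer 𝕜 v (Fn.shiftS j f) = (dVarDer 𝕜 v f).shiftS j := (shiftS_dVar j v f).symm

theorem sDer_comm (j : ℤ) (f : Fn 𝕜 (Var m)) :
    dSDer 𝕜 (Var m) (Fn.shiftS j f) = (dSDer 𝕜 (Var m) f).shiftS j := (shiftS_dS j f).symm

/-- The operator `L ^ (n / k)`. -/
def upPow (W Winv : Op 𝕜 m 1) (n : ℕ) : Op 𝕜 m 1 := W * mono 1 1 n * Winv

/-- The operator `L ^ (n / m)`. -/
def downPow (Wb Wbinv : Op 𝕜 m (-1)) (n : ℕ) : Op 𝕜 m (-1) := Wb * mono (-1) 1 (-n) * Wbinv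

theorem coe_upPow (n : ℕ+) : (upPow W Winv n : DiffOp 𝕜 m) = powK (W : DiffOp 𝕜 m) Winv n := rfl

theorem coe_downPow (n : ℕ+) :
    (downPow Wb Wbinv n : DiffOp 𝕜 m) = powM (Wb : DiffOp 𝕜 m) Wbinv n := rfl

theorem IsDressing.agree_upPow (h : IsDressing k W Winv Wb Wbinv) (l : ℕ) :
    Agree (upPow W Winv (l * k)) (downPow Wb Wbinv (l * m)) := by
  have := h.agree_pow l
  rw [upPow, downPow]
  push_cast
  exact this

/-- The flow with respect to `x_l`, `l ≥ 0`, is generated by this operator. -/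
theorem twoPowLog_eq (h : IsDressing k W Winv Wb Wbinv) {L : DiffOp 𝕜 m}
    (hL : L = (upPow W Winv k : DiffOp 𝕜 m)) (l : ℕ) :
    twoPowLog L W Winv Wb Wbinv l =
      -((upPow W Winv (l * k) * (opDer 1 (dSDer 𝕜 (Var m)) W * Winv) : Op 𝕜 m 1) : DiffOp 𝕜 m) +
      (downPow Wb Wbinv (l * m) * (opDer (-1) (dSDer 𝕜 (Var m)) Wb * Wbinv) : Op 𝕜 m (-1)) := by
  have h1 : L.npow l = (upPow W Winv (l * k) : DiffOp 𝕜 m) := by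
    rw [hL, ← coe_npow, upPow, h.pow, upPow, Nat.cast_mul]
  have h2 : L.npow l = (downPow Wb Wbinv (l * m) : DiffOp 𝕜 m) := h1.trans (h.agree_upPow l)
  have hfin : ∀ e, Bdd e (L.npow l) := fun e => by
    obtain rfl | rfl := Int.units_eq_one_or e
    · rw [h1]; exact (upPow W Winv (l * k)).2
    · rw [h2]; exact (downPow Wb Wbinv (l * m)).2
  have hneg : -((1 / 2 : ℂ) • mul ((W : DiffOp 𝕜 m).onCoeffs Fn.dS) Winv) =
      (-(1 / 2) : ℂ) • mul ((W : DiffOp 𝕜 m).onCoeffs Fn.dS) Winv := (neg_smul _ _).symm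
  have hone : ∀ M : DiffOp 𝕜 m, (2 * -(1 / 2) : ℂ) • M = -M := fun M => by
    rw [show (2 * -(1 / 2) : ℂ) = -1 by norm_num]
    exact neg_one_smul ℂ M
  have hone' : ∀ M : DiffOp 𝕜 m, (2 * (1 / 2) : ℂ) • M = M := fun M => by norm_num
  rw [twoPowLog, logL, (finMul_of_finite hfin _).mul_add (finMul_of_finite hfin _), hneg,
    mul_smul', mul_smul', smul_add, smul_smul, smul_smul, hone, hone']
  nth_rw 1 [h1]
  rw [h2]
  rfl

theorem rightD_apply (v : Var m) (c : ℂ) (q : ℤ) (c' : ℂ) (q' : ℤ) (X : DiffOp 𝕜 m) (i : ℤ) :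
    rightD v c q c' q' X i = (X i).dVar v + c • X (i - q) + c' • (X (i - q')).dS := rfl

theorem leftD_apply (v : Var m) (c' : ℂ) (q' : ℤ) (Y : DiffOp 𝕜 m) (i : ℤ) :
    leftD v c' q' Y i = (Y i).dVar v + c' • ((Y (i - q')).dS).shiftS q' := rfl

theorem coe_timeD (a : Op 𝕜 m 1) (v : Time m) : timeD k v (a : DiffOp 𝕜 m) =
    (opDer 1 (dVarDer 𝕜 (Var.time v)) a + timeWeight Time.t k v •
      (a * mono 1 1 (timeIndex Time.t v)) : Op 𝕜 m 1) := by
  ext1 i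
  rw [timeD, rightD_apply, Submodule.coe_add, Submodule.coe_smul, Pi.add_apply, Pi.smul_apply,
    mul_mono_apply, shiftS_one, mul_one, zero_smul, add_zero, neg_one_mul, neg_neg]
  rfl

theorem coe_barTimeD (b : Op 𝕜 m (-1)) (v : Time m) : barTimeD k v (b : DiffOp 𝕜 m) =
    (opDer (-1) (dVarDer 𝕜 (Var.time v)) b - timeWeight (Time.tb k m) m v •
      (b * mono (-1) 1 (-timeIndex (Time.tb k m) v)) : Op 𝕜 m (-1)) := by
  ext1 i
  rw [barTimeD, rightD_apply, Submodule.coe_sub, Submodule.coe_smul, Pi.sub_apply, Pi.smul_apply,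
    mul_mono_apply, shiftS_one, mul_one, zero_smul, add_zero, one_mul, neg_smul, ← sub_eq_add_neg]
  rfl

theorem coe_logD (a : Op 𝕜 m e) (q : ℤ) (l : ℕ+) : logD q l (a : DiffOp 𝕜 m) =
    (opDer e (dVarDer 𝕜 (Var.x l)) a - opDer e (dSDer 𝕜 (Var m)) a * mono e 1 q : Op 𝕜 m e) := by
  ext1 i
  rw [logD, rightD_apply, Submodule.coe_sub, Pi.sub_apply, mul_mono_apply, shiftS_one, mul_one,
    zero_smul, add_zero, neg_one_smul, ← sub_eq_add_neg]
  rfl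

theorem coe_dualLogD (a : Op 𝕜 m e) (q : ℤ) (l : ℕ+) : dualLogD q l (a : DiffOp 𝕜 m) =
    (opDer e (dVarDer 𝕜 (Var.x l)) a - mono e 1 q * opDer e (dSDer 𝕜 (Var m)) a : Op 𝕜 m e) := by
  ext1 i
  rw [dualLogD, leftD_apply, Submodule.coe_sub, Pi.sub_apply, mono_mul_apply, one_mul,
    neg_one_smul, ← sub_eq_add_neg]
  rfl

/-- The first derivative of the bilinear equation with respect to a time variable, expressed by the
dressing operators. -/
def TimeRel (k : ℕ+) (W Winv : Op 𝕜 m 1) (Wb Wbinv : Op 𝕜 m (-1)) (v : Time m) : Prop :=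
  Agree (opDer 1 (dVarDer 𝕜 (Var.time v)) W * Winv +
      timeWeight Time.t k v • (W * mono 1 1 (timeIndex Time.t v) * Winv))
    (opDer (-1) (dVarDer 𝕜 (Var.time v)) Wb * Wbinv - timeWeight (Time.tb k m) m v •
      (Wb * mono (-1) 1 (-timeIndex (Time.tb k m) v) * Wbinv))

/-- The first derivative of the bilinear equation with respect to a variable `a_l`, expressed by the
dressing operators. -/
def LogRel (k : ℕ+) (W Winv : Op 𝕜 m 1) (Wb Wbinv : Op 𝕜 m (-1)) (l : ℕ+) : Prop :=
  Agree (opDer 1 (dVarDer 𝕜 (Var.x l)) W * Winv -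
      opDer 1 (dSDer 𝕜 (Var m)) W * mono 1 1 (k * l) * Winv)
    (opDer (-1) (dVarDer 𝕜 (Var.x l)) Wb * Wbinv -
      opDer (-1) (dSDer 𝕜 (Var m)) Wb * mono (-1) 1 (-(m * l)) * Wbinv)

theorem Time.t_ne_tb {i : ℕ+} (hi : ¬ k ∣ i) (j : ℕ+) : Time.tb k m j ≠ Time.t i := by
  unfold Time.tb
  split_ifs with h
  · intro h'
    exact hi ⟨_, (Time.t.inj h').symm⟩
  · simp

theorem Time.tb_mul (l : ℕ+) : Time.tb k m (m * l) = Time.t (k * l) := by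
  have h : m ∣ m * l := ⟨l, rfl⟩
  rw [Time.tb, dif_pos h]
  congr 2
  exact mul_left_cancel (PNat.mul_div_exact h)

theorem Time.t_ne_tb_of_not_dvd {j : ℕ+} (hj : ¬ m ∣ j) (i : ℕ+) :
    Time.t i ≠ Time.tb k m j := by
  unfold Time.tb
  rw [dif_neg hj]
  simp

/-- For each time variable, the relation that follows from the bilinear equation is the flow of the
hierarchy. If `v = t_{kl} = tbar_{ml}`, the two exponents contribute one half of `L ^ l` each. -/
theorem timeRel_iff_isFlow (h : IsDressing k W Winv Wb Wbinv) {v : Time m} {B : DiffOp 𝕜 m}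
    (ht : ∀ n, v = Time.t n → B = powK (W : DiffOp 𝕜 m) Winv n)
    (htb : ∀ n, v = Time.tb k m n → B = powM (Wb : DiffOp 𝕜 m) Wbinv n) :
    TimeRel k W Winv Wb Wbinv v ↔ IsFlow W Winv Wb Wbinv (dVarDer 𝕜 (Var.time v)) B := by
  rw [TimeRel, IsFlow, Agree]
  simp only [Submodule.coe_add, Submodule.coe_sub, Submodule.coe_smul]
  by_cases h1 : ∃ n, v = Time.t n
  · obtain ⟨n, rfl⟩ := h1
    rw [ht n rfl, timeWeight_apply Time.t_injective, timeIndex_apply Time.t_injective]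
    by_cases hn : k ∣ n
    · obtain ⟨l, rfl⟩ := hn
      have h2 : timeWeight (Time.tb k m) m (Time.t (k * l)) = 1 / 2 := by
        rw [← Time.tb_mul, timeWeight_apply Time.tb_injective, weight, if_pos ⟨l, rfl⟩]
      have h3 : timeIndex (Time.tb k m) (Time.t (k * l)) = l * m := by
        rw [← Time.tb_mul, timeIndex_apply Time.tb_injective]
        push_cast
        ring
      have h4 : powK (W : DiffOp 𝕜 m) Winv (k * l) =
          ((W * mono 1 1 (l * k) * Winv : Op 𝕜 m 1) : DiffOp 𝕜 m) := by
        rw [powK]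
        push_cast
        rw [mul_comm]
        rfl
      have h5 : ((k * l : ℕ+) : ℤ) = l * k := by push_cast; ring
      have h6 := h.agree_pow l
      rw [Agree] at h6
      rw [weight, if_pos ⟨l, rfl⟩, h2, h3, h4, h5]
      rw [← h6]
      generalize ((W * mono 1 1 (l * k) * Winv : Op 𝕜 m 1) : DiffOp 𝕜 m) = C
      rw [eq_sub_iff_add_eq, add_assoc, ← add_smul]
      norm_num
    · rw [weight, if_neg hn, timeWeight_eq_zero m (Time.t_ne_tb hn), one_smul, zero_smul, sub_zero]
      rfl
  · obtain ⟨n, rfl⟩ : ∃ n, v = Time.tb k m n := by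
      obtain i | ⟨j, hj⟩ := v
      · exact absurd ⟨i, rfl⟩ h1
      · exact ⟨j, by rw [Time.tb, dif_neg hj]⟩
    have hn : ¬ m ∣ n := by
      rintro ⟨l, rfl⟩
      exact h1 ⟨_, Time.tb_mul l⟩
    rw [htb n rfl, timeWeight_apply Time.tb_injective, timeIndex_apply Time.tb_injective,
      timeWeight_eq_zero k fun i => Time.t_ne_tb_of_not_dvd hn i, zero_smul, add_zero, weight,
      if_neg hn, one_smul, eq_sub_iff_add_eq]
    rfl

theorem opDer_s_mul (l : ℕ) (h : IsDressing k W Winv Wb Wbinv) :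
    opDer 1 (dSDer 𝕜 (Var m)) W * mono 1 1 (l * k) * Winv =
      upPow W Winv (l * k) * (opDer 1 (dSDer 𝕜 (Var m)) W * Winv) +
        opDer 1 (dSDer 𝕜 (Var m)) (upPow W Winv (l * k)) := by
  rw [upPow, Nat.cast_mul, opDer_conj sDer_comm h.inv_mul h.mul_inv
    (opDer_mono (Derivation.map_one_eq_zero _) _)]
  have h1 : opDer 1 (dSDer 𝕜 (Var m)) W * Winv * (W * mono 1 1 (l * k) * Winv) =
      opDer 1 (dSDer 𝕜 (Var m)) W * (Winv * W) * mono 1 1 (l * k) * Winv := by noncomm_ring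
  rw [h1, h.inv_mul]
  noncomm_ring

theorem opDer_s_bar_mul (l : ℕ) (h : IsDressing k W Winv Wb Wbinv) :
    opDer (-1) (dSDer 𝕜 (Var m)) Wb * mono (-1) 1 (-(l * m)) * Wbinv =
      downPow Wb Wbinv (l * m) * (opDer (-1) (dSDer 𝕜 (Var m)) Wb * Wbinv) +
        opDer (-1) (dSDer 𝕜 (Var m)) (downPow Wb Wbinv (l * m)) := by
  rw [downPow, Nat.cast_mul, opDer_conj sDer_comm h.bar_inv_mul h.bar_mul_inv
    (opDer_mono (Derivation.map_one_eq_zero _) _)]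
  have h1 : opDer (-1) (dSDer 𝕜 (Var m)) Wb * Wbinv * (Wb * mono (-1) 1 (-(l * m)) * Wbinv) =
      opDer (-1) (dSDer 𝕜 (Var m)) Wb * (Wbinv * Wb) * mono (-1) 1 (-(l * m)) * Wbinv := by
    noncomm_ring
  rw [h1, h.bar_inv_mul]
  noncomm_ring

/-- For each variable `x_l`, the relation that follows from the bilinear equation is the flow of the
hierarchy. -/
theorem logRel_iff_isFlow (h : IsDressing k W Winv Wb Wbinv) (l : ℕ+) :
    LogRel k W Winv Wb Wbinv l ↔ IsFlow W Winv Wb Wbinv (dVarDer 𝕜 (Var.x l))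
      (twoPowLog (upPow W Winv k) W Winv Wb Wbinv l) := by
  have h1 := opDer_s_mul l h
  have h2 := opDer_s_bar_mul l h
  have h3 := (h.agree_upPow l).opDer (dSDer 𝕜 (Var m))
  rw [Agree] at h3
  rw [LogRel, IsFlow, Agree, twoPowLog_eq h rfl, mul_comm (k : ℤ), mul_comm (m : ℤ)]
  rw [h1, h2]
  simp only [Submodule.coe_add, Submodule.coe_sub, h3]
  rw [← sub_sub, ← sub_sub, sub_left_inj, eq_sub_iff_add_eq, ← add_assoc, ← sub_eq_add_neg]

end Flows

/-! ### Recursions for the shifts of the time variables -/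

section DualSymbol

open Finset

theorem sum_antidiagonal_assoc {M : Type*} [AddCommMonoid M] (F : ℕ → ℕ → ℕ → M) (N : ℕ) :
    ∑ x ∈ antidiagonal N, ∑ y ∈ antidiagonal x.1, F y.1 y.2 x.2 =
      ∑ x ∈ antidiagonal N, ∑ y ∈ antidiagonal x.2, F x.1 y.1 y.2 := by
  rw [sum_sigma', sum_sigma']
  refine sum_nbij' (fun x => ⟨(x.2.1, x.2.2 + x.1.2), (x.2.2, x.1.2)⟩)
    (fun x => ⟨(x.1.1 + x.2.1, x.2.2), (x.1.1, x.2.1)⟩) ?_ ?_ ?_ ?_ ?_ <;>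
  · simp only [mem_sigma, HasAntidiagonal.mem_antidiagonal, and_imp, Sigma.forall, Prod.forall]
    intros
    subst_vars
    simp [add_assoc]

theorem sum_antidiagonal_comm {M : Type*} [AddCommMonoid M] (F : ℕ → ℕ → ℕ → M) (N : ℕ) :
    ∑ x ∈ antidiagonal N, ∑ y ∈ antidiagonal x.1, F y.1 y.2 x.2 =
      ∑ x ∈ antidiagonal N, ∑ y ∈ antidiagonal x.1, F y.1 x.2 y.2 := by
  rw [sum_antidiagonal_assoc, sum_antidiagonal_assoc fun a b c => F a c b]
  exact sum_congr rfl fun x _ => (Nat.sum_antidiagonal_swap (f := fun y => F x.1 y.1 y.2)).symm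

theorem succ_smul_sum_antidiagonal {M : Type*} [AddCommGroup M] [Module ℂ M] (F : ℕ → ℕ → M)
    (N : ℕ) : (N + 1 : ℂ) • ∑ x ∈ antidiagonal (N + 1), F x.1 x.2 =
      ∑ x ∈ antidiagonal N, (x.1 + 1 : ℂ) • F (x.1 + 1) x.2 +
        ∑ x ∈ antidiagonal N, (x.2 + 1 : ℂ) • F x.1 (x.2 + 1) := by
  have h : (N + 1 : ℂ) • ∑ x ∈ antidiagonal (N + 1), F x.1 x.2 =
      ∑ x ∈ antidiagonal (N + 1), (x.1 : ℂ) • F x.1 x.2 +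
        ∑ x ∈ antidiagonal (N + 1), (x.2 : ℂ) • F x.1 x.2 := by
    rw [← sum_add_distrib, smul_sum]
    refine sum_congr rfl fun x hx => ?_
    rw [← add_smul, ← Nat.cast_add, HasAntidiagonal.mem_antidiagonal.1 hx, Nat.cast_succ]
  rw [h, Nat.sum_antidiagonal_succ, Nat.sum_antidiagonal_succ' (f := fun x => (x.2 : ℂ) • F x.1 x.2)]
  simp

variable {p : ℕ+ → Time m}

theorem shiftCoeff_succ_antidiagonal (hp : p.Injective) (ε : ℂ) (N : ℕ) (f : Fn 𝕜 (Var m)) :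
    (N + 1 : ℂ) • shiftCoeff p ε (N + 1) f = ε • ∑ x ∈ antidiagonal N,
      (shiftCoeff p ε x.1 f).dVar (Var.time (p x.2.succPNat)) := by
  rw [shiftCoeff_succ hp, ← Nat.sum_antidiagonal_swap,
    Nat.sum_antidiagonal_eq_sum_range_succ_mk]
  simp only [shiftCoeff_dVar hp, Prod.fst_swap, Prod.snd_swap]

/-- The shifts by `ε [ζ]` and `-ε [ζ]` are inverse to each other. -/
theorem sum_shiftCoeff_neg (hp : p.Injective) (ε : ℂ) (N : ℕ) (f : Fn 𝕜 (Var m)) :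
    ∑ x ∈ antidiagonal N, shiftCoeff p ε x.1 (shiftCoeff p (-ε) x.2 f) = if N = 0 then f else 0 := by
  obtain _ | N := N
  · simp [shiftCoeff_zero_index hp]
  rw [if_neg N.succ_ne_zero]
  have hN : (N + 1 : ℂ) ≠ 0 := by exact_mod_cast N.succ_ne_zero
  refine (smul_eq_zero.1 ?_).resolve_left hN
  rw [succ_smul_sum_antidiagonal fun q i => shiftCoeff p ε q (shiftCoeff p (-ε) i f)]
  have h1 : ∀ x : ℕ × ℕ, (x.1 + 1 : ℂ) • shiftCoeff p ε (x.1 + 1) (shiftCoeff p (-ε) x.2 f) =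
      ∑ y ∈ antidiagonal x.1, ε • (shiftCoeff p ε y.1 (shiftCoeff p (-ε) x.2 f)).dVar
        (Var.time (p y.2.succPNat)) := fun x => by
    rw [shiftCoeff_succ_antidiagonal hp, smul_sum]
  have h2 : ∀ x : ℕ × ℕ, (x.2 + 1 : ℂ) • shiftCoeff p ε x.1 (shiftCoeff p (-ε) (x.2 + 1) f) =
      ∑ y ∈ antidiagonal x.2, -(ε • (shiftCoeff p ε x.1 (shiftCoeff p (-ε) y.1 f)).dVar
        (Var.time (p y.2.succPNat))) := fun x => by
    rw [← shiftCoeff_smul hp, shiftCoeff_succ_antidiagonal hp, smul_sum,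
      ← shiftCoeffLin_apply hp, map_sum]
    refine sum_congr rfl fun y _ => ?_
    rw [shiftCoeffLin_apply, neg_smul, ← neg_one_smul ℂ (ε • _), shiftCoeff_smul hp,
      neg_one_smul, shiftCoeff_smul hp, shiftCoeff_dVar hp]
  simp only [h1, h2]
  rw [sum_antidiagonal_comm (fun a b c => ε • (shiftCoeff p ε a (shiftCoeff p (-ε) c f)).dVar
        (Var.time (p b.succPNat))), sum_antidiagonal_assoc
    (fun a b c => ε • (shiftCoeff p ε a (shiftCoeff p (-ε) b f)).dVar (Var.time (p c.succPNat))),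
    ← sum_add_distrib]
  exact sum_eq_zero fun x _ => by rw [← sum_add_distrib]; simp

variable {e : ℤˣ}

variable (e) in
/-- A linear map applied to the coefficients of a difference operator. -/
def opMap (φ : Fn 𝕜 (Var m) →ₗ[ℂ] Fn 𝕜 (Var m)) : Op 𝕜 m e →ₗ[ℂ] Op 𝕜 m e where
  toFun a := ⟨fun i => φ ((a : DiffOp 𝕜 m) i), by
    obtain ⟨N, hN⟩ := a.2
    exact ⟨N, fun i hi => (congrArg φ (hN i hi)).trans (map_zero φ)⟩⟩
  map_add' a b := Op.ext fun i => map_add φ _ _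
  map_smul' c a := Op.ext fun i => φ.map_smul c _

theorem opMap_apply (φ : Fn 𝕜 (Var m) →ₗ[ℂ] Fn 𝕜 (Var m)) (a : Op 𝕜 m e) (i : ℤ) :
    (opMap e φ a : DiffOp 𝕜 m) i = φ ((a : DiffOp 𝕜 m) i) := rfl

theorem Op.coe_sum {ι : Type*} (s : Finset ι) (a : ι → Op 𝕜 m e) (i : ℤ) :
    ((∑ j ∈ s, a j : Op 𝕜 m e) : DiffOp 𝕜 m) i = ∑ j ∈ s, (a j : DiffOp 𝕜 m) i := by
  rw [Submodule.coe_sum, Finset.sum_apply]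

theorem opMap_shiftCoeff_succ (hp : p.Injective) (ε : ℂ) (N : ℕ) (a : Op 𝕜 m e) :
    (N + 1 : ℂ) • opMap e (shiftCoeffLin hp ε (N + 1)) a = ε • ∑ x ∈ antidiagonal N,
      opDer e (dVarDer 𝕜 (Var.time (p x.2.succPNat))) (opMap e (shiftCoeffLin hp ε x.1) a) := by
  refine Op.ext fun i => ?_
  rw [Submodule.coe_smul, Submodule.coe_smul, Pi.smul_apply, Pi.smul_apply, Op.coe_sum]
  exact shiftCoeff_succ_antidiagonal hp ε N _

/-- The recursion for the coefficients `X_N` of the product of the series `∑ s_N ζ ^ N` and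
`(1 - u ζ)⁻¹`, if `s_N` is given by a similar recursion. -/
theorem succ_smul_sum_mul_pow {R : Type*} [Ring R] [Algebra ℂ R] {s : ℕ → R} {d : ℕ → R →ₗ[ℂ] R}
    {u : R} {ε : ℂ} (hε : ε * ε = 1) (hd : ∀ j a c, d j (a * u ^ c) = d j a * u ^ c)
    (hs : ∀ N : ℕ, (N + 1 : ℂ) • s (N + 1) = ε • ∑ x ∈ antidiagonal N, d x.2 (s x.1)) (N : ℕ) :
    (N + 1 : ℂ) • ∑ x ∈ antidiagonal (N + 1), s x.1 * u ^ x.2 =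
      ε • ∑ x ∈ antidiagonal N, (d x.2 (∑ y ∈ antidiagonal x.1, s y.1 * u ^ y.2) +
        ε • ((∑ y ∈ antidiagonal x.1, s y.1 * u ^ y.2) * u ^ (x.2 + 1))) := by
  rw [succ_smul_sum_antidiagonal fun b c => s b * u ^ c, sum_add_distrib, smul_add, ← smul_sum,
    smul_smul, hε, one_smul]
  congr 1
  · have h1 : ∀ x : ℕ × ℕ, (x.1 + 1 : ℂ) • (s (x.1 + 1) * u ^ x.2) =
        ∑ y ∈ antidiagonal x.1, ε • (d y.2 (s y.1) * u ^ x.2) := fun x => by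
      rw [← smul_mul_assoc, hs, smul_mul_assoc, sum_mul, smul_sum]
    have h2 : ∀ x : ℕ × ℕ, d x.2 (∑ y ∈ antidiagonal x.1, s y.1 * u ^ y.2) =
        ∑ y ∈ antidiagonal x.1, d x.2 (s y.1) * u ^ y.2 := fun x => by
      rw [map_sum]
      exact sum_congr rfl fun y _ => hd _ _ _
    simp only [h1, h2, smul_sum]
    exact sum_antidiagonal_comm (fun a b c => ε • (d b (s a) * u ^ c)) N
  · have h1 : ∀ x : ℕ × ℕ, (x.2 + 1 : ℂ) • (s x.1 * u ^ (x.2 + 1)) =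
        ∑ y ∈ antidiagonal x.2, s x.1 * u ^ (y.1 + y.2 + 1) := fun x => by
      rw [sum_congr rfl fun y hy => by rw [HasAntidiagonal.mem_antidiagonal.1 hy], sum_const, Nat.card_antidiagonal,
        ← Nat.cast_smul_eq_nsmul ℂ, Nat.cast_succ]
    simp only [h1, sum_mul, mul_assoc, ← pow_add, ← add_assoc]
    exact (sum_antidiagonal_assoc (fun a b c => s a * u ^ (b + c + 1)) N).symm

end DualSymbol

/-! ### Inverses of dressing operators -/

section Inverse

open Finset

variable {e e' : ℤˣ} {V U : Op 𝕜 m e} {V' U' : Op 𝕜 m e'}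
  {δ η : Derivation ℂ (Fn 𝕜 (Var m)) (Fn 𝕜 (Var m))}

/-! #### Derivatives in terms of dressing operators

For `A = X V⁻¹` the derivatives of `X` that occur in the bilinear equation are expressed by `A` and
by the same derivatives of `V`; similarly for `A = V Y`. -/

theorem opDer_add_mul_inv (hδ : ∀ j f, δ (Fn.shiftS j f) = (δ f).shiftS j) (h : U * V = 1)
    (h' : V * U = 1) (x y : Op 𝕜 m e) :
    (opDer e δ x + x * y) * U =
      opDer e δ (x * U) + x * U * (opDer e δ V * U + V * y * U) := by
  have h1 : x * U * (opDer e δ V * U) = -(x * opDer e δ U) := by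
    rw [← neg_neg (opDer e δ V * U), ← mul_opDer_inv hδ h', mul_neg, ← mul_assoc, mul_assoc x, h,
      mul_one]
  have h2 : x * U * (V * y * U) = x * (U * V) * y * U := by noncomm_ring
  rw [opDer_mul hδ, mul_add, h1, h2, h]
  noncomm_ring

theorem opDer_sub_mul_inv (hδ : ∀ j f, δ (Fn.shiftS j f) = (δ f).shiftS j)
    (hη : ∀ j f, η (Fn.shiftS j f) = (η f).shiftS j) (h : U * V = 1)
    (h' : V * U = 1) (x q : Op 𝕜 m e) :
    (opDer e δ x - opDer e η x * q) * U =
      opDer e δ (x * U) - opDer e η (x * U) * (V * q * U) +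
        x * U * (opDer e δ V * U - opDer e η V * q * U) := by
  have h1 : x * U * (opDer e δ V * U) = -(x * opDer e δ U) := by
    rw [← neg_neg (opDer e δ V * U), ← mul_opDer_inv hδ h', mul_neg, ← mul_assoc, mul_assoc x, h,
      mul_one]
  have h2 : opDer e η U * V = -(U * opDer e η V) := by
    rw [mul_opDer_inv hη h, neg_neg]
  have h3 : (opDer e η x * U + x * opDer e η U) * (V * q * U) =
      opDer e η x * (U * V) * q * U + x * (opDer e η U * V) * q * U := by noncomm_ring
  rw [opDer_mul hδ, opDer_mul hη, mul_sub, h1, h3, h, h2]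
  noncomm_ring

theorem mul_opDer_sub (hδ : ∀ j f, δ (Fn.shiftS j f) = (δ f).shiftS j)
    (hη : ∀ j f, η (Fn.shiftS j f) = (η f).shiftS j) (h : U * V = 1)
    (y : Op 𝕜 m e) {q : Op 𝕜 m e} (hq : opDer e η q = 0) :
    V * (opDer e δ y - q * opDer e η y) =
      opDer e δ (V * y) - V * q * U * opDer e η (V * y) -
        (opDer e δ V * U - opDer e η V * q * U + opDer e η (V * q * U)) * (V * y) := by
  have h1 : opDer e η U * V = -(U * opDer e η V) := by
    rw [mul_opDer_inv hη h, neg_neg]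
  have h2 : opDer e η (V * q * U) * (V * y) =
      opDer e η V * q * (U * V) * y + V * q * (opDer e η U * V) * y := by
    rw [opDer_mul hη, opDer_mul hη, hq]
    noncomm_ring
  have h3 : (opDer e δ V * U - opDer e η V * q * U) * (V * y) =
      opDer e δ V * (U * V) * y - opDer e η V * q * (U * V) * y := by noncomm_ring
  have h4 : V * q * U * opDer e η (V * y) =
      V * q * U * opDer e η V * y + V * q * (U * V) * opDer e η y := by
    rw [opDer_mul hη]
    noncomm_ring
  rw [add_mul, h2, h3, h4, h, h1, opDer_mul hδ]
  noncomm_ring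

/-! #### The symbol of the inverse -/

/-- The coefficients of a product, counted from the leading one. -/
theorem BddBy.mul_apply_sub {A B : DiffOp 𝕜 m} {a b : ℤ} (hA : BddBy e a A) (hB : BddBy e b B)
    (n : ℕ) : DiffOp.mul A B (e * (a + b - n)) = ∑ x ∈ antidiagonal n,
      A (e * (a - x.1)) * (B (e * (b - x.2))).shiftS (e * (a - x.1)) := by
  have hinj : Function.Injective fun M : ℕ => (e : ℤ) * (a - M) := fun M M' h => by
    have := unit_mul_injective e h
    simpa using this
  rw [Nat.sum_antidiagonal_eq_sum_range_succ_mk]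
  refine (finsum_eq_sum_of_support_subset (s := (range (n + 1)).map ⟨_, hinj⟩) _ ?_).trans ?_
  · intro i hi
    have h1 : (e : ℤ) * i ≤ a := by
      by_contra h
      exact hi (by dsimp only; rw [hA i (not_le.1 h), zero_mul])
    have h2 : (e : ℤ) * (e * (a + b - n) - i) ≤ b := by
      by_contra h
      exact hi (by dsimp only; rw [hB _ (not_le.1 h), shiftS_zero, mul_zero])
    rw [mul_sub, unit_mul_unit_mul] at h2
    rw [coe_map, Set.mem_image]
    refine ⟨(a - e * i).toNat, ?_, ?_⟩
    · rw [coe_range, Set.mem_Iio]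
      omega
    · rw [Function.Embedding.coeFn_mk, Int.toNat_of_nonneg (by omega), sub_sub_cancel,
        unit_mul_unit_mul]
  · rw [sum_map]
    refine sum_congr rfl fun M hM => ?_
    have : M ≤ n := Nat.lt_succ_iff.1 (mem_range.1 hM)
    have h1 : (e : ℤ) * (a + b - n) - e * (a - M) = e * (b - (n - M : ℕ)) := by
      push_cast [this]
      ring
    rw [Function.Embedding.coeFn_mk, h1]

theorem Lam_apply_of_ne {i : ℤ} (n : ℤ) (h : i ≠ n) : (Lam n : DiffOp 𝕜 m) i = 0 :=
  Pi.single_eq_of_ne (M := fun _ => Fn 𝕜 (Var m)) h 1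

theorem Lam_apply_self (n : ℤ) : (Lam n : DiffOp 𝕜 m) n = 1 :=
  Pi.single_eq_same (M := fun _ => Fn 𝕜 (Var m)) n 1

/-- The inverse of an operator whose leading power is `Λ ^ 0` has the same property. -/
theorem bddBy_inv (h : V * U = 1) (hV : BddBy e 0 (V : DiffOp 𝕜 m))
    (hV0 : IsUnit ((V : DiffOp 𝕜 m) 0)) : BddBy e 0 (U : DiffOp 𝕜 m) := by
  obtain ⟨N, hN⟩ := U.2
  have hN' : BddBy e (N.toNat : ℤ) (U : DiffOp 𝕜 m) := hN.mono (Int.self_le_toNat N)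
  generalize N.toNat = n at hN'
  induction n with
  | zero => exact hN'
  | succ n ih =>
    refine ih fun i hi => ?_
    by_cases hi' : ((n + 1 : ℕ) : ℤ) < e * i
    · exact hN' i hi'
    have hei : (e : ℤ) * i = (n + 1 : ℕ) := by push_cast at hi' ⊢; omega
    have h0 : i ≠ 0 := by
      rintro rfl
      rw [mul_zero] at hei
      norm_cast at hei
    have h1 : BddBy e (e * 0) (V : DiffOp 𝕜 m) := by rwa [mul_zero]
    have h2 := h1.mul_apply (j := i) (by rwa [hei])
    rw [← Op.coe_mul, h, Op.coe_one, zero_add, shiftS_zero_index, Lam_apply_of_ne 0 h0] at h2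
    exact (hV0.mul_right_eq_zero).1 h2.symm

theorem leading_mul_inv (h : V * U = 1) (hV : BddBy e 0 (V : DiffOp 𝕜 m))
    (hU : BddBy e 0 (U : DiffOp 𝕜 m)) : (V : DiffOp 𝕜 m) 0 * (U : DiffOp 𝕜 m) 0 = 1 := by
  have h1 : BddBy e (e * 0) (V : DiffOp 𝕜 m) := by rwa [mul_zero]
  have h2 := h1.mul_apply (j := 0) (B := U) (by rwa [mul_zero])
  rwa [← Op.coe_mul, h, Op.coe_one, zero_add, shiftS_zero_index, Lam_apply_self, eq_comm] at h2

variable {p : ℕ+ → Time m}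

/-- For `S f = ∑ S_N f ζ ^ N` and `U = ∑ S(w_i) ζ ^ i` the hypotheses say that `S(g) U = f`, as the
two shifts are inverse to each other, and `U v = S(w_0) v_0`. As `g w_0 = f`, it follows that
`f v = S(f) v_0`. -/
theorem mul_eq_of_generating (hp : p.Injective) (ε : ℂ) {f g : Fn 𝕜 (Var m)}
    {w v : ℕ → Fn 𝕜 (Var m)} (hw : ∀ i, g * w i = shiftCoeff p (-ε) i f)
    (hv : ∀ N, ∑ x ∈ antidiagonal N, (∑ y ∈ antidiagonal x.1, shiftCoeff p ε y.1 (w y.2)) * v x.2 =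
      shiftCoeff p ε N (w 0) * v 0) (l : ℕ) :
    f * v l = v 0 * shiftCoeff p ε l f := by
  have h1 : PowerSeries.mk (fun N => shiftCoeff p ε N g) * PowerSeries.mk (fun M =>
      ∑ y ∈ antidiagonal M, shiftCoeff p ε y.1 (w y.2)) = PowerSeries.C f := by
    ext N : 1
    rw [PowerSeries.coeff_mul, PowerSeries.coeff_C, ← sum_shiftCoeff_neg hp ε]
    simp only [PowerSeries.coeff_mk, mul_sum]
    rw [← sum_antidiagonal_assoc fun a b c => shiftCoeff p ε a g * shiftCoeff p ε b (w c)]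
    exact sum_congr rfl fun x _ => by rw [← hw, shiftCoeff_mul hp]
  have h2 : PowerSeries.mk (fun M => ∑ y ∈ antidiagonal M, shiftCoeff p ε y.1 (w y.2)) *
      PowerSeries.mk v = PowerSeries.mk (fun N => shiftCoeff p ε N (w 0)) * PowerSeries.C (v 0) := by
    ext N : 1
    rw [PowerSeries.coeff_mul, PowerSeries.coeff_mul_C]
    simp only [PowerSeries.coeff_mk]
    exact hv N
  have h3 : PowerSeries.mk (fun N => shiftCoeff p ε N g) *
      PowerSeries.mk (fun N => shiftCoeff p ε N (w 0)) =
      PowerSeries.mk fun N => shiftCoeff p ε N f := by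
    ext N : 1
    rw [PowerSeries.coeff_mul, PowerSeries.coeff_mk]
    simp only [PowerSeries.coeff_mk]
    rw [← shiftCoeff_mul hp, hw, shiftCoeff_zero_index hp]
  have h4 := congrArg (PowerSeries.coeff l) (congrArg (fun F => F * PowerSeries.mk v) h1)
  rw [mul_assoc, h2, ← mul_assoc, h3, PowerSeries.coeff_mul_C, PowerSeries.coeff_C_mul,
    PowerSeries.coeff_mk, PowerSeries.coeff_mk] at h4
  rw [← h4, mul_comm]

/-- The coefficient of `ζ ^ N` in `V(t + e [ζ]) (1 - ζ Λ ^ e)⁻¹`, multiplied by `V⁻¹`. By the flows,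
it is the same difference operator as the coefficient of `ζ ^ N` in `V'(t + e [ζ])`, multiplied by
`V'⁻¹`. -/
theorem coe_sum_mul_inv (hp : p.Injective)
    (h : U * V = 1) (hVU : V * U = 1) (h' : U' * V' = 1) (hVU' : V' * U' = 1)
    (hflow : ∀ n : ℕ+, ((opDer e (dVarDer 𝕜 (Var.time (p n))) V * U +
      ((e : ℤ) : ℂ) • (V * mono e 1 (n * e) * U) : Op 𝕜 m e) : DiffOp 𝕜 m) =
      (opDer e' (dVarDer 𝕜 (Var.time (p n))) V' * U' : Op 𝕜 m e')) (N : ℕ) :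
    (((∑ x ∈ antidiagonal N, opMap e (shiftCoeffLin hp (e : ℤ) x.1) V * (mono e 1 e : Op 𝕜 m e) ^ x.2) * U :
      Op 𝕜 m e) : DiffOp 𝕜 m) =
      (opMap e' (shiftCoeffLin hp (e : ℤ) N) V' * U' : Op 𝕜 m e') := by
  have hε : (((e : ℤ) : ℂ)) * ((e : ℤ) : ℂ) = 1 := by
    rw [← Int.cast_mul, Int.units_coe_mul_self, Int.cast_one]
  have hmap : ∀ {e : ℤˣ} (a : Op 𝕜 m e) (ε : ℂ), opMap e (shiftCoeffLin hp ε 0) a = a :=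
    fun a ε => Op.ext fun i => shiftCoeff_zero_index hp ε _
  have hd : ∀ (j : ℕ) (a : Op 𝕜 m e) (c : ℕ),
      opDer e (dVarDer 𝕜 (Var.time (p j.succPNat))) (a * (mono e 1 e : Op 𝕜 m e) ^ c) =
      opDer e (dVarDer 𝕜 (Var.time (p j.succPNat))) a * (mono e 1 e : Op 𝕜 m e) ^ c := fun j a c => by
    rw [mono_one_pow, opDer_mul (timeDer_comm _), opDer_mono (Derivation.map_one_eq_zero _),
      mul_zero, add_zero]
  induction N using Nat.strong_induction_on with
  | _ N ih =>
    obtain _ | N := N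
    · rw [hmap, hVU', Nat.antidiagonal_zero, sum_singleton, hmap, pow_zero, mul_one, hVU]
      rfl
    · have hN : (N + 1 : ℂ) ≠ 0 := by exact_mod_cast N.succ_ne_zero
      have hrec := succ_smul_sum_mul_pow (s := fun N => opMap e (shiftCoeffLin hp (e : ℤ) N) V)
        (d := fun j => opDer e (dVarDer 𝕜 (Var.time (p j.succPNat))))
        hε hd (opMap_shiftCoeff_succ hp _ · V) N
      refine smul_right_injective _ hN ?_
      dsimp only
      rw [← Submodule.coe_smul, ← Submodule.coe_smul, ← smul_mul_assoc, ← smul_mul_assoc,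
        opMap_shiftCoeff_succ, hrec,
        smul_mul_assoc, smul_mul_assoc, Submodule.coe_smul, Submodule.coe_smul, sum_mul, sum_mul,
        Submodule.coe_sum, Submodule.coe_sum]
      congr 1
      refine sum_congr rfl fun x hx => ?_
      have hx : x.1 < N + 1 := by
        have := HasAntidiagonal.mem_antidiagonal.1 hx
        omega
      have hx' := ih x.1 hx
      have h1 := opDer_add_mul_inv (timeDer_comm (Var.time (p x.2.succPNat))) h hVU
        (∑ y ∈ antidiagonal x.1, opMap e (shiftCoeffLin hp (e : ℤ) y.1) V * (mono e 1 e : Op 𝕜 m e) ^ y.2)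
        (((e : ℤ) : ℂ) • (mono e 1 e : Op 𝕜 m e) ^ (x.2 + 1))
      have h2 := opDer_add_mul_inv (timeDer_comm (Var.time (p x.2.succPNat))) h' hVU'
        (opMap e' (shiftCoeffLin hp (e : ℤ) x.1) V') 0
      have h3 := hflow x.2.succPNat
      rw [mul_zero, mul_zero, zero_mul, add_zero, add_zero] at h2
      rw [mul_smul_comm, mul_smul_comm, smul_mul_assoc, mono_one_pow] at h1
      rw [mono_one_pow, h1, h2]
      exact congrArg₂ (fun (A B : DiffOp 𝕜 m) => (fun i => dVarDer 𝕜 _ (A i)) + mul A B) hx' h3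

/-- The coefficients of the inverse of a dressing operator, if the symbol of the dressing operator
is given by a tau-function. -/
theorem inv_symbol (hp : p.Injective) (hee : (e' : ℤ) = -e)
    (h : U * V = 1) (hVU : V * U = 1) (h' : U' * V' = 1) (hVU' : V' * U' = 1)
    (hV : BddBy e 0 (V : DiffOp 𝕜 m)) (hU : BddBy e 0 (U : DiffOp 𝕜 m))
    (hV' : BddBy e' 0 (V' : DiffOp 𝕜 m)) (hU' : BddBy e' 0 (U' : DiffOp 𝕜 m))
    (hflow : ∀ n : ℕ+, ((opDer e (dVarDer 𝕜 (Var.time (p n))) V * U +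
      ((e : ℤ) : ℂ) • (V * mono e 1 (n * e) * U) : Op 𝕜 m e) : DiffOp 𝕜 m) =
      (opDer e' (dVarDer 𝕜 (Var.time (p n))) V' * U' : Op 𝕜 m e')) {f g : Fn 𝕜 (Var m)}
    (hsymb : ∀ i : ℕ, g * (V : DiffOp 𝕜 m) (e * -i) = shiftCoeff p (-(e : ℤ)) i f) (l : ℕ) :
    f * ((U : DiffOp 𝕜 m) (e * -l)).shiftS (e * (l - 1)) =
      ((U : DiffOp 𝕜 m) 0).shiftS (-e) * shiftCoeff p (e : ℤ) l f := by
  have key := mul_eq_of_generating hp ((e : ℤ) : ℂ) (f := f) (g := g)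
    (w := fun i => (V : DiffOp 𝕜 m) (e * -i))
    (v := fun l => ((U : DiffOp 𝕜 m) (e * -l)).shiftS (e * (l - 1))) hsymb ?_ l
  · simpa using key
  intro N
  obtain _ | N := N
  · simp [shiftCoeff_zero_index hp]
  set X : Op 𝕜 m e :=
    ∑ x ∈ antidiagonal N, opMap e (shiftCoeffLin hp (e : ℤ) x.1) V * (mono e 1 e : Op 𝕜 m e) ^ x.2 with hX
  have hXU := coe_sum_mul_inv hp h hVU h' hVU' hflow N
  rw [← hX] at hXU
  have hXapp : ∀ M : ℕ, (X : DiffOp 𝕜 m) (e * (N - M)) =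
      ∑ q ∈ range (N + 1), shiftCoeff p (e : ℤ) q ((V : DiffOp 𝕜 m) (e * (q - M))) := by
    intro M
    rw [hX, Op.coe_sum, Nat.sum_antidiagonal_eq_sum_range_succ_mk]
    refine sum_congr rfl fun q hq => ?_
    have : q ≤ N := Nat.lt_succ_iff.1 (mem_range.1 hq)
    rw [mono_one_pow, mul_mono_apply, shiftS_one, mul_one, opMap_apply, shiftCoeffLin_apply]
    refine congrArg (fun i => shiftCoeff p _ q ((V : DiffOp 𝕜 m) i)) ?_
    push_cast [this]
    ring
  have hzero : ∀ q M : ℕ, M < q →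
      shiftCoeff p (e : ℤ) q ((V : DiffOp 𝕜 m) (e * (q - M))) = 0 := by
    intro q M hq
    rw [hV _ (by rw [unit_mul_unit_mul]; omega), ← shiftCoeffLin_apply hp, map_zero]
  have hsum : ∀ M : ℕ, ∑ y ∈ antidiagonal M, shiftCoeff p (e : ℤ) y.1
      ((V : DiffOp 𝕜 m) (e * -(y.2 : ℤ))) =
      ∑ q ∈ range (M + 1), shiftCoeff p (e : ℤ) q ((V : DiffOp 𝕜 m) (e * (q - M))) := by
    intro M
    rw [Nat.sum_antidiagonal_eq_sum_range_succ_mk]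
    refine sum_congr rfl fun q hq => ?_
    have : q ≤ M := Nat.lt_succ_iff.1 (mem_range.1 hq)
    refine congrArg (fun i => shiftCoeff p _ q ((V : DiffOp 𝕜 m) i)) ?_
    push_cast [this]
    ring
  have hXB : BddBy e N (X : DiffOp 𝕜 m) := by
    intro i hi
    rw [hX, Op.coe_sum]
    refine sum_eq_zero fun x hx => ?_
    have := HasAntidiagonal.mem_antidiagonal.1 hx
    rw [mono_one_pow, mul_mono_apply, opMap_apply, hV, map_zero, zero_mul]
    rw [mul_sub, mul_left_comm, Int.units_coe_mul_self]
    omega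
  have hvan : mul (X : DiffOp 𝕜 m) U (e * (N + 0 - (N + 1 : ℕ))) = 0 := by
    rw [← Op.coe_mul, hXU]
    refine BddBy.mul (N := 0) (fun i hi => ?_) hU' _ ?_
    · rw [opMap_apply, hV' i hi, map_zero]
    · rw [hee, neg_mul, unit_mul_unit_mul]
      push_cast
      omega
  rw [hXB.mul_apply_sub hU, Nat.sum_antidiagonal_succ'] at hvan
  rw [Nat.sum_antidiagonal_succ']
  dsimp only at hvan ⊢
  have h1 : (X : DiffOp 𝕜 m) (e * (N - (N + 1 : ℕ))) = (∑ y ∈ antidiagonal (N + 1),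
      shiftCoeff p (e : ℤ) y.1 ((V : DiffOp 𝕜 m) (e * -(y.2 : ℤ)))) -
      shiftCoeff p (e : ℤ) (N + 1) ((V : DiffOp 𝕜 m) 0) := by
    rw [hXapp, hsum, sum_range_succ _ (N + 1), sub_self, mul_zero, add_sub_cancel_right]
  have h2 : ∀ x ∈ antidiagonal N, (X : DiffOp 𝕜 m) (e * (N - x.1)) = ∑ y ∈ antidiagonal x.1,
      shiftCoeff p (e : ℤ) y.1 ((V : DiffOp 𝕜 m) (e * -(y.2 : ℤ))) := by
    intro x hx
    have := HasAntidiagonal.mem_antidiagonal.1 hx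
    rw [hXapp, hsum]
    refine (sum_subset (range_subset_range.2 (by omega)) fun q _ hq => hzero q x.1 ?_).symm
    rw [mem_range] at hq
    omega
  have h3 : ∑ x ∈ antidiagonal N, (X : DiffOp 𝕜 m) (e * (N - x.1)) *
      ((U : DiffOp 𝕜 m) (e * (0 - (x.2 + 1 : ℕ)))).shiftS (e * (N - x.1)) =
      ∑ x ∈ antidiagonal N, (∑ y ∈ antidiagonal x.1,
        shiftCoeff p (e : ℤ) y.1 ((V : DiffOp 𝕜 m) (e * -(y.2 : ℤ)))) *
        ((U : DiffOp 𝕜 m) (e * -(x.2 + 1 : ℕ))).shiftS (e * ((x.2 + 1 : ℕ) - 1)) := by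
    refine sum_congr rfl fun x hx => ?_
    have := HasAntidiagonal.mem_antidiagonal.1 hx
    have h4 : ((N : ℤ) - x.1) = ((x.2 + 1 : ℕ) : ℤ) - 1 := by omega
    rw [h2 x hx, h4, zero_sub]
  have h4 : (N : ℤ) - (N + 1 : ℕ) = (0 : ℕ) - 1 := by omega
  rw [h3, h1, h4, zero_sub, sub_mul] at hvan
  rw [← sub_eq_zero]
  refine Eq.trans ?_ hvan
  rw [Nat.cast_zero, neg_zero, mul_zero]
  abel

end Inverse

/-! ### Tau-functions satisfy the bilinear equation -/

section Forward

variable {W Winv : Op 𝕜 m 1} {Wb Wbinv : Op 𝕜 m (-1)}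

theorem IsDressing.powK_eq_powM (h : IsDressing k W Winv Wb Wbinv) {n n' : ℕ+}
    (hn : Time.t n = Time.tb k m n') :
    powK (W : DiffOp 𝕜 m) Winv n = powM (Wb : DiffOp 𝕜 m) Wbinv n' := by
  by_cases hm : m ∣ n'
  · obtain ⟨l, rfl⟩ := hm
    rw [Time.tb_mul] at hn
    rw [Time.t.inj hn, ← coe_upPow, ← coe_downPow, mul_comm, mul_comm m]
    push_cast
    exact h.agree_upPow l
  · exact absurd hn (Time.t_ne_tb_of_not_dvd hm n)

theorem timeRel_t_iff (h : IsDressing k W Winv Wb Wbinv) (n : ℕ+) :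
    TimeRel k W Winv Wb Wbinv (Time.t n) ↔ IsFlow W Winv Wb Wbinv
      (dVarDer 𝕜 (Var.time (Time.t n))) (powK (W : DiffOp 𝕜 m) Winv n) :=
  timeRel_iff_isFlow h (fun _ hn => by rw [Time.t.inj hn]) fun _ hn => h.powK_eq_powM hn

theorem timeRel_tb_iff (h : IsDressing k W Winv Wb Wbinv) (n : ℕ+) :
    TimeRel k W Winv Wb Wbinv (Time.tb k m n) ↔ IsFlow W Winv Wb Wbinv
      (dVarDer 𝕜 (Var.time (Time.tb k m n))) (powM (Wb : DiffOp 𝕜 m) Wbinv n) :=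
  timeRel_iff_isFlow h (fun _ hn => (h.powK_eq_powM hn.symm).symm)
    fun _ hn => by rw [Time.tb_injective hn]

theorem Time.eq_t_or_eq_tb (k : ℕ+) (v : Time m) :
    (∃ n, v = Time.t n) ∨ ∃ n, v = Time.tb k m n := by
  obtain i | ⟨j, hj⟩ := v
  · exact Or.inl ⟨i, rfl⟩
  · exact Or.inr ⟨j, by rw [Time.tb, dif_neg hj]⟩

theorem mul_mul_eq_conj {R : Type*} [Ring R] {w w' : R} (h : w' * w = 1) (x u y : R) :
    x * u * y = x * w' * (w * u * w') * (w * y) := by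
  have h1 : x * w' * (w * u * w') * (w * y) = x * (w' * w) * u * (w' * w) * y := by noncomm_ring
  rw [h1, h, mul_one, mul_one]

theorem opDer_add_smul_mul_inv {e : ℤˣ} {V U : Op 𝕜 m e}
    {δ : Derivation ℂ (Fn 𝕜 (Var m)) (Fn 𝕜 (Var m))}
    (hδ : ∀ j f, δ (Fn.shiftS j f) = (δ f).shiftS j) (h : U * V = 1)
    (h' : V * U = 1) (c : ℂ) (x y : Op 𝕜 m e) :
    (opDer e δ x + c • (x * y)) * U =
      opDer e δ (x * U) + x * U * (opDer e δ V * U + c • (V * y * U)) := by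
  have h1 := opDer_add_mul_inv hδ h h' x (c • y)
  rwa [mul_smul_comm, mul_smul_comm, smul_mul_assoc] at h1

theorem opDer_sub_smul_mul_inv {e : ℤˣ} {V U : Op 𝕜 m e}
    {δ : Derivation ℂ (Fn 𝕜 (Var m)) (Fn 𝕜 (Var m))}
    (hδ : ∀ j f, δ (Fn.shiftS j f) = (δ f).shiftS j) (h : U * V = 1)
    (h' : V * U = 1) (c : ℂ) (x y : Op 𝕜 m e) :
    (opDer e δ x - c • (x * y)) * U =
      opDer e δ (x * U) + x * U * (opDer e δ V * U - c • (V * y * U)) := by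
  rw [sub_eq_add_neg, sub_eq_add_neg, ← neg_smul, ← neg_smul, opDer_add_smul_mul_inv hδ h h']

/-- The bilinear equation for a function whose symbols are given by dressing operators that satisfy
the flow equations. -/
theorem IsDressing.satisfiesBilinear (h : IsDressing k W Winv Wb Wbinv)
    (htime : ∀ v, TimeRel k W Winv Wb Wbinv v) (hlog : ∀ l, LogRel k W Winv Wb Wbinv l)
    {τ : Fn 𝕜 (Var m)} (h₁ : upOp τ = (mono 1 τ 0 * W : Op 𝕜 m 1))
    (h₁' : downOp k τ = (mono (-1) τ 0 * Wb : Op 𝕜 m (-1)))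
    (h₂ : dualUpOp τ = (Winv * mono 1 (τ.shiftS 1) 1 : Op 𝕜 m 1))
    (h₂' : dualDownOp k τ = (Wbinv * mono (-1) (τ.shiftS 1) 1 : Op 𝕜 m (-1))) :
    SatisfiesBilinear k τ := by
  have hpow : ∀ l : ℕ+, Agree (W * mono 1 1 (k * l) * Winv) (Wb * mono (-1) 1 (-(m * l)) * Wbinv) :=
    fun l => by rw [mul_comm, mul_comm (m : ℤ)]; exact h.agree_pow l
  refine satisfiesBilinear_of_pairs
    (fun X Xb => ∃ (x : Op 𝕜 m 1) (xb : Op 𝕜 m (-1)), X = x ∧ Xb = xb ∧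
      Agree (x * Winv) (xb * Wbinv))
    (fun Y Yb => ∃ (y : Op 𝕜 m 1) (yb : Op 𝕜 m (-1)), Y = y ∧ Yb = yb ∧
      Agree (W * y) (Wb * yb)) ?_ ?_ ?_ ?_ ⟨_, _, h₁, h₁', ?_⟩ ⟨_, _, h₂, h₂', ?_⟩
  · rintro _ _ ⟨x, xb, rfl, rfl, hA⟩ v
    refine ⟨_, _, coe_timeD x v, coe_barTimeD xb v, ?_⟩
    rw [opDer_add_smul_mul_inv (timeDer_comm (Var.time v)) h.inv_mul h.mul_inv,
      opDer_sub_smul_mul_inv (timeDer_comm (Var.time v)) h.bar_inv_mul h.bar_mul_inv]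
    exact (hA.opDer _).add (hA.mul (htime v))
  · rintro _ _ ⟨x, xb, rfl, rfl, hA⟩ l
    refine ⟨_, _, coe_logD x _ l, coe_logD xb _ l, ?_⟩
    rw [opDer_sub_mul_inv (timeDer_comm (Var.x l)) sDer_comm h.inv_mul h.mul_inv,
      opDer_sub_mul_inv (timeDer_comm (Var.x l)) sDer_comm h.bar_inv_mul h.bar_mul_inv]
    exact ((hA.opDer _).sub ((hA.opDer _).mul (hpow l))).add (hA.mul (hlog l))
  · rintro _ _ ⟨y, yb, rfl, rfl, hA⟩ l
    refine ⟨_, _, coe_dualLogD y _ l, coe_dualLogD yb _ l, ?_⟩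
    rw [mul_opDer_sub (timeDer_comm (Var.x l)) sDer_comm h.inv_mul _
        (opDer_mono (Derivation.map_one_eq_zero _) _),
      mul_opDer_sub (timeDer_comm (Var.x l)) sDer_comm h.bar_inv_mul _
        (opDer_mono (Derivation.map_one_eq_zero _) _)]
    exact ((hA.opDer _).sub ((hpow l).mul (hA.opDer _))).sub
      (((hlog l).add ((hpow l).opDer _)).mul hA)
  · rintro _ _ _ _ ⟨x, xb, rfl, rfl, hA⟩ ⟨y, yb, rfl, rfl, hA'⟩ n
    have h3 := (hA.mul (h.agree_pow n)).mul hA'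
    rw [← mul_mul_eq_conj h.inv_mul, ← mul_mul_eq_conj h.bar_inv_mul] at h3
    exact h3
  · rw [mul_assoc, mul_assoc, h.mul_inv, h.bar_mul_inv, mul_one, mul_one]
    exact agree_mono _ _
  · rw [← mul_assoc, ← mul_assoc, h.mul_inv, h.bar_mul_inv, one_mul, one_mul]
    exact agree_mono _ _

theorem Fn.dX_coe (l : ℕ+) : Fn.dX (𝕜 := 𝕜) (m := m) l = Fn.dVar (Var.x l) := by
  ext1 f
  rw [Fn.dX, dif_pos l.pos]
  rfl

theorem mono_zero_mul_apply {e : ℤˣ} (f : Fn 𝕜 (Var m)) (a : Op 𝕜 m e) (i : ℤ) :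
    ((mono e f 0 * a : Op 𝕜 m e) : DiffOp 𝕜 m) i = f * (a : DiffOp 𝕜 m) i := by
  rw [mono_mul_apply, sub_zero, shiftS_zero_index]

theorem eq_neg_natCast_or_pos (i : ℤ) : (∃ l : ℕ, i = -l) ∨ 0 < i := by
  obtain h | h := lt_or_ge 0 i
  · exact Or.inr h
  · exact Or.inl ⟨(-i).toNat, by omega⟩

theorem eq_natCast_or_neg (i : ℤ) : (∃ l : ℕ, i = l) ∨ i < 0 := by
  obtain h | h := lt_or_ge i 0
  · exact Or.inr h
  · exact Or.inl ⟨i.toNat, by omega⟩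

theorem IsTauFunction.satisfiesBilinear {τ : Fn 𝕜 (Var m)} (hu : IsUnit τ)
    (hτ : IsTauFunction k τ) : SatisfiesBilinear k τ := by
  obtain ⟨L, W, Winv, Wb, Wbinv, S, hW, hWb⟩ := hτ
  have hWB : BddBy 1 0 W := fun i hi => S.wave.top i (by simpa using hi)
  have hWbB : BddBy (-1) 0 Wb := fun i hi => S.barWave.bot i (by simpa using hi)
  obtain ⟨w, rfl⟩ : ∃ w : Op 𝕜 m 1, (w : DiffOp 𝕜 m) = W := ⟨⟨W, 0, hWB⟩, rfl⟩
  obtain ⟨winv, rfl⟩ : ∃ w : Op 𝕜 m 1, (w : DiffOp 𝕜 m) = Winv :=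
    ⟨⟨Winv, bdd_one_iff.2 S.wave.inv_bdd⟩, rfl⟩
  obtain ⟨wb, rfl⟩ : ∃ w : Op 𝕜 m (-1), (w : DiffOp 𝕜 m) = Wb := ⟨⟨Wb, 0, hWbB⟩, rfl⟩
  obtain ⟨wbinv, rfl⟩ : ∃ w : Op 𝕜 m (-1), (w : DiffOp 𝕜 m) = Wbinv :=
    ⟨⟨Wbinv, bdd_neg_one_iff.2 S.barWave.inv_bdd⟩, rfl⟩
  have h : IsDressing k w winv wb wbinv :=
    ⟨Subtype.ext S.wave.mul_inv, Subtype.ext S.wave.inv_mul, Subtype.ext S.barWave.mul_inv,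
      Subtype.ext S.barWave.inv_mul, S.dress.symm.trans S.barDress⟩
  have hflow_t : ∀ n, IsFlow w winv wb wbinv (dVarDer 𝕜 (Var.time (Time.t n)))
      (powK (w : DiffOp 𝕜 m) winv n) := fun n =>
    isFlow_of_flows h (S.wave_t n) (S.barWave_t n)
  have hflow_tb : ∀ n, IsFlow w winv wb wbinv (dVarDer 𝕜 (Var.time (Time.tb k m n)))
      (powM (wb : DiffOp 𝕜 m) wbinv n) := fun n =>
    isFlow_of_flows h (S.wave_tbar n) (S.barWave_tbar n)
  have hw0 : IsUnit ((w : DiffOp 𝕜 m) 0) := by rw [S.wave.leading]; exact isUnit_one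
  have hwinvB := bddBy_inv h.mul_inv hWB hw0
  have hwbinvB := bddBy_inv h.bar_mul_inv hWbB S.barWave.leading
  have hup : ∀ l : ℕ, τ * ((winv : DiffOp 𝕜 m) (-l)).shiftS (l - 1) = shiftCoeff Time.t 1 l τ := by
    intro l
    have := inv_symbol (f := τ) (g := τ) Time.t_injective (e := 1) (e' := -1) rfl h.inv_mul
      h.mul_inv h.bar_inv_mul h.bar_mul_inv hWB hwinvB hWbB hwbinvB (fun n => ?_) (fun i => ?_) l
    · have h0 := leading_mul_inv h.mul_inv hWB hwinvB
      rw [S.wave.leading, one_mul] at h0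
      simpa [h0] using this
    · simp only [Units.val_one, Int.cast_one, one_smul, mul_one]
      exact hflow_t n
    · simp only [Units.val_one, Int.cast_one, one_mul]
      exact hW i
  have hdown : ∀ l : ℕ, τ.shiftS 2 * ((wbinv : DiffOp 𝕜 m) l).shiftS (1 - l) =
      (shiftCoeff (Time.tb k m) (-1) l τ).shiftS 1 := by
    intro l
    have := inv_symbol (f := τ.shiftS 1) (g := τ) (Time.tb_injective (k := k)) (e := -1) (e' := 1)
      rfl h.bar_inv_mul h.bar_mul_inv h.inv_mul h.mul_inv hWbB hwbinvB hWB hwinvB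
      (fun n => ?_) (fun i => ?_) l
    · have h0 := leading_mul_inv h.bar_mul_inv hWbB hwbinvB
      have h1 := hWb 0
      change _ = shiftCoeff _ _ _ _ at h1
      rw [shiftCoeff_zero_index Time.tb_injective, Nat.cast_zero] at h1
      have h2 : τ.shiftS 1 * (wbinv : DiffOp 𝕜 m) 0 = τ := by
        rw [← h1, mul_assoc, h0, mul_one]
      have h3 : τ.shiftS 2 * ((wbinv : DiffOp 𝕜 m) 0).shiftS 1 = τ.shiftS 1 := by
        rw [← congrArg (Fn.shiftS 1) h2, shiftS_mul, shiftS_shiftS]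
        rfl
      have h4 : IsUnit (τ.shiftS 1) := hu.map (MvPowerSeries.map (sShift 1))
      simp only [Units.val_neg, Units.val_one, neg_mul, one_mul, neg_neg, neg_sub, Int.cast_neg,
        Int.cast_one, mul_neg, shiftCoeff_shiftS Time.tb_injective] at this
      refine h4.mul_left_cancel ?_
      rw [mul_left_comm, this, ← mul_assoc, h3]
    · have := hflow_tb n
      rw [IsFlow, ← eq_sub_iff_add_eq] at this
      simp only [Units.val_neg, Units.val_one, Int.cast_neg, Int.cast_one, mul_neg, mul_one,
        neg_smul, one_smul, ← sub_eq_add_neg]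
      exact this.symm
    · simp only [Units.val_neg, Units.val_one, Int.cast_neg, Int.cast_one, neg_mul, one_mul,
        neg_neg]
      exact hWb i
  refine h.satisfiesBilinear (fun v => ?_) (fun l => ?_) ?_ ?_ ?_ ?_
  · obtain ⟨n, rfl⟩ | ⟨n, rfl⟩ := Time.eq_t_or_eq_tb k v
    · exact (timeRel_t_iff h n).2 (hflow_t n)
    · exact (timeRel_tb_iff h n).2 (hflow_tb n)
  · have h1 := S.wave_x l
    have h2 := S.barWave_x l
    rw [DiffOp.dX, Fn.dX_coe, S.dress] at h1 h2
    exact (logRel_iff_isFlow h l).2 (isFlow_of_flows h h1 h2)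
  · ext1 i
    rw [mono_zero_mul_apply, upOp, rightOp]
    obtain ⟨l, rfl⟩ | hi := eq_neg_natCast_or_pos i
    · simp only [neg_mul, one_mul, neg_neg, sub_zero, shiftCoeffInt_natCast]
      exact (hW l).symm
    · rw [shiftCoeffInt_of_neg (by dsimp only; omega), S.wave.top i hi, mul_zero]
  · ext1 i
    rw [mono_zero_mul_apply, downOp, rightOp]
    obtain ⟨l, rfl⟩ | hi := eq_natCast_or_neg i
    · simp only [one_mul, sub_zero, shiftCoeffInt_natCast]
      exact (hWb l).symm
    · rw [shiftCoeffInt_of_neg (by dsimp only; omega), S.barWave.bot i hi, mul_zero]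
  · ext1 i
    rw [mul_mono_apply, dualUpOp, leftOp, shiftS_shiftS, sub_add_cancel]
    obtain ⟨i, rfl⟩ : ∃ i', i = i' + 1 := ⟨i - 1, by ring⟩
    rw [add_sub_cancel_right]
    obtain ⟨l, rfl⟩ | hi := eq_neg_natCast_or_pos i
    · simp only [neg_mul, one_mul, neg_neg, sub_zero, shiftCoeffInt_natCast]
      rw [← hup, shiftS_mul, shiftS_shiftS, neg_add_eq_sub, ← neg_sub, neg_add_cancel,
        shiftS_zero_index, mul_comm]
    · rw [shiftCoeffInt_of_neg (by dsimp only; omega), hwinvB i (by simpa using hi), zero_mul,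
        shiftS_zero]
  · ext1 i
    rw [mul_mono_apply, dualDownOp, leftOp, shiftS_shiftS, sub_add_cancel]
    obtain ⟨i, rfl⟩ : ∃ i', i = i' + 1 := ⟨i - 1, by ring⟩
    rw [add_sub_cancel_right]
    obtain ⟨l, rfl⟩ | hi := eq_natCast_or_neg i
    · simp only [one_mul, sub_zero, shiftCoeffInt_natCast]
      have h1 := congrArg (Fn.shiftS (l - 1)) (hdown l)
      rw [shiftS_mul, shiftS_shiftS, shiftS_shiftS, shiftS_shiftS, ← neg_sub, neg_add_cancel,
        shiftS_zero_index] at h1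
      rw [shiftCoeff_shiftS Time.tb_injective, shiftS_shiftS]
      rw [show (l : ℤ) + 1 = -(1 - l) + 2 by ring, mul_comm _ (Fn.shiftS _ τ), h1]
      congr 1
      ring
    · rw [shiftCoeffInt_of_neg (by dsimp only; omega), hwbinvB i (by simpa using hi), zero_mul,
        shiftS_zero]

end Forward

/-! ### Solutions of the bilinear equation are tau-functions -/

section Backward

theorem isUnit_of_constantCoeff_ne_zero {f : Fn 𝕜 σ}
    (hf : ∀ s : 𝕜, ((MvPowerSeries.constantCoeff f : SFun 𝕜) : 𝕜 → ℂ) s ≠ 0) : IsUnit f := by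
  rw [MvPowerSeries.isUnit_iff_constantCoeff]
  set c : SFun 𝕜 := MvPowerSeries.constantCoeff f
  refine IsUnit.of_mul_eq_one ⟨fun s => ((c : 𝕜 → ℂ) s)⁻¹, mem_SFun.2 ((contDiff_SFun c).inv hf)⟩ ?_
  exact Subtype.ext (funext fun s => mul_inv_cancel₀ (hf s))

variable {e : ℤˣ} {W Winv : Op 𝕜 m 1} {Wb Wbinv : Op 𝕜 m (-1)}
  {δ : Derivation ℂ (Fn 𝕜 (Var m)) (Fn 𝕜 (Var m))} {B : DiffOp 𝕜 m}

theorem eq_zero_of_bddBy {a : Op 𝕜 m e} (h : ∀ n : ℕ, BddBy e (-n) (a : DiffOp 𝕜 m)) : a = 0 :=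
  Op.ext fun i => h (-(e * i) + 1).toNat i (by omega)

/-- A right inverse of an operator with invertible leading coefficient is a left inverse: the
difference between `1` and the product in the other order is an idempotent with negative leading
power. -/
theorem inv_mul_of_mul_inv {V U : Op 𝕜 m e} (h : V * U = 1) (hV : BddBy e 0 (V : DiffOp 𝕜 m))
    (hV0 : IsUnit ((V : DiffOp 𝕜 m) 0)) : U * V = 1 := by
  have hU := bddBy_inv h hV hV0
  have h0 := leading_mul_inv h hV hU
  have hidem : (1 - U * V) * (1 - U * V) = 1 - U * V := by
    have h1 : (1 - U * V) * (1 - U * V) = 1 - U * V - U * V + U * (V * U) * V := by noncomm_ring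
    rw [h1, h]
    noncomm_ring
  have hneg : BddBy e (-1) ((1 - U * V : Op 𝕜 m e) : DiffOp 𝕜 m) := by
    intro i hi
    rw [Submodule.coe_sub, Pi.sub_apply, Op.coe_one]
    by_cases h1 : 0 < e * i
    · have h2 := hU.mul hV i (by simpa using h1)
      rw [Op.coe_mul, h2, sub_zero]
      exact Lam_apply_of_ne 0 (by rintro rfl; simp at h1)
    · obtain rfl : i = 0 := by
        refine unit_mul_injective e ?_
        dsimp only
        omega
      have h2 : BddBy e (e * 0) (U : DiffOp 𝕜 m) := by rwa [mul_zero]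
      have h3 := h2.mul_apply (j := 0) (B := V) (by rwa [mul_zero])
      rw [zero_add, shiftS_zero_index, mul_comm, h0] at h3
      rw [Op.coe_mul, h3, Lam_apply_self, sub_self]
  have hpow : ∀ n : ℕ, BddBy e (-(n + 1 : ℕ)) ((1 - U * V : Op 𝕜 m e) : DiffOp 𝕜 m) := by
    intro n
    induction n with
    | zero => exact hneg
    | succ n ih =>
      rw [← hidem]
      refine (ih.mul hneg).mono ?_
      push_cast
      omega
  exact (sub_eq_zero.1 (eq_zero_of_bddBy fun n => (hpow n).mono (by push_cast; omega))).symm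

theorem IsDressing.wave_flow (h : IsDressing k W Winv Wb Wbinv)
    (hneg : B.neg = -((opDer 1 δ W * Winv : Op 𝕜 m 1) : DiffOp 𝕜 m)) :
    (opDer 1 δ W : DiffOp 𝕜 m) = -mul B.neg W := by
  have h1 : -(-(opDer 1 δ W * Winv) * W) = opDer 1 δ W := by
    rw [neg_mul, neg_neg, mul_assoc, h.inv_mul, mul_one]
  rw [hneg]
  exact (congrArg Subtype.val h1).symm

theorem IsDressing.barWave_flow (h : IsDressing k W Winv Wb Wbinv)
    (hpos : B.pos = (opDer (-1) δ Wb * Wbinv : Op 𝕜 m (-1))) :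
    (opDer (-1) δ Wb : DiffOp 𝕜 m) = mul B.pos Wb := by
  have h1 : opDer (-1) δ Wb * Wbinv * Wb = opDer (-1) δ Wb := by
    rw [mul_assoc, h.bar_inv_mul, mul_one]
  rw [hpos]
  exact (congrArg Subtype.val h1).symm

theorem IsDressing.lax_flow (hδ : ∀ j f, δ (Fn.shiftS j f) = (δ f).shiftS j)
    (h : IsDressing k W Winv Wb Wbinv)
    (hpos : B.pos = (opDer (-1) δ Wb * Wbinv : Op 𝕜 m (-1))) :
    (opDer 1 δ (W * mono 1 1 k * Winv) : DiffOp 𝕜 m) =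
      comm B.pos (W * mono 1 1 k * Winv : Op 𝕜 m 1) := by
  have h1 := opDer_conj hδ h.bar_inv_mul h.bar_mul_inv
    (opDer_mono (e := -1) δ.map_one_eq_zero (-(m : ℤ)))
  have h2 := h.agree.opDer δ
  have h3 := h.agree
  rw [Agree] at h2 h3
  rw [h2, h3, h1, hpos]
  rfl

/-- The flow with respect to `x_0 = s` is automatic. -/
theorem isFlow_s (h : IsDressing k W Winv Wb Wbinv) : IsFlow W Winv Wb Wbinv (dSDer 𝕜 (Var m))
    (twoPowLog (upPow W Winv k) W Winv Wb Wbinv 0) := by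
  have h1 : upPow W Winv (0 * k) = 1 := by
    rw [upPow, zero_mul, Nat.cast_zero, mono_one_zero, mul_one, h.mul_inv]
  have h2 : downPow Wb Wbinv (0 * m) = 1 := by
    rw [downPow, zero_mul, Nat.cast_zero, neg_zero, mono_one_zero, mul_one, h.bar_mul_inv]
  rw [IsFlow, twoPowLog_eq h rfl, h1, h2, one_mul, one_mul, add_neg_cancel_left]

/-- Dressing operators that satisfy the flow equations give a solution of the hierarchy. -/
theorem IsDressing.isSolution (h : IsDressing k W Winv Wb Wbinv)
    (hW : BddBy 1 0 (W : DiffOp 𝕜 m)) (hW0 : (W : DiffOp 𝕜 m) 0 = 1)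
    (hWb : BddBy (-1) 0 (Wb : DiffOp 𝕜 m)) (hWb0 : IsUnit ((Wb : DiffOp 𝕜 m) 0))
    (htime : ∀ v, TimeRel k W Winv Wb Wbinv v) (hlog : ∀ l, LogRel k W Winv Wb Wbinv l) :
    IsSolution k (upPow W Winv k) (W : DiffOp 𝕜 m) Winv Wb Wbinv := by
  have hWinv : BddBy 1 0 (Winv : DiffOp 𝕜 m) :=
    bddBy_inv h.mul_inv hW (by rw [hW0]; exact isUnit_one)
  have hWbinv : BddBy (-1) 0 (Wbinv : DiffOp 𝕜 m) := bddBy_inv h.bar_mul_inv hWb hWb0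
  have hWinv0 : (Winv : DiffOp 𝕜 m) 0 = 1 := by
    have := leading_mul_inv h.mul_inv hW hWinv
    rwa [hW0, one_mul] at this
  have hWΛ : BddBy 1 (1 * k) ((W * mono 1 1 k : Op 𝕜 m 1) : DiffOp 𝕜 m) := by
    intro i hi
    rw [mul_mono_apply, hW _ (by simp at hi ⊢; exact hi), zero_mul]
  have hWbΛ : BddBy (-1) ((-1 : ℤˣ) * (-m : ℤ))
      ((Wb * mono (-1) 1 (-m) : Op 𝕜 m (-1)) : DiffOp 𝕜 m) := by
    intro i hi
    rw [mul_mono_apply, hWb _ (by simp at hi ⊢; omega), zero_mul]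
  have hagree : (upPow W Winv k : DiffOp 𝕜 m) = (Wb * mono (-1) 1 (-m) * Wbinv : Op 𝕜 m (-1)) :=
    h.agree
  have parts_t := fun n => ((timeRel_t_iff h n).1 (htime _)).parts hW hW0 hWinv hWb hWbinv
  have parts_tb := fun n => ((timeRel_tb_iff h n).1 (htime _)).parts hW hW0 hWinv hWb hWbinv
  have parts_x := fun l => ((logRel_iff_isFlow h l).1 (hlog l)).parts hW hW0 hWinv hWb hWbinv
  have parts_s := (isFlow_s h).parts hW hW0 hWinv hWb hWbinv
  have hs : Fn.dX (𝕜 := 𝕜) (m := m) 0 = Fn.dS := by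
    ext1 f
    rw [Fn.dX, dif_neg (lt_irrefl 0)]
  have hx : ∀ n : ℕ, n = 0 ∨ ∃ l : ℕ+, n = l := fun n =>
    n.eq_zero_or_pos.imp_right fun hn => ⟨⟨n, hn⟩, rfl⟩
  refine
    { lax := ⟨fun i hi => ?_, ?_, fun i hi => ?_, ?_⟩
      wave := ⟨hW0, fun i hi => hW i (by simpa using hi), bdd_one_iff.1 Winv.2,
        congrArg Subtype.val h.mul_inv, congrArg Subtype.val h.inv_mul⟩
      barWave := ⟨hWb0, fun i hi => hWb i (by simpa using hi), bdd_neg_one_iff.1 Wbinv.2,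
        congrArg Subtype.val h.bar_mul_inv, congrArg Subtype.val h.bar_inv_mul⟩
      dress := rfl
      barDress := hagree
      lax_t := fun n => IsDressing.lax_flow (timeDer_comm _) h (parts_t n).2
      lax_tbar := fun n => IsDressing.lax_flow (timeDer_comm _) h (parts_tb n).2
      lax_x := fun n => ?_
      wave_t := fun n => IsDressing.wave_flow h (parts_t n).1
      wave_tbar := fun n => IsDressing.wave_flow h (parts_tb n).1
      wave_x := fun n => ?_
      barWave_t := fun n => IsDressing.barWave_flow h (parts_t n).2
      barWave_tbar := fun n => IsDressing.barWave_flow h (parts_tb n).2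
      barWave_x := fun n => ?_ }
  · exact hWΛ.mul hWinv i (by simpa using hi)
  · have h1 := hWΛ.mul_apply (i := k) (j := 0) (B := Winv) (by simpa using hWinv)
    rw [add_zero, mul_mono_apply, sub_self, hW0, hWinv0, shiftS_one, shiftS_one, mul_one,
      mul_one] at h1
    exact h1
  · rw [hagree]
    exact hWbΛ.mul hWbinv i (by simp; omega)
  · have h1 := hWbΛ.mul_apply (i := -m) (j := 0) (B := Wbinv) (by simpa using hWbinv)
    rw [add_zero, mul_mono_apply, sub_self, shiftS_one, mul_one] at h1
    have h2 : IsUnit ((Wbinv : DiffOp 𝕜 m) 0) :=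
      isUnit_of_mul_isUnit_right (by rw [leading_mul_inv h.bar_mul_inv hWb hWbinv]; exact isUnit_one)
    rw [hagree, Op.coe_mul, h1]
    exact hWb0.mul (h2.map (MvPowerSeries.map (sShift (-m : ℤ))))
  · obtain rfl | ⟨l, rfl⟩ := hx n
    · rw [DiffOp.dX, hs]
      exact IsDressing.lax_flow sDer_comm h parts_s.2
    · rw [DiffOp.dX, Fn.dX_coe]
      exact IsDressing.lax_flow (timeDer_comm _) h (parts_x l).2
  · obtain rfl | ⟨l, rfl⟩ := hx n
    · rw [DiffOp.dX, hs]
      exact IsDressing.wave_flow h parts_s.1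
    · rw [DiffOp.dX, Fn.dX_coe]
      exact IsDressing.wave_flow h (parts_x l).1
  · obtain rfl | ⟨l, rfl⟩ := hx n
    · rw [DiffOp.dX, hs]
      exact IsDressing.barWave_flow h parts_s.2
    · rw [DiffOp.dX, Fn.dX_coe]
      exact IsDressing.barWave_flow h (parts_x l).2

theorem SatisfiesBilinear.isTauFunction {τ : Fn 𝕜 (Var m)} (hu : IsUnit τ)
    (h : SatisfiesBilinear k τ) : IsTauFunction k τ := by
  obtain ⟨τinv, hτ⟩ := hu.exists_left_inv
  have hτ' : τ.shiftS 1 * τinv.shiftS 1 = 1 := by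
    rw [mul_comm, ← shiftS_mul, hτ, shiftS_one]
  -- the four operators with symbols given by `τ`
  have hxB : BddBy 1 0 (upOp τ) := fun i hi =>
    shiftCoeffInt_of_neg (by simp at hi ⊢; omega) _ _
  have hxbB : BddBy (-1) 0 (downOp k τ) := fun i hi =>
    shiftCoeffInt_of_neg (by simp at hi ⊢; omega) _ _
  have hyB : BddBy 1 1 (dualUpOp τ) := fun i hi => by
    rw [dualUpOp, leftOp, shiftCoeffInt_of_neg (by simp at hi ⊢; omega), shiftS_zero]
  have hybB : BddBy (-1) (-1) (dualDownOp k τ) := fun i hi => by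
    rw [dualDownOp, leftOp, shiftCoeffInt_of_neg (by simp at hi ⊢; omega), shiftS_zero]
  have hx0 : upOp τ 0 = τ := (shiftCoeff_zero_index Time.t_injective (-1) τ)
  have hxb0 : downOp k τ 0 = τ.shiftS 1 := (shiftCoeff_zero_index Time.tb_injective 1 _)
  have hy1 : dualUpOp τ 1 = τ.shiftS 1 :=
    congrArg (Fn.shiftS 1) (shiftCoeff_zero_index Time.t_injective 1 τ)
  obtain ⟨x, hx⟩ : ∃ x : Op 𝕜 m 1, (x : DiffOp 𝕜 m) = upOp τ := ⟨⟨_, 0, hxB⟩, rfl⟩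
  obtain ⟨xb, hxb⟩ : ∃ x : Op 𝕜 m (-1), (x : DiffOp 𝕜 m) = downOp k τ := ⟨⟨_, 0, hxbB⟩, rfl⟩
  obtain ⟨y, hy⟩ : ∃ x : Op 𝕜 m 1, (x : DiffOp 𝕜 m) = dualUpOp τ := ⟨⟨_, 1, hyB⟩, rfl⟩
  obtain ⟨yb, hyb⟩ : ∃ x : Op 𝕜 m (-1), (x : DiffOp 𝕜 m) = dualDownOp k τ := ⟨⟨_, -1, hybB⟩, rfl⟩
  have hop0 := h.operators 0
  have hop1 := (h.operators 1).1
  rw [← hx] at hxB hx0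
  rw [← hxb] at hxbB hxb0
  rw [← hy] at hyB hy1
  rw [← hyb] at hybB
  rw [← hx, ← hxb, ← hy, ← hyb] at hop0 hop1
  simp only [Nat.cast_zero, zero_mul, neg_zero, mul_Lam_zero, Nat.cast_one, one_mul] at hop0 hop1
  obtain ⟨hxy, hder, hlog⟩ := hop0
  -- at `t' = t`, only one power of `Λ` is left
  have hone : ∀ i, i ≠ 1 → mul (x : DiffOp 𝕜 m) y i = 0 := by
    intro i hi
    obtain h1 | h1 := lt_or_gt_of_ne hi
    · rw [hxy]
      exact hxbB.mul hybB i (by simp; omega)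
    · exact hxB.mul hyB i (by simpa using h1)
  have hval : mul (x : DiffOp 𝕜 m) y 1 = τ * τ.shiftS 1 := by
    have h1 : BddBy 1 ((1 : ℤˣ) * 0) (x : DiffOp 𝕜 m) := by simpa using hxB
    have h2 := h1.mul_apply (j := 1) (B := y) (by simpa using hyB)
    rwa [zero_add, shiftS_zero_index, hx0, hy1] at h2
  have hprod : (x * y : Op 𝕜 m 1) = mono 1 (τ * τ.shiftS 1) 1 := Op.ext fun i => by
    by_cases hi : i = 1
    · rw [hi, mono_apply_self, Op.coe_mul, hval]
    · rw [mono_apply_of_ne _ hi, Op.coe_mul, hone i hi]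
  have hprodb : (xb * yb : Op 𝕜 m (-1)) = mono (-1) (τ * τ.shiftS 1) 1 :=
    Subtype.ext (hxy.symm.trans (congrArg Subtype.val hprod))
  have hmono : ∀ e : ℤˣ, (mono e τinv 0 * mono e (τ * τ.shiftS 1) 1 * mono e τinv (-1) : Op 𝕜 m e) =
      1 := fun e => by
    rw [mono_mul_mono, mono_mul_mono, shiftS_zero_index, ← mul_assoc, hτ, one_mul, zero_add, hτ']
    rfl
  have hcancel : ∀ e : ℤˣ, (mono e τinv 0 * mono e τ 0 : Op 𝕜 m e) = 1 := fun e => by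
    rw [mono_mul_mono, shiftS_zero_index, hτ]
    rfl
  set W : Op 𝕜 m 1 := mono 1 τinv 0 * x with hWdef
  set Winv : Op 𝕜 m 1 := y * mono 1 τinv (-1) with hWinvdef
  set Wb : Op 𝕜 m (-1) := mono (-1) τinv 0 * xb with hWbdef
  set Wbinv : Op 𝕜 m (-1) := yb * mono (-1) τinv (-1) with hWbinvdef
  have hτmul : τ * τinv = 1 := by rw [mul_comm, hτ]
  have hW : ∀ i, τ * (W : DiffOp 𝕜 m) i = (x : DiffOp 𝕜 m) i := fun i => by
    rw [hWdef, mono_zero_mul_apply, ← mul_assoc, hτmul, one_mul]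
  have hWb : ∀ i, τ * (Wb : DiffOp 𝕜 m) i = (xb : DiffOp 𝕜 m) i := fun i => by
    rw [hWbdef, mono_zero_mul_apply, ← mul_assoc, hτmul, one_mul]
  have hWB : BddBy 1 0 (W : DiffOp 𝕜 m) := fun i hi => by
    rw [hWdef, mono_zero_mul_apply, hxB i hi, mul_zero]
  have hWbB : BddBy (-1) 0 (Wb : DiffOp 𝕜 m) := fun i hi => by
    rw [hWbdef, mono_zero_mul_apply, hxbB i hi, mul_zero]
  have hW0 : (W : DiffOp 𝕜 m) 0 = 1 := by rw [hWdef, mono_zero_mul_apply, hx0, hτ]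
  have hWb0 : IsUnit ((Wb : DiffOp 𝕜 m) 0) := by
    rw [hWbdef, mono_zero_mul_apply, hxb0]
    exact (IsUnit.of_mul_eq_one _ hτ).mul (IsUnit.of_mul_eq_one _ hτ')
  have hassoc : ∀ {R : Type _} [Ring R] (a b c d z : R), a * b * z * (c * d) = a * (b * z * c) * d :=
    fun a b c d z => by noncomm_ring
  have hWW : W * Winv = 1 := by
    have h1 := hassoc (mono 1 τinv 0) x y (mono 1 τinv (-1)) 1
    rwa [mul_one, mul_one, hprod, hmono] at h1
  have hWbWb : Wb * Wbinv = 1 := by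
    have h1 := hassoc (mono (-1) τinv 0) xb yb (mono (-1) τinv (-1)) 1
    rwa [mul_one, mul_one, hprodb, hmono] at h1
  have hdress : IsDressing k W Winv Wb Wbinv := by
    refine ⟨hWW, inv_mul_of_mul_inv hWW hWB (by rw [hW0]; exact isUnit_one), hWbWb,
      inv_mul_of_mul_inv hWbWb hWbB hWb0, ?_⟩
    rw [hWdef, hWinvdef, hWbdef, hWbinvdef, hassoc, hassoc]
    have h1 : Agree (x * mono 1 1 k * y) (xb * mono (-1) 1 (-m) * yb) := by
      rw [Agree, Op.coe_mul, Op.coe_mul, Op.coe_mul, Op.coe_mul, coe_mono_one, coe_mono_one, hop1]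
    exact ((agree_mono τinv 0).mul h1).mul (agree_mono τinv (-1))
  -- a relation between operators of the form `A X⁻¹` follows from one between `A Y`
  have hright : ∀ {a : Op 𝕜 m 1} {b : Op 𝕜 m (-1)}, mul (a : DiffOp 𝕜 m) y = mul (b : DiffOp 𝕜 m) yb →
      Agree (a * Winv) (b * Wbinv) := by
    intro a b hab
    rw [hWinvdef, hWbinvdef, ← mul_assoc, ← mul_assoc]
    exact Agree.mul (a := a * y) (b := b * yb) hab (agree_mono τinv (-1))
  have hleft : ∀ {a : Op 𝕜 m 1} {b : Op 𝕜 m (-1)}, Agree (mono 1 τ 0 * a) (mono (-1) τ 0 * b) →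
      Agree a b := by
    intro a b hab
    have h1 := (agree_mono τinv 0).mul hab
    rwa [← mul_assoc, ← mul_assoc, hcancel, hcancel, one_mul, one_mul] at h1
  have hxW : x * Winv = mono 1 τ 0 := by
    have h1 : x = mono 1 τ 0 * W := Op.ext fun i => by rw [mono_zero_mul_apply, hW]
    rw [h1, mul_assoc, hWW, mul_one]
  have hxbW : xb * Wbinv = mono (-1) τ 0 := by
    have h1 : xb = mono (-1) τ 0 * Wb := Op.ext fun i => by rw [mono_zero_mul_apply, hWb]
    rw [h1, mul_assoc, hWbWb, mul_one]
  refine ⟨_, _, _, _, _, hdress.isSolution hWB hW0 hWbB hWb0 (fun v => ?_) (fun l => ?_),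
    fun i => ?_, fun i => ?_⟩
  · have h1 := hder v
    rw [coe_timeD, coe_barTimeD] at h1
    have h2 := hright h1
    rw [opDer_add_smul_mul_inv (timeDer_comm (Var.time v)) hdress.inv_mul hWW,
      opDer_sub_smul_mul_inv (timeDer_comm (Var.time v)) hdress.bar_inv_mul hWbWb, hxW, hxbW] at h2
    have h3 := h2.sub ((agree_mono τ 0).opDer (dVarDer 𝕜 (Var.time v)))
    rw [add_sub_cancel_left, add_sub_cancel_left] at h3
    exact hleft h3
  · have h1 := hlog l
    rw [coe_logD, coe_logD] at h1
    have h2 := hright h1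
    rw [opDer_sub_mul_inv (timeDer_comm (Var.x l)) sDer_comm hdress.inv_mul hWW,
      opDer_sub_mul_inv (timeDer_comm (Var.x l)) sDer_comm hdress.bar_inv_mul hWbWb, hxW, hxbW] at h2
    have h4 : Agree (W * mono 1 1 (k * l) * Winv) (Wb * mono (-1) 1 (-(m * l)) * Wbinv) := by
      rw [mul_comm, mul_comm (m : ℤ)]
      exact hdress.agree_pow l
    have h3 := h2.sub (((agree_mono τ 0).opDer (dVarDer 𝕜 (Var.x l))).sub
      (((agree_mono τ 0).opDer (dSDer 𝕜 (Var m))).mul h4))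
    rw [add_sub_cancel_left, add_sub_cancel_left] at h3
    exact hleft h3
  · rw [hW, hx, upOp, rightOp]
    simp only [neg_mul, one_mul, neg_neg, sub_zero, shiftCoeffInt_natCast]
    rfl
  · rw [hWb, hxb, downOp, rightOp]
    simp only [one_mul, sub_zero, shiftCoeffInt_natCast]
    rfl

end Backward

end

end EBTH

theorem theorem2p6 {𝕜 : Type*} [RCLike 𝕜] [NormedAlgebra 𝕜 ℂ] (k m : ℕ+)
    (τ : EBTH.Fn 𝕜 (EBTH.Var m))
    (hτ : ∀ s : 𝕜, ((MvPowerSeries.constantCoeff τ : EBTH.SFun 𝕜) : 𝕜 → ℂ) s ≠ 0) :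
    EBTH.IsTauFunction k τ ↔ EBTH.SatisfiesBilinear k τ :=
  have hu := EBTH.isUnit_of_constantCoeff_ne_zero hτ
  ⟨EBTH.IsTauFunction.satisfiesBilinear hu, EBTH.SatisfiesBilinear.isTauFunction hu⟩
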